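/- Notation and definitions. For an entire function $f$ put $f^{*}(z)=\overline{f(\bar z)}$. The class $\mathcal{HB}$ consists of the entire functions $E$ with $|E(\bar z)|<|E(z)|$ whenever $\operatorname{Im} z>0$. A function is of bounded type in $\mathbb{C}^{+}=\{\operatorname{Im} z>0\}$ if it is analytic there and is a quotient of two bounded analytic functions on $\mathbb{C}^{+}$; its mean type is $\limsup_{y\to+\infty} y^{-1}\log|f(iy)|$. For $E\in\mathcal{HB}$, the de Branges space $\mathcal{H}(E)$ is the set of entire functions $f$ such that $\|f\|_{E}^{2}=\int_{\mathbb{R}}|f(t)/E(t)|^{2}\,dt<\infty$ and $f/E$, $f^{*}/E$ are of bounded type and nonpositive mean type in $\mathbb{C}^{+}$. Its reproducing kernel is $$K_{E}(w,z)=\frac{\overline{E(w)}E(z)-E(\bar w)E^{*}(z)}{2\pi i(\bar w-z)},$$ extended by its limit at $z=\bar w$. We write $\mathcal{H}(E_{0})=\mathcal{H}(E)$ if the two spaces coincide as sets and their norms are equivalent. A phase function of $E$ is a continuous, strictly increasing $\varphi_{E}:\mathbb{R}\to\mathbb{R}$ with $E(x)=|E(x)|e^{-i\varphi_{E}(x)}$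 for all $x\in\mathbb{R}$. A set $\Lambda$ is a normalized sampling set for $\mathcal{H}(E)$ if $\Lambda\subset\mathbb{R}$ and there are constants $A,B>0$ such that for all $f\in\mathcal{H}(E)$ $$A\|f\|_{E}^{2}\le\sum_{\lambda\in\Lambda}\frac{|f(\lambda)|^{2}}{K_{E}(\lambda,\lambda)}\le B\|f\|_{E}^{2}.$$ Corollary. Let $E_{0},E,F\in\mathcal{HB}$ have no real zeros. Suppose that $\mathcal{H}(E_{0})=\mathcal{H}(E)$, and that $\varphi_{F}'\lesssim\varphi_{E}'$, that is, there is a constant $C>0$ with $\varphi_{F}'(x)\le C\varphi_{E}'(x)$ for all $x\in\mathbb{R}$, where $\varphi_{E},\varphi_{F}$ are phase functions of $E$ and $F$. Then the zero set of $EF+E^{*}F^{*}$ in $\mathbb{C}$ is a normalized sampling set for $\mathcal{H}(E_{0})$ (in particular, all its zeros are real). -/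

import Mathlib

namespace DeBranges

open Filter Topology MeasureTheory
open scoped ComplexConjugate

noncomputable section

/-- The open upper half-plane, as a subset of the complex plane. -/
def upperHalf : Set ℂ := {z | 0 < z.im}

/-- The function `f*`, `f*(z) = conj (f (conj z))`. -/
def sharp (f : ℂ → ℂ) : ℂ → ℂ := fun z => conj (f (conj z))

/-- The Hermite-Biehler class: entire functions with `|E (conj z)| < |E z|` for `Im z > 0`. -/
def HermiteBiehler (E : ℂ → ℂ) : Prop :=
  Differentiable ℂ E ∧ ∀ z : ℂ, 0 < z.im → ‖E (conj z)‖ < ‖E z‖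

/-- `E` has no zeros on the real axis. -/
def NoRealZeros (E : ℂ → ℂ) : Prop := ∀ x : ℝ, E x ≠ 0

/-- `g` is bounded and analytic in the open upper half-plane. -/
def BoundedAnalytic (g : ℂ → ℂ) : Prop :=
  DifferentiableOn ℂ g upperHalf ∧ ∃ M : ℝ, ∀ z ∈ upperHalf, ‖g z‖ ≤ M

/-- `f` is analytic and of bounded type in the upper half-plane: it is a quotient `p / q` of two
bounded analytic functions, where `q` does not vanish identically. -/
def BoundedType (f : ℂ → ℂ) : Prop :=
  DifferentiableOn ℂ f upperHalf ∧
    ∃ p q : ℂ → ℂ, BoundedAnalytic p ∧ BoundedAnalytic q ∧ (∃ z ∈ upperHalf, q z ≠ 0) ∧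
      ∀ z ∈ upperHalf, f z * q z = p z

/-- The mean type `limsup_{y → +∞} log |f (i y)| / y` in the upper half-plane, an extended real
number (with `log 0 = -∞`). -/
def meanType (f : ℂ → ℂ) : EReal :=
  limsup (fun y : ℝ => ENNReal.log ‖f (y * Complex.I)‖ₑ / (y : EReal)) atTop

/-- The underlying set of the de Branges space `H(E)`. -/
def space (E : ℂ → ℂ) : Set (ℂ → ℂ) :=
  {f | Differentiable ℂ f ∧
    Integrable (fun t : ℝ => ‖f t / E t‖ ^ 2) ∧
    BoundedType (fun z => f z / E z) ∧ meanType (fun z => f z / E z) ≤ 0 ∧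
    BoundedType (fun z => sharp f z / E z) ∧ meanType (fun z => sharp f z / E z) ≤ 0}

/-- The squared norm of `H(E)`. -/
def normSq (E f : ℂ → ℂ) : ℝ := ∫ t : ℝ, ‖f t / E t‖ ^ 2

/-- `H(E₁) = H(E₂)`: the spaces coincide as sets and their norms are equivalent. -/
def SameSpace (E₁ E₂ : ℂ → ℂ) : Prop :=
  space E₁ = space E₂ ∧
    ∃ c C : ℝ, 0 < c ∧ 0 < C ∧
      ∀ f ∈ space E₁, c * normSq E₁ f ≤ normSq E₂ f ∧ normSq E₂ f ≤ C * normSq E₁ f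

/-- The numerator of the reproducing kernel. It vanishes at `z = conj w`. -/
def kernelNum (E : ℂ → ℂ) (w z : ℂ) : ℂ := conj (E w) * E z - E (conj w) * sharp E z

/-- The reproducing kernel `K_E(w, z)` of `H(E)`, extended to the removable singularity
`z = conj w` by its limit. -/
def kernel (E : ℂ → ℂ) (w z : ℂ) : ℂ :=
  if z = conj w then -deriv (kernelNum E w) (conj w) / (2 * Real.pi * Complex.I)
  else kernelNum E w z / (2 * Real.pi * Complex.I * (conj w - z))

/-- `φ` is a phase function of `E`. -/
def IsPhase (E : ℂ → ℂ) (φ : ℝ → ℝ) : Prop :=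
  Continuous φ ∧ StrictMono φ ∧ ∀ x : ℝ, E x = ‖E x‖ * Complex.exp (-Complex.I * φ x)

/-- The family `(lam n)` of real numbers is a normalized sampling sequence for `H(E)`. The number
`K_E(x, x)` is real for real `x`. -/
def NormalizedSampling (E : ℂ → ℂ) {ι : Type*} (lam : ι → ℝ) : Prop :=
  ∃ A B : ℝ, 0 < A ∧ 0 < B ∧ ∀ f ∈ space E,
    Summable (fun n => ‖f (lam n)‖ ^ 2 / (kernel E (lam n) (lam n)).re) ∧
    A * normSq E f ≤ ∑' n, ‖f (lam n)‖ ^ 2 / (kernel E (lam n) (lam n)).re ∧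
    ∑' n, ‖f (lam n)‖ ^ 2 / (kernel E (lam n) (lam n)).re ≤ B * normSq E f

/-- The set `Λ` of complex numbers consists of real numbers, and these, each taken once, form a
normalized sampling sequence for `H(E)`. -/
def NormalizedSamplingSet (E : ℂ → ℂ) (Λ : Set ℂ) : Prop :=
  (∀ z ∈ Λ, z.im = 0) ∧ NormalizedSampling E (fun z : Λ => (z : ℂ).re)

/-- The zero set, in the complex plane, of an entire function. -/
def zeroSet (G : ℂ → ℂ) : Set ℂ := {z | G z = 0}

end

end DeBranges

namespace DeBranges

open Filter Topology MeasureTheory Metric Set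
open scoped ComplexConjugate InnerProductSpace

/-! Put `B = E F`, again a Hermite-Biehler function. Since `f F / (E F) = f / E`, multiplication by
`F` embeds H(E) isometrically into H(B); inside L²(ℝ), with f represented by f/E, the embedding is
an inclusion of closed subspaces M ≤ N. The zeros of `B + B*` are real and simple, and the
normalized kernels of H(B) at these zeros are orthonormal, so Bessel's inequality gives the upper
sampling bound for `f F`.

For the lower bound, a function in H(B) vanishing at all these zeros is a multiple of `B + B*`, so
the orthonormal family has defect at most one in N. The defect does not meet M: if `f F = c (E F +
E* F*)` with c ≠ 0, then F has no zeros, `F*/F` is an exponential decaying along the positive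
imaginary axis, and hence f/E tends to c there, whereas Hardy class estimates force f/E to tend to
0. A line outside the closed subspace M makes a positive angle with it, which is the lower bound
(`Orthonormal.exists_lower_bound`, `exists_sampling_bounds`).

It remains to change weights. On the diagonal `K_B = |F|² K_E + |E|² K_F`, and `K_E(x,x) = φ_E'(x)
|E(x)|² / π`. The hypothesis on the phases makes K_B comparable to |F|² K_E, and equivalence of
norms makes K_E comparable to K_{E₀}.

The analytic input is that bounded type, nonpositive mean type and square integrability on the line
give a pointwise bound by `‖f‖ / √(4π y)` for f/E and f*/E (`isHardy_of_boundedType`,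
`IsHardy.sq_norm_le`). It comes from Harnack's inequality, Cauchy's theorem on rectangles with a
damping multiplier, and the Phragmén–Lindelöf principle. The reproducing formula, closedness in L²
and the description of the defect all rest on it. -/

/-! ### Harnack's inequality and quotients of bounded functions in a disc. -/

theorem harnack_closedBall {u : ℂ → ℝ} {R : ℝ} {w : ℂ}
    (hu : InnerProductSpace.HarmonicOnNhd u (closedBall 0 R)) (hpos : ∀ z ∈ sphere (0 : ℂ) R, 0 ≤ u z)
    (hw : w ∈ ball (0 : ℂ) R) :
    (R - ‖w‖) / (R + ‖w‖) * u 0 ≤ u w ∧ u w ≤ (R + ‖w‖) / (R - ‖w‖) * u 0 := by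
  have hR : 0 < R := pos_of_mem_ball hw
  have hR' : |R| = R := abs_of_pos hR
  have hwR : ‖w‖ < R := by simpa using hw
  have hP := hu.circleAverage_re_herglotzRieszKernel_smul hw
  have h0 : Real.circleAverage u 0 R = u 0 :=
    InnerProductSpace.HarmonicOnNhd.circleAverage_eq (by rwa [hR'])
  have hcu : ContinuousOn u (sphere 0 R) := fun z hz =>
    (hu z (sphere_subset_closedBall hz)).1.continuousAt.continuousWithinAt
  have hcK : ContinuousOn (Complex.re ∘ herglotzRieszKernel 0 w) (sphere 0 R) := by
    refine Complex.continuous_re.comp_continuousOn ?_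
    rw [herglotzRieszKernel_fun_def]
    refine ContinuousOn.div (by fun_prop) (by fun_prop) fun z hz h => ?_
    have : z = w := by simpa [sub_eq_zero] using h
    subst this
    simp at hz; linarith
  have hi1 : CircleIntegrable ((Complex.re ∘ herglotzRieszKernel 0 w) • u) 0 R :=
    (hcK.smul hcu).circleIntegrable hR.le
  have hi2 : ∀ c : ℝ, CircleIntegrable (c • u) 0 R := fun c =>
    (hcu.const_smul c).circleIntegrable hR.le
  rw [← hP]
  conv_lhs => rw [← h0]
  conv_rhs => rw [← h0]
  rw [← smul_eq_mul, ← smul_eq_mul, ← Real.circleAverage_smul, ← Real.circleAverage_smul]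
  constructor
  · refine Real.circleAverage_mono (hi2 _) hi1 fun z hz => ?_
    rw [hR'] at hz
    have := le_re_herglotzRieszKernel hz hw
    simp only [sub_zero] at this
    simpa [herglotzRieszKernel_def] using mul_le_mul_of_nonneg_right this (hpos z hz)
  · refine Real.circleAverage_mono hi1 (hi2 _) fun z hz => ?_
    rw [hR'] at hz
    have := re_herglotzRieszKernel_le hz hw
    simp only [sub_zero] at this
    simpa [herglotzRieszKernel_def] using mul_le_mul_of_nonneg_right this (hpos z hz)

/-- Apply the closed version on radii r < R and let r → R. No regularity on the circle is assumed
because the functions `-log ‖T‖` used below may be singular there. -/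
theorem harnack_ball {u : ℂ → ℝ} {R : ℝ} {w : ℂ}
    (hu : InnerProductSpace.HarmonicOnNhd u (ball 0 R)) (hpos : ∀ z ∈ ball (0 : ℂ) R, 0 ≤ u z)
    (hw : w ∈ ball (0 : ℂ) R) :
    (R - ‖w‖) / (R + ‖w‖) * u 0 ≤ u w ∧ u w ≤ (R + ‖w‖) / (R - ‖w‖) * u 0 := by
  have hR : 0 < R := pos_of_mem_ball hw
  have hwR : ‖w‖ < R := by simpa using hw
  have key : ∀ᶠ r in 𝓝[<] R, (r - ‖w‖) / (r + ‖w‖) * u 0 ≤ u w ∧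
      u w ≤ (r + ‖w‖) / (r - ‖w‖) * u 0 := by
    filter_upwards [Ioo_mem_nhdsLT hwR] with r hr
    refine harnack_closedBall (hu.mono (closedBall_subset_ball hr.2))
      (fun z hz => hpos z (sphere_subset_ball hr.2 hz)) (by simpa using hr.1)
  have hn := norm_nonneg w
  constructor
  · have hc : ContinuousAt (fun r : ℝ => (r - ‖w‖) / (r + ‖w‖) * u 0) R := by
      refine ContinuousAt.mul (ContinuousAt.div (by fun_prop) (by fun_prop) (by positivity))
        continuousAt_const
    exact le_of_tendsto (hc.tendsto.mono_left nhdsWithin_le_nhds) (key.mono fun _ h => h.1)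
  · have hc : ContinuousAt (fun r : ℝ => (r + ‖w‖) / (r - ‖w‖) * u 0) R := by
      refine ContinuousAt.mul (ContinuousAt.div (by fun_prop) (by fun_prop) (by linarith))
        continuousAt_const
    exact ge_of_tendsto (hc.tendsto.mono_left nhdsWithin_le_nhds) (key.mono fun _ h => h.2)

/-- The Blaschke reflection: on the circle the factor `z - u` can be traded for one whose zero `R² /
conj u` lies outside the open disc. -/
theorem norm_sub_eq_of_norm_eq {R : ℝ} (hR : 0 < R) {z u : ℂ} (hz : ‖z‖ = R) :
    ‖(R : ℂ) - conj u * z / R‖ = ‖z - u‖ := by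
  have h1 : (R : ℂ) * ((R : ℂ) - conj u * z / R) = conj (z - u) * z := by
    have : conj z * z = (R : ℂ) ^ 2 := by
      rw [mul_comm, Complex.mul_conj, Complex.normSq_eq_norm_sq, hz]; push_cast; ring
    have hR' : (R : ℂ) ≠ 0 := by exact_mod_cast hR.ne'
    field_simp
    rw [map_sub]
    linear_combination -this
  have h2 := congrArg norm h1
  simp only [norm_mul, Complex.norm_real, Real.norm_eq_abs, abs_of_pos hR, RCLike.norm_conj, hz] at h2
  rw [mul_comm] at h2
  exact mul_right_cancel₀ hR.ne' h2

/-- A function analytic on a closed disc has the same modulus on the boundary circle as one without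
zeros in the open disc. -/
theorem exists_zeroFree_of_analyticOnNhd {R : ℝ} (hR : 0 < R) {Q : ℂ → ℂ}
    (hQ : AnalyticOnNhd ℂ Q (closedBall 0 R)) (h0 : Q 0 ≠ 0) :
    ∃ T : ℂ → ℂ, AnalyticOnNhd ℂ T (closedBall 0 R) ∧ (∀ z ∈ ball (0 : ℂ) R, T z ≠ 0) ∧
      (∀ z ∈ sphere (0 : ℂ) R, ‖T z‖ = ‖Q z‖) ∧ ‖Q 0‖ ≤ ‖T 0‖ := by
  have hfin : (MeromorphicOn.divisor Q (closedBall 0 R)).support.Finite :=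
    (MeromorphicOn.divisor Q (closedBall 0 R)).finiteSupport (isCompact_closedBall 0 R)
  have hord : ∀ u : closedBall (0 : ℂ) R, meromorphicOrderAt Q u ≠ ⊤ := by
    have hconn : IsPreconnected (closedBall (0 : ℂ) R) := (convex_closedBall 0 R).isPreconnected
    have h00 : meromorphicOrderAt Q 0 ≠ ⊤ := by
      have : AnalyticAt ℂ Q 0 := hQ 0 (by simp [hR.le])
      rw [this.meromorphicOrderAt_eq, this.analyticOrderAt_eq_zero.mpr h0]
      simp
    intro u
    exact MeromorphicOn.meromorphicOrderAt_ne_top_of_isPreconnected hQ.meromorphicOn hconn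
      (by simp [hR.le]) u.2 h00
  obtain ⟨g, hg, hg0, hQg⟩ := hQ.meromorphicOn.extract_zeros_poles hord hfin
  set D := MeromorphicOn.divisor Q (closedBall 0 R) with hD
  have hDnn : ∀ u, 0 ≤ D u := fun u => hQ.meromorphicNFOn.divisor_nonneg_iff_analyticOnNhd.2 hQ u
  have hprod : ∀ z, (∏ᶠ u, (· - u) ^ D u : ℂ → ℂ) z = ∏ u ∈ hfin.toFinset, (z - u) ^ (D u).toNat := by
    intro z
    rw [finprod_eq_prod_of_mulSupport_subset (s := hfin.toFinset)]
    · rw [Finset.prod_apply]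
      refine Finset.prod_congr rfl fun u _ => ?_
      simp only [Pi.pow_apply]
      conv_lhs => rw [← Int.toNat_of_nonneg (hDnn u), zpow_natCast]
    · intro u hu
      simp only [Set.Finite.coe_toFinset, Function.mem_support]
      intro h
      exact hu (by simp [h])
  have heq : ∀ z ∈ closedBall (0 : ℂ) R, Q z = (∏ u ∈ hfin.toFinset, (z - u) ^ (D u).toNat) * g z := by
    intro z hz
    -- The factorization is only known off a discrete subset of the disc; the identity principle at
    -- each point extends it to the whole closed disc.
    have hacc : AccPt z (𝓟 (closedBall (0 : ℂ) R)) := by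
      have hpre : Preperfect (closedBall (0 : ℂ) R) := by
        rw [← closure_ball (0 : ℂ) hR.ne']
        exact (isOpen_ball.preperfect).perfect_closure.acc
      exact hpre z hz
    rw [accPt_iff_frequently_nhdsNE] at hacc
    have h1 : ∀ᶠ y in 𝓝[≠] z, y ∈ closedBall (0 : ℂ) R → Q y = ((∏ᶠ u, (· - u) ^ D u : ℂ → ℂ) • g) y := by
      have := mem_codiscreteWithin.1 hQg z hz
      rw [disjoint_principal_right] at this
      filter_upwards [this] with y hy hyb
      by_contra hne
      exact hy ⟨hyb, hne⟩
    have h2 : ∃ᶠ y in 𝓝[≠] z, Q y = (∏ u ∈ hfin.toFinset, (y - u) ^ (D u).toNat) * g y := by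
      refine (hacc.and_eventually h1).mono fun y hy => ?_
      rw [hy.2 hy.1, Pi.smul_apply', hprod, smul_eq_mul]
    have hc1 : AnalyticAt ℂ Q z := hQ z hz
    have hc2 : AnalyticAt ℂ (fun y => (∏ u ∈ hfin.toFinset, (y - u) ^ (D u).toNat) * g y) z := by
      have := hg z hz
      fun_prop
    exact ((hc1.frequently_eq_iff_eventually_eq hc2).1 h2).self_of_nhds
  -- Every factor `z - u` is replaced by its reflection. At the origin this replaces |u| by R ≥ |u|,
  -- which is the last claim.
  refine ⟨fun z => (∏ u ∈ hfin.toFinset, ((R : ℂ) - conj u * z / R) ^ (D u).toNat) * g z,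
    ?_, ?_, ?_, ?_⟩
  · intro z hz
    have := hg z hz
    have hR' : (R : ℂ) ≠ 0 := by exact_mod_cast hR.ne'
    fun_prop
  · intro z hz
    refine mul_ne_zero (Finset.prod_ne_zero_iff.2 fun u hu => pow_ne_zero _ ?_)
      (hg0 ⟨z, ball_subset_closedBall hz⟩)
    have huR : ‖u‖ ≤ R := by
      have : u ∈ closedBall (0 : ℂ) R := D.supportWithinDomain (by simpa using hu)
      simpa using this
    have hzR : ‖z‖ < R := by simpa using hz
    intro h
    have h3 : conj u * z / R = R := (sub_eq_zero.1 h).symm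
    have h4 := congrArg norm h3
    simp only [norm_div, norm_mul, RCLike.norm_conj, Complex.norm_real, Real.norm_eq_abs,
      abs_of_pos hR] at h4
    rw [div_eq_iff hR.ne'] at h4
    nlinarith [norm_nonneg u, norm_nonneg z]
  · intro z hz
    rw [heq z (sphere_subset_closedBall hz), norm_mul, norm_mul, norm_prod, norm_prod]
    congr 1
    refine Finset.prod_congr rfl fun u _ => ?_
    rw [norm_pow, norm_pow, norm_sub_eq_of_norm_eq hR (by simpa using hz)]
  · rw [heq 0 (by simp [hR.le]), norm_mul, norm_mul, norm_prod, norm_prod]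
    refine mul_le_mul_of_nonneg_right (Finset.prod_le_prod (fun _ _ => norm_nonneg _) fun u hu => ?_)
      (norm_nonneg _)
    have huR : ‖u‖ ≤ R := by
      have : u ∈ closedBall (0 : ℂ) R := D.supportWithinDomain (by simpa using hu)
      simpa using this
    rw [norm_pow, norm_pow]
    refine pow_le_pow_left₀ (norm_nonneg _) ?_ _
    simpa [abs_of_pos hR] using huR

/-- A quotient of functions bounded by one in a disc grows at most exponentially in the reciprocal
of the distance to the boundary. -/
theorem norm_le_exp_of_mul_eq_closedBall {R : ℝ} {P Q G : ℂ → ℂ}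
    (hQ : AnalyticOnNhd ℂ Q (closedBall 0 R)) (hG : AnalyticOnNhd ℂ G (closedBall 0 R))
    (h : ∀ z ∈ closedBall (0 : ℂ) R, G z * Q z = P z)
    (hP1 : ∀ z ∈ closedBall (0 : ℂ) R, ‖P z‖ ≤ 1) (hQ1 : ∀ z ∈ closedBall (0 : ℂ) R, ‖Q z‖ ≤ 1)
    (h0 : Q 0 ≠ 0) {w : ℂ} (hw : w ∈ ball (0 : ℂ) R) :
    ‖G w‖ ≤ Real.exp ((R + ‖w‖) / (R - ‖w‖) * (-Real.log ‖Q 0‖)) := by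
  have hR : 0 < R := pos_of_mem_ball hw
  have hwR : ‖w‖ < R := by simpa using hw
  obtain ⟨T, hT, hT0, hTs, hTQ⟩ := exists_zeroFree_of_analyticOnNhd hR hQ h0
  have hmax : ∀ {f : ℂ → ℂ}, AnalyticOnNhd ℂ f (closedBall 0 R) →
      (∀ z ∈ sphere (0 : ℂ) R, ‖f z‖ ≤ 1) → ∀ z ∈ closedBall (0 : ℂ) R, ‖f z‖ ≤ 1 := by
    intro f hf hfs z hz
    refine Complex.norm_le_of_forall_mem_frontier_norm_le (U := ball (0 : ℂ) R) isBounded_ball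
      ?_ (fun y hy => ?_) ?_
    · refine DifferentiableOn.diffContOnCl ?_
      rw [closure_ball (0 : ℂ) hR.ne']
      exact hf.differentiableOn
    · rw [frontier_ball (0 : ℂ) hR.ne'] at hy
      exact hfs y hy
    · rwa [closure_ball (0 : ℂ) hR.ne']
  have hT1 := hmax hT fun z hz => (hTs z hz).trans_le (hQ1 z (sphere_subset_closedBall hz))
  -- On the circle |G T| = |G Q| = |P| ≤ 1, so G is bounded by 1/|T|, and T has no zeros inside.
  have hGT := hmax (hG.mul hT) fun z hz => by
    simp only [norm_mul, hTs z hz]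
    rw [← norm_mul, h z (sphere_subset_closedBall hz)]
    exact hP1 z (sphere_subset_closedBall hz)
  have hharm : InnerProductSpace.HarmonicOnNhd (fun z => -Real.log ‖T z‖) (ball 0 R) := by
    have : InnerProductSpace.HarmonicOnNhd (fun z => Real.log ‖T z‖) (ball 0 R) := fun z hz =>
      (hT z (ball_subset_closedBall hz)).harmonicAt_log_norm (hT0 z hz)
    exact this.neg
  have hpos : ∀ z ∈ ball (0 : ℂ) R, 0 ≤ -Real.log ‖T z‖ := fun z hz => by
    have := Real.log_nonpos (norm_nonneg _) (hT1 z (ball_subset_closedBall hz))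
    linarith
  have hH := (harnack_ball hharm hpos hw).2
  have hTw : 0 < ‖T w‖ := norm_pos_iff.2 (hT0 w hw)
  have h1 : ‖G w‖ * ‖T w‖ ≤ 1 := by
    simpa using hGT w (ball_subset_closedBall hw)
  have h2 : ‖G w‖ ≤ Real.exp (-Real.log ‖T w‖) := by
    rw [Real.exp_neg, Real.exp_log hTw, ← one_div, le_div_iff₀ hTw]
    exact h1
  refine h2.trans (Real.exp_le_exp.2 (hH.trans ?_))
  refine mul_le_mul_of_nonneg_left ?_ (div_nonneg (by positivity) (by linarith))
  have := Real.log_le_log (norm_pos_iff.2 h0) hTQ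
  linarith

/-! ### Transfer to the upper half-plane: growth of bounded type functions. -/

/-- The conformal map of the unit disc onto the upper half-plane that takes `0` to `a`. -/
noncomputable def cayley (a ζ : ℂ) : ℂ := (a - conj a * ζ) / (1 - ζ)

theorem one_sub_ne_zero_of_norm_lt {ζ : ℂ} (hζ : ‖ζ‖ < 1) : 1 - ζ ≠ 0 := by
  intro h
  rw [← sub_eq_zero.1 h] at hζ
  simp at hζ

theorem cayley_im_pos {a ζ : ℂ} (ha : 0 < a.im) (hζ : ‖ζ‖ < 1) : 0 < (cayley a ζ).im := by
  have h1 := one_sub_ne_zero_of_norm_lt hζ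
  have h2 : (cayley a ζ).im = a.im * (1 - ‖ζ‖ ^ 2) / Complex.normSq (1 - ζ) := by
    rw [cayley, Complex.div_im, ← Complex.normSq_eq_norm_sq]
    have h3 : Complex.normSq (1 - ζ) ≠ 0 := by simpa using h1
    field_simp
    simp [Complex.normSq_apply]
    ring
  rw [h2]
  have : 0 < Complex.normSq (1 - ζ) := Complex.normSq_pos.2 h1
  have : 0 < 1 - ‖ζ‖ ^ 2 := by nlinarith [norm_nonneg ζ]
  positivity

theorem analyticAt_cayley (a : ℂ) {ζ : ℂ} (hζ : ‖ζ‖ < 1) : AnalyticAt ℂ (cayley a) ζ := by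
  have h1 := one_sub_ne_zero_of_norm_lt hζ
  unfold cayley
  fun_prop (disch := exact h1)

theorem sub_conj_ne_zero {a z : ℂ} (ha : 0 < a.im) (hz : 0 < z.im) : z - conj a ≠ 0 := by
  intro h
  have := congrArg Complex.im h
  simp at this
  linarith

theorem cayley_div {a z : ℂ} (ha : 0 < a.im) (hz : 0 < z.im) :
    cayley a ((z - a) / (z - conj a)) = z := by
  have h1 := sub_conj_ne_zero ha hz
  have h2 := sub_conj_ne_zero ha ha
  unfold cayley
  have h3 : 1 - (z - a) / (z - conj a) = (a - conj a) / (z - conj a) := by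
    field_simp
    ring
  rw [h3]
  field_simp
  ring

theorem one_sub_normSq_cayleyInv {a z : ℂ} (ha : 0 < a.im) (hz : 0 < z.im) :
    1 - ‖(z - a) / (z - conj a)‖ ^ 2 = 4 * a.im * z.im / ‖z - conj a‖ ^ 2 := by
  have h1 := sub_conj_ne_zero ha hz
  rw [norm_div, div_pow, ← Complex.normSq_eq_norm_sq, ← Complex.normSq_eq_norm_sq]
  have h3 : Complex.normSq (z - conj a) ≠ 0 := by simpa using h1
  field_simp
  simp [Complex.normSq_apply]
  ring

theorem norm_cayleyInv_lt_one {a z : ℂ} (ha : 0 < a.im) (hz : 0 < z.im) :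
    ‖(z - a) / (z - conj a)‖ < 1 := by
  have h1 : 0 < ‖z - conj a‖ := norm_pos_iff.2 (sub_conj_ne_zero ha hz)
  have h2 := one_sub_normSq_cayleyInv ha hz
  have h3 : 0 < 4 * a.im * z.im / ‖z - conj a‖ ^ 2 := by positivity
  nlinarith [norm_nonneg ((z - a) / (z - conj a))]

/-- Harnack's factor (1 + r)/(1 - r) is at most 4/(1 - r²), and 1 - r² is explicit in z. This is the
origin of the expression (|z|² + 1)/Im z in all the growth estimates below. -/
theorem harnack_ratio_cayleyInv_le {a : ℂ} (ha : 0 < a.im) :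
    ∃ C : ℝ, 0 < C ∧ ∀ z : ℂ, 0 < z.im →
      (1 + ‖(z - a) / (z - conj a)‖) / (1 - ‖(z - a) / (z - conj a)‖) ≤
        C * (‖z‖ ^ 2 + 1) / z.im := by
  refine ⟨2 * (‖a‖ ^ 2 + 1) / a.im, by positivity, fun z hz => ?_⟩
  have h1 : 0 < ‖z - conj a‖ := norm_pos_iff.2 (sub_conj_ne_zero ha hz)
  have h2 := one_sub_normSq_cayleyInv ha hz
  have h3 := norm_cayleyInv_lt_one ha hz
  set r := ‖(z - a) / (z - conj a)‖ with hr
  have hr0 : 0 ≤ r := norm_nonneg _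
  have h4 : (1 + r) / (1 - r) ≤ 4 / (1 - r ^ 2) := by
    rw [div_le_div_iff₀ (by linarith) (by nlinarith)]
    have : 0 ≤ (1 - r) * (4 - (1 + r) ^ 2) := mul_nonneg (by linarith) (by nlinarith)
    nlinarith
  refine h4.trans ?_
  rw [h2]
  have h5 : ‖z - conj a‖ ^ 2 ≤ 2 * (‖a‖ ^ 2 + 1) * (‖z‖ ^ 2 + 1) := by
    have : ‖z - conj a‖ ≤ ‖z‖ + ‖a‖ := by
      simpa using norm_sub_le z (conj a)
    nlinarith [sq_nonneg (‖z‖ - ‖a‖), norm_nonneg z, norm_nonneg a, mul_nonneg (sq_nonneg ‖z‖) (sq_nonneg ‖a‖)]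
  have h6 : 4 / (4 * a.im * z.im / ‖z - conj a‖ ^ 2) = ‖z - conj a‖ ^ 2 / (a.im * z.im) := by
    field_simp
  rw [h6, div_le_iff₀ (by positivity)]
  calc _ ≤ _ := h5
    _ = _ := by field_simp

/-- Functions of bounded type in the upper half-plane grow at most like `exp (C (|z|² + 1) / y)`. -/
theorem BoundedType.growth {f : ℂ → ℂ} (hf : BoundedType f) :
    ∃ C : ℝ, 0 ≤ C ∧ ∀ z : ℂ, 0 < z.im → ‖f z‖ ≤ Real.exp (C * (‖z‖ ^ 2 + 1) / z.im) := by
  obtain ⟨hfd, p, q, ⟨hp, M₁, hM₁⟩, ⟨hq, M₂, hM₂⟩, ⟨a, ha, hqa⟩, hfpq⟩ := hf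
  replace ha : 0 < a.im := ha
  obtain ⟨M, hM0, hMp, hMq⟩ : ∃ M : ℝ, 0 < M ∧ (∀ z ∈ upperHalf, ‖p z‖ ≤ M) ∧
      ∀ z ∈ upperHalf, ‖q z‖ ≤ M :=
    ⟨max 1 (max M₁ M₂), by positivity, fun z hz => (hM₁ z hz).trans (by simp),
      fun z hz => (hM₂ z hz).trans (by simp)⟩
  obtain ⟨C, hC, hCr⟩ := harnack_ratio_cayleyInv_le ha
  have hMc : (M : ℂ) ≠ 0 := by exact_mod_cast hM0.ne'
  have hopen : IsOpen upperHalf := isOpen_lt continuous_const Complex.continuous_im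
  have han : ∀ {g : ℂ → ℂ}, DifferentiableOn ℂ g upperHalf → ∀ ζ : ℂ, ‖ζ‖ < 1 →
      AnalyticAt ℂ (fun ζ => g (cayley a ζ)) ζ := fun hg ζ hζ =>
    AnalyticAt.fun_comp (hg.analyticAt (hopen.mem_nhds (cayley_im_pos ha hζ))) (analyticAt_cayley a hζ)
  have hb : ∀ {g : ℂ → ℂ}, (∀ z ∈ upperHalf, ‖g z‖ ≤ M) → ∀ ζ : ℂ, ‖ζ‖ < 1 →
      ‖g (cayley a ζ) / M‖ ≤ 1 := fun hg ζ hζ => by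
    rw [norm_div, Complex.norm_real, Real.norm_eq_abs, abs_of_pos hM0, div_le_one hM0]
    exact hg _ (cayley_im_pos ha hζ)
  have h00 : q (cayley a 0) / M ≠ 0 := by
    simpa [cayley] using ⟨hqa, hM0.ne'⟩
  have hlog : 0 ≤ -Real.log ‖q (cayley a 0) / M‖ := by
    have := Real.log_nonpos (norm_nonneg _) (hb hMq 0 (by simp))
    linarith
  refine ⟨C * (-Real.log ‖q (cayley a 0) / M‖), by positivity, fun z hz => ?_⟩
  set w := (z - a) / (z - conj a) with hw
  have hw1 : ‖w‖ < 1 := norm_cayleyInv_lt_one ha hz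
  have hwz : cayley a w = z := cayley_div ha hz
  -- Analyticity on a closed disc requires a radius R < 1; the bound is then passed to the limit R →
  -- 1.
  have key : ∀ᶠ R in 𝓝[<] (1 : ℝ), ‖f (cayley a w)‖ ≤
      Real.exp ((R + ‖w‖) / (R - ‖w‖) * (-Real.log ‖q (cayley a 0) / M‖)) := by
    filter_upwards [Ioo_mem_nhdsLT hw1] with R hR
    have hlt : ∀ ζ ∈ closedBall (0 : ℂ) R, ‖ζ‖ < 1 := fun ζ hζ =>
      (show ‖ζ‖ ≤ R by simpa using hζ).trans_lt hR.2
    refine norm_le_exp_of_mul_eq_closedBall (R := R) (P := fun ζ => p (cayley a ζ) / M)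
      (Q := fun ζ => q (cayley a ζ) / M) (G := fun ζ => f (cayley a ζ))
      (fun ζ hζ => ?_) (fun ζ hζ => han hfd ζ (hlt ζ hζ)) (fun ζ hζ => ?_)
      (fun ζ hζ => hb hMp ζ (hlt ζ hζ)) (fun ζ hζ => hb hMq ζ (hlt ζ hζ)) h00 (by simpa using hR.1)
    · exact (han hq ζ (hlt ζ hζ)).fun_div analyticAt_const hMc
    · rw [← hfpq _ (cayley_im_pos ha (hlt ζ hζ))]
      ring
  have hcont : ContinuousAt (fun R : ℝ =>
      Real.exp ((R + ‖w‖) / (R - ‖w‖) * (-Real.log ‖q (cayley a 0) / M‖))) 1 := by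
    refine Real.continuous_exp.continuousAt.comp (ContinuousAt.mul
      (ContinuousAt.div (by fun_prop) (by fun_prop) (by linarith)) continuousAt_const)
  have hlim := ge_of_tendsto (hcont.tendsto.mono_left nhdsWithin_le_nhds) key
  rw [hwz] at hlim
  refine hlim.trans (Real.exp_le_exp.2 ?_)
  calc _ ≤ C * (‖z‖ ^ 2 + 1) / z.im * (-Real.log ‖q (cayley a 0) / M‖) :=
        mul_le_mul_of_nonneg_right (hCr z hz) hlog
    _ = _ := by ring

theorem differentiableOn_comp_cayley {g : ℂ → ℂ} (hg : DifferentiableOn ℂ g upperHalf) {a : ℂ}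
    (ha : 0 < a.im) : DifferentiableOn ℂ (fun ζ => g (cayley a ζ)) (ball 0 1) := by
  intro ζ hζ
  have hζ1 : ‖ζ‖ < 1 := by simpa using hζ
  have hopen : IsOpen upperHalf := isOpen_lt continuous_const Complex.continuous_im
  exact (AnalyticAt.fun_comp (hg.analyticAt (hopen.mem_nhds (cayley_im_pos ha hζ1)))
    (analyticAt_cayley a hζ1)).differentiableAt.differentiableWithinAt

/-- A function of modulus less than one in the upper half-plane stays away from the unit circle. -/
theorem exists_le_one_sub_norm {θ : ℂ → ℂ} (hθ : DifferentiableOn ℂ θ upperHalf)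
    (h1 : ∀ z : ℂ, 0 < z.im → ‖θ z‖ < 1) :
    ∃ c : ℝ, 0 < c ∧ ∀ z : ℂ, 0 < z.im → c * z.im / (‖z‖ ^ 2 + 1) ≤ 1 - ‖θ z‖ := by
  have hI : 0 < Complex.I.im := by simp
  obtain ⟨C, hC, hCr⟩ := harnack_ratio_cayleyInv_le hI
  have hθI : 0 < 1 - ‖θ Complex.I‖ := by linarith [h1 _ hI]
  refine ⟨C⁻¹ * (1 - ‖θ Complex.I‖), by positivity, fun z hz => ?_⟩
  set w := (z - Complex.I) / (z - conj Complex.I) with hw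
  have hw1 : ‖w‖ < 1 := norm_cayleyInv_lt_one hI hz
  have hwz : cayley Complex.I w = z := cayley_div hI hz
  -- The rotation u is chosen for the given z so that the positive harmonic function Re (1 - u θ)
  -- equals 1 - |θ z| at z; Harnack's lower bound then compares it with its value at i.
  obtain ⟨u, hu, huz⟩ : ∃ u : ℂ, ‖u‖ = 1 ∧ u * θ z = ‖θ z‖ := by
    by_cases h : θ z = 0
    · exact ⟨1, by simp, by simp [h]⟩
    · refine ⟨(‖θ z‖ : ℂ) / θ z, ?_, div_mul_cancel₀ _ h⟩
      rw [norm_div, Complex.norm_real, norm_norm, div_self (norm_ne_zero_iff.2 h)]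
  have hd := differentiableOn_comp_cayley hθ hI
  have hharm : InnerProductSpace.HarmonicOnNhd
      (fun ζ => (1 - u * θ (cayley Complex.I ζ)).re) (ball 0 1) := fun ζ hζ => by
    refine AnalyticAt.harmonicAt_re (f := fun ζ => 1 - u * θ (cayley Complex.I ζ)) ?_
    exact analyticAt_const.fun_sub
      (analyticAt_const.fun_mul (hd.analyticAt (isOpen_ball.mem_nhds hζ)))
  have hre : ∀ y : ℂ, 1 - ‖y‖ ≤ (1 - u * y).re := fun y => by
    have := Complex.re_le_norm (u * y)
    rw [norm_mul, hu, one_mul] at this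
    simp only [Complex.sub_re, Complex.one_re]
    linarith
  have hH := (harnack_ball hharm (fun ζ hζ => by
    have := h1 _ (cayley_im_pos hI (by simpa using hζ))
    linarith [hre (θ (cayley Complex.I ζ))]) (by simpa using hw1)).1
  have h0 : cayley Complex.I 0 = Complex.I := by simp [cayley]
  rw [hwz, huz, h0] at hH
  simp only [Complex.sub_re, Complex.one_re, Complex.ofReal_re] at hH
  refine le_trans ?_ hH
  have h2 : C⁻¹ * z.im / (‖z‖ ^ 2 + 1) ≤ (1 - ‖w‖) / (1 + ‖w‖) := by
    have h3 := hCr z hz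
    have h4 : 0 < (1 + ‖w‖) / (1 - ‖w‖) := div_pos (by positivity) (by linarith)
    have h5 := inv_anti₀ h4 h3
    rw [inv_div, inv_div] at h5
    calc _ = z.im / (C * (‖z‖ ^ 2 + 1)) := by field_simp
      _ ≤ _ := h5
  have h6 := hre (θ Complex.I)
  simp only [Complex.sub_re, Complex.one_re] at h6
  calc _ = C⁻¹ * z.im / (‖z‖ ^ 2 + 1) * (1 - ‖θ Complex.I‖) := by ring
    _ ≤ _ := mul_le_mul h2 h6 hθI.le (div_nonneg (by linarith) (by positivity))

/-- Growth of functions with nonnegative real part in the upper half-plane. -/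
theorem exists_norm_le_of_re_nonneg {h : ℂ → ℂ} (hh : DifferentiableOn ℂ h upperHalf)
    (h0 : ∀ z : ℂ, 0 < z.im → 0 ≤ (h z).re) :
    ∃ C : ℝ, 0 < C ∧ ∀ z : ℂ, 0 < z.im → ‖h z‖ ≤ C * (‖z‖ ^ 2 + 1) / z.im := by
  have hI : 0 < Complex.I.im := by simp
  obtain ⟨C, hC, hCr⟩ := harnack_ratio_cayleyInv_le hI
  refine ⟨C * (2 + ‖h Complex.I‖), by positivity, fun z hz => ?_⟩
  set w := (z - Complex.I) / (z - conj Complex.I) with hw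
  have hw1 : ‖w‖ < 1 := norm_cayleyInv_lt_one hI hz
  have hwz : cayley Complex.I w = z := cayley_div hI hz
  have hB := Complex.borelCaratheodory (f := fun ζ => -h (cayley Complex.I ζ)) (M := 1) (R := 1)
    one_pos (differentiableOn_comp_cayley hh hI).neg (fun ζ hζ => by
      have := h0 _ (cayley_im_pos hI (by simpa using hζ))
      simp only [Set.mem_ofPred_eq, Complex.neg_re]
      linarith) one_pos (show w ∈ ball (0 : ℂ) 1 by simpa using hw1)
  have hc0 : cayley Complex.I 0 = Complex.I := by simp [cayley]
  simp only [hwz, hc0, norm_neg] at hB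
  refine hB.trans ?_
  have hw0 := norm_nonneg w
  have h1w : 0 < 1 - ‖w‖ := by linarith
  calc _ ≤ (1 + ‖w‖) / (1 - ‖w‖) * (2 + ‖h Complex.I‖) := by
        rw [← add_div, div_mul_eq_mul_div]
        refine div_le_div_of_nonneg_right ?_ h1w.le
        nlinarith
    _ ≤ C * (‖z‖ ^ 2 + 1) / z.im * (2 + ‖h Complex.I‖) :=
        mul_le_mul_of_nonneg_right (hCr z hz) (by positivity)
    _ = _ := by ring

/-! ### Cauchy's theorem in the upper half-plane under bounded type growth. -/

/-- The closed upper half-plane. -/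
def closedUpperHalf : Set ℂ := {z | 0 ≤ z.im}

/-- A multiplier that decays rapidly on the upper three sides of the rectangle with vertices
`-R`, `R`, `R + iR`, `-R + iR`. -/
noncomputable def rectMultiplier (c R : ℝ) (z : ℂ) : ℂ :=
  Complex.exp (-c * (Complex.I * R ^ 2 / (z - R) + Complex.I * R ^ 2 / (z + R))) *
    (1 - z ^ 2 / R ^ 2)

theorem re_I_mul_div_sub (R a : ℝ) (z : ℂ) :
    (Complex.I * (R : ℂ) ^ 2 / (z - a)).re = R ^ 2 * z.im / Complex.normSq (z - a) := by
  have : (R : ℂ) ^ 2 = ((R ^ 2 : ℝ) : ℂ) := by push_cast; ring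
  rw [Complex.div_re, this]
  simp only [Complex.mul_re, Complex.mul_im, Complex.I_re, Complex.I_im, Complex.ofReal_re,
    Complex.ofReal_im, Complex.sub_im]
  ring

/-- The exponent is a negative multiple of Poisson kernels with poles at ±R. On the vertical sides
Re z = ±R one of them equals R²/y, matching the growth C(|z|² + 1)/y of a bounded type function
there; on the top side both are of order R. -/
theorem norm_rectMultiplier (c R : ℝ) (z : ℂ) :
    ‖rectMultiplier c R z‖ = Real.exp (-c * (R ^ 2 * z.im / Complex.normSq (z - R) +
      R ^ 2 * z.im / Complex.normSq (z + R))) * ‖1 - z ^ 2 / R ^ 2‖ := by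
  rw [rectMultiplier, norm_mul, Complex.norm_exp]
  congr 2
  have h1 := re_I_mul_div_sub R R z
  have h2 := re_I_mul_div_sub R (-R) z
  simp only [Complex.ofReal_neg, sub_neg_eq_add] at h2
  rw [← h1, ← h2, ← Complex.add_re, ← Complex.ofReal_neg, Complex.re_ofReal_mul]

theorem norm_rectMultiplier_le {c R : ℝ} (hc : 0 ≤ c) {z : ℂ} (hz : 0 ≤ z.im) :
    ‖rectMultiplier c R z‖ ≤ ‖1 - z ^ 2 / R ^ 2‖ := by
  rw [norm_rectMultiplier]
  refine mul_le_of_le_one_left (norm_nonneg _) (Real.exp_le_one_iff.2 ?_)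
  have h1 : 0 ≤ R ^ 2 * z.im / Complex.normSq (z - R) :=
    div_nonneg (by positivity) (Complex.normSq_nonneg _)
  have h2 : 0 ≤ R ^ 2 * z.im / Complex.normSq (z + R) :=
    div_nonneg (by positivity) (Complex.normSq_nonneg _)
  nlinarith

theorem analyticAt_rectMultiplier {c R : ℝ} {z : ℂ} (h1 : z ≠ R) (h2 : z ≠ -R) (hR : R ≠ 0) :
    AnalyticAt ℂ (rectMultiplier c R) z := by
  have h3 : z - R ≠ 0 := sub_ne_zero.2 h1
  have h4 : z + R ≠ 0 := fun h => h2 (eq_neg_of_add_eq_zero_left h)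
  have h5 : (R : ℂ) ^ 2 ≠ 0 := by exact_mod_cast pow_ne_zero 2 hR
  have e1 : AnalyticAt ℂ (fun z : ℂ => Complex.I * (R : ℂ) ^ 2 / (z - R)) z :=
    analyticAt_const.fun_div (by fun_prop) h3
  have e2 : AnalyticAt ℂ (fun z : ℂ => Complex.I * (R : ℂ) ^ 2 / (z + R)) z :=
    analyticAt_const.fun_div (by fun_prop) h4
  have e3 : AnalyticAt ℂ (fun z : ℂ => 1 - z ^ 2 / (R : ℂ) ^ 2) z :=
    analyticAt_const.fun_sub (AnalyticAt.fun_div (by fun_prop) analyticAt_const h5)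
  unfold rectMultiplier
  fun_prop

/-- The exponential has essential singularities at ±R, but its modulus is at most 1 in the closed
half-plane, and the factor `1 - z²/R²` vanishes at these two corners. -/
theorem continuousOn_rectMultiplier {c R : ℝ} (hc : 0 ≤ c) (hR : 0 < R) :
    ContinuousOn (rectMultiplier c R) closedUpperHalf := by
  intro z hz
  by_cases h : z = R ∨ z = -R
  · have hz2 : 1 - z ^ 2 / (R : ℂ) ^ 2 = 0 := by
      have : (R : ℂ) ≠ 0 := by exact_mod_cast hR.ne'
      rcases h with rfl | rfl <;> field_simp <;> ring
    have h0 : rectMultiplier c R z = 0 := by rw [rectMultiplier, hz2, mul_zero]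
    rw [ContinuousWithinAt, h0, tendsto_zero_iff_norm_tendsto_zero]
    have hc1 : Tendsto (fun w : ℂ => ‖1 - w ^ 2 / (R : ℂ) ^ 2‖) (𝓝[closedUpperHalf] z) (𝓝 0) := by
      have : Continuous (fun w : ℂ => ‖1 - w ^ 2 / (R : ℂ) ^ 2‖) := by fun_prop
      have h1 := this.tendsto z
      rw [hz2, norm_zero] at h1
      exact h1.mono_left nhdsWithin_le_nhds
    refine tendsto_of_tendsto_of_tendsto_of_le_of_le' tendsto_const_nhds hc1
      (Eventually.of_forall fun _ => norm_nonneg _) ?_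
    filter_upwards [self_mem_nhdsWithin] with w hw
    exact norm_rectMultiplier_le hc hw
  · push Not at h
    exact (analyticAt_rectMultiplier h.1 h.2 hR.ne').continuousAt.continuousWithinAt

/-- The price of damping: on the real line the multiplier does not tend to 1 but to a character of
frequency 2c, which is why Cauchy's theorem first appears with a factor exp(ist). -/
theorem tendsto_rectMultiplier (c x : ℝ) :
    Tendsto (fun R : ℝ => rectMultiplier c R x) atTop
      (𝓝 (Complex.exp (2 * c * x * Complex.I))) := by
  have hq : Tendsto (fun R : ℝ => (x : ℂ) ^ 2 / (R : ℂ) ^ 2) atTop (𝓝 0) := by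
    have h1 : Tendsto (fun R : ℝ => x ^ 2 / R ^ 2) atTop (𝓝 0) :=
      Tendsto.div_atTop tendsto_const_nhds (tendsto_pow_atTop two_ne_zero)
    have h2 := (Complex.continuous_ofReal.tendsto 0).comp h1
    simpa [Function.comp_def] using h2
  have h1 : Tendsto (fun R : ℝ => Complex.exp (-c * (2 * x * Complex.I /
      ((x : ℂ) ^ 2 / (R : ℂ) ^ 2 - 1))) * (1 - (x : ℂ) ^ 2 / (R : ℂ) ^ 2)) atTop
      (𝓝 (Complex.exp (-c * (2 * x * Complex.I / (0 - 1))) * (1 - 0))) := by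
    refine Tendsto.mul ((Complex.continuous_exp.tendsto _).comp ?_) (hq.const_sub 1)
    exact (tendsto_const_nhds.div (hq.sub_const 1) (by simp)).const_mul _
  have h2 : Complex.exp (-c * (2 * x * Complex.I / (0 - 1))) * (1 - 0) =
      Complex.exp (2 * c * x * Complex.I) := by
    rw [sub_zero, mul_one]
    congr 1
    ring
  rw [h2] at h1
  refine h1.congr' ?_
  filter_upwards [eventually_gt_atTop |x|] with R hR
  have hR0 : (R : ℂ) ≠ 0 := by exact_mod_cast ((abs_nonneg x).trans_lt hR).ne'
  have ha := abs_lt.1 hR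
  have hm : (x : ℂ) - R ≠ 0 := by
    rw [← Complex.ofReal_sub]
    exact_mod_cast (by linarith [ha.2] : x - R < 0).ne
  have hp : (x : ℂ) + R ≠ 0 := by
    rw [← Complex.ofReal_add]
    exact_mod_cast (by linarith [ha.1] : 0 < x + R).ne'
  rw [rectMultiplier]
  congr 3
  have h3 : (x : ℂ) ^ 2 / (R : ℂ) ^ 2 - 1 = (x - R) * (x + R) / R ^ 2 := by
    field_simp
    ring
  rw [h3]
  field_simp
  ring

theorem norm_mul_rectMultiplier_vertical_le {K C c R : ℝ} {L : ℂ → ℂ} (hK : 0 ≤ K) (hC : 0 ≤ C)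
    (hL : ∀ z : ℂ, 0 < z.im → ‖L z‖ ≤ K * Real.exp (C * (‖z‖ ^ 2 + 1) / z.im))
    (hc : 8 * C < c) (hR : 1 ≤ R) {z : ℂ} (hz0 : 0 < z.im) (hzR : z.im ≤ R)
    (hz : z.re = R ∨ z.re = -R) :
    ‖L z * rectMultiplier c R z‖ ≤ 3 * K * Real.exp (-(2 / 5 * (c - 8 * C)) * R) := by
  have hn : ‖z‖ ^ 2 = R ^ 2 + z.im ^ 2 := by
    rw [← Complex.normSq_eq_norm_sq, Complex.normSq_apply]
    rcases hz with h | h <;> rw [h] <;> ring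
  have hm : ‖1 - z ^ 2 / (R : ℂ) ^ 2‖ ≤ 3 := by
    have h1 : ‖z ^ 2 / (R : ℂ) ^ 2‖ ≤ 2 := by
      rw [norm_div, norm_pow, norm_pow, Complex.norm_real, Real.norm_eq_abs, sq_abs, hn,
        div_le_iff₀ (by positivity)]
      nlinarith
    calc _ ≤ ‖(1 : ℂ)‖ + ‖z ^ 2 / (R : ℂ) ^ 2‖ := norm_sub_le _ _
      _ ≤ 3 := by rw [norm_one]; linarith
  have hsum : R ^ 2 / z.im ≤ R ^ 2 * z.im / Complex.normSq (z - R) +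
      R ^ 2 * z.im / Complex.normSq (z + R) := by
    have h1 : 0 ≤ R ^ 2 * z.im / Complex.normSq (z - R) :=
      div_nonneg (by positivity) (Complex.normSq_nonneg _)
    have h2 : 0 ≤ R ^ 2 * z.im / Complex.normSq (z + R) :=
      div_nonneg (by positivity) (Complex.normSq_nonneg _)
    rcases hz with h | h
    · have : Complex.normSq (z - R) = z.im ^ 2 := by
        rw [Complex.normSq_apply]; simp [h]; ring
      rw [this] at h1 ⊢
      have h3 : R ^ 2 * z.im / z.im ^ 2 = R ^ 2 / z.im := by field_simp
      linarith
    · have : Complex.normSq (z + R) = z.im ^ 2 := by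
        rw [Complex.normSq_apply]; simp [h]; ring
      rw [this] at h2 ⊢
      have h3 : R ^ 2 * z.im / z.im ^ 2 = R ^ 2 / z.im := by field_simp
      linarith
  rw [norm_mul, norm_rectMultiplier]
  set S := R ^ 2 * z.im / Complex.normSq (z - R) + R ^ 2 * z.im / Complex.normSq (z + R)
  have hc0 : 0 < c := by linarith
  have hRy : R ≤ R ^ 2 / z.im := by
    rw [le_div_iff₀ hz0]; nlinarith
  calc ‖L z‖ * (Real.exp (-c * S) * ‖1 - z ^ 2 / (R : ℂ) ^ 2‖)
      ≤ (K * Real.exp (C * (‖z‖ ^ 2 + 1) / z.im)) * (Real.exp (-c * S) * 3) := by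
        gcongr
        exact hL z hz0
    _ = 3 * K * Real.exp (C * (‖z‖ ^ 2 + 1) / z.im + -c * S) := by
        rw [Real.exp_add]; ring
    _ ≤ _ := by
        refine mul_le_mul_of_nonneg_left (Real.exp_le_exp.2 ?_) (by positivity)
        have h1 : C * (‖z‖ ^ 2 + 1) / z.im ≤ 3 * C * (R ^ 2 / z.im) := by
          rw [← mul_div_assoc]
          refine div_le_div_of_nonneg_right ?_ hz0.le
          rw [hn]
          nlinarith [mul_nonneg hC (by nlinarith : (0 : ℝ) ≤ R ^ 2 - z.im ^ 2),
            mul_nonneg hC (by nlinarith : (0 : ℝ) ≤ R ^ 2 - 1)]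
        have h2 : -c * S ≤ -c * (R ^ 2 / z.im) := by nlinarith
        have h3 : (c - 3 * C) * R ≤ (c - 3 * C) * (R ^ 2 / z.im) :=
          mul_le_mul_of_nonneg_left hRy (by linarith)
        nlinarith [mul_nonneg hC (by linarith : (0 : ℝ) ≤ R),
          mul_nonneg hc0.le (by linarith : (0 : ℝ) ≤ R)]

theorem norm_mul_rectMultiplier_horizontal_le {K C c R : ℝ} {L : ℂ → ℂ} (hK : 0 ≤ K) (hC : 0 ≤ C)
    (hL : ∀ z : ℂ, 0 < z.im → ‖L z‖ ≤ K * Real.exp (C * (‖z‖ ^ 2 + 1) / z.im))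
    (hc : 8 * C < c) (hR : 1 ≤ R) {z : ℂ} (hz : z.im = R) (hzR : |z.re| ≤ R) :
    ‖L z * rectMultiplier c R z‖ ≤ 3 * K * Real.exp (-(2 / 5 * (c - 8 * C)) * R) := by
  have hR0 : 0 < R := by linarith
  have hz0 : 0 < z.im := by linarith
  have ha := abs_le.1 hzR
  have hn : ‖z‖ ^ 2 = z.re ^ 2 + R ^ 2 := by
    rw [← Complex.normSq_eq_norm_sq, Complex.normSq_apply, hz]; ring
  have hre2 : z.re ^ 2 ≤ R ^ 2 := sq_le_sq' ha.1 ha.2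
  have hm : ‖1 - z ^ 2 / (R : ℂ) ^ 2‖ ≤ 3 := by
    have h1 : ‖z ^ 2 / (R : ℂ) ^ 2‖ ≤ 2 := by
      rw [norm_div, norm_pow, norm_pow, Complex.norm_real, Real.norm_eq_abs, sq_abs, hn,
        div_le_iff₀ (by positivity)]
      nlinarith
    calc _ ≤ ‖(1 : ℂ)‖ + ‖z ^ 2 / (R : ℂ) ^ 2‖ := norm_sub_le _ _
      _ ≤ 3 := by rw [norm_one]; linarith
  have hside : ∀ a : ℝ, |a| = R → R / 5 ≤ R ^ 2 * z.im / Complex.normSq (z - a) := by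
    intro a haR
    have h1 : Complex.normSq (z - a) = (z.re - a) ^ 2 + R ^ 2 := by
      rw [Complex.normSq_apply]; simp [hz]; ring
    have h2 : (z.re - a) ^ 2 ≤ 4 * R ^ 2 := by
      have hb := abs_le.1 haR.le
      nlinarith
    rw [h1, hz, le_div_iff₀ (by positivity)]
    nlinarith
  have hs1 := hside R (abs_of_pos hR0)
  have hs2 := hside (-R) (by rw [abs_neg, abs_of_pos hR0])
  rw [Complex.ofReal_neg, sub_neg_eq_add] at hs2
  rw [norm_mul, norm_rectMultiplier]
  set S1 := R ^ 2 * z.im / Complex.normSq (z - R)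
  set S2 := R ^ 2 * z.im / Complex.normSq (z + R)
  have hc0 : 0 < c := by linarith
  calc ‖L z‖ * (Real.exp (-c * (S1 + S2)) * ‖1 - z ^ 2 / (R : ℂ) ^ 2‖)
      ≤ (K * Real.exp (C * (‖z‖ ^ 2 + 1) / z.im)) * (Real.exp (-c * (S1 + S2)) * 3) := by
        gcongr
        exact hL z hz0
    _ = 3 * K * Real.exp (C * (‖z‖ ^ 2 + 1) / z.im + -c * (S1 + S2)) := by
        rw [Real.exp_add]; ring
    _ ≤ _ := by
        refine mul_le_mul_of_nonneg_left (Real.exp_le_exp.2 ?_) (by positivity)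
        have h1 : C * (‖z‖ ^ 2 + 1) / z.im ≤ 3 * C * R := by
          rw [hz, div_le_iff₀ hR0, hn]
          nlinarith [mul_nonneg hC (by nlinarith : (0 : ℝ) ≤ R ^ 2 - z.re ^ 2),
            mul_nonneg hC (by nlinarith : (0 : ℝ) ≤ R ^ 2 - 1)]
        -- On the top side growth 3CR competes with decay 2cR/5. The condition 8C < c ensures that
        -- decay wins and fixes the rate 2/5 (c - 8C), which the vertical sides also satisfy.
        have h2 : -c * (S1 + S2) ≤ -c * (2 * R / 5) := by nlinarith
        nlinarith [mul_nonneg hC hR0.le]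

/-- Cauchy's theorem in the upper half-plane under a growth condition that allows functions of
bounded type. -/
theorem integral_mul_exp_eq_zero_of_growth {K C s : ℝ} {L : ℂ → ℂ} (hC : 0 ≤ C)
    (hLa : AnalyticOnNhd ℂ L closedUpperHalf) (hLi : Integrable (fun t : ℝ => L t))
    (hL : ∀ z : ℂ, 0 < z.im → ‖L z‖ ≤ K * Real.exp (C * (‖z‖ ^ 2 + 1) / z.im))
    (hs : 16 * C < s) :
    ∫ t : ℝ, L t * Complex.exp (s * t * Complex.I) = 0 := by
  have hK : 0 ≤ K := by
    have h1 := (norm_nonneg _).trans (hL Complex.I (by simp))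
    exact nonneg_of_mul_nonneg_left h1 (Real.exp_pos _)
  -- The limiting character has frequency 2c = s, so the condition 8C < c becomes 16C < s.
  set c := s / 2 with hcs
  have hc : 8 * C < c := by linarith
  have hc0 : 0 ≤ c := by linarith
  set δ := 2 / 5 * (c - 8 * C) with hδ
  have hδ0 : 0 < δ := by linarith
  -- The three upper sides have total length 4R and the integrand on them is at most 3K exp(-δR);
  -- this gives 12K.
  have hbound : ∀ R : ℝ, 1 ≤ R → ‖∫ x in (-R)..R, L x * rectMultiplier c R x‖ ≤
      12 * K * (R * Real.exp (-δ * R)) := by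
    intro R hR
    have hR0 : 0 < R := by linarith
    have hrect := Complex.integral_boundary_rect_eq_zero_of_continuousOn_of_differentiableOn
      (fun z => L z * rectMultiplier c R z) (-R : ℝ) (R + R * Complex.I) ?_ ?_
    · simp only [Complex.ofReal_re, Complex.ofReal_im, Complex.add_re, Complex.add_im,
        Complex.mul_re, Complex.mul_im, Complex.I_re, Complex.I_im, mul_zero, mul_one, sub_self,
        add_zero, zero_add, Complex.ofReal_zero, zero_mul, smul_eq_mul] at hrect
      have e1 : ‖∫ x in (-R)..R, L (x + R * Complex.I) * rectMultiplier c R (x + R * Complex.I)‖ ≤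
          3 * K * Real.exp (-δ * R) * |R - -R| := by
        refine intervalIntegral.norm_integral_le_of_norm_le_const fun x hx => ?_
        rw [uIoc_of_le (by linarith)] at hx
        exact norm_mul_rectMultiplier_horizontal_le hK hC hL hc hR (by simp)
          (by simpa using abs_le.2 ⟨hx.1.le, hx.2⟩)
      have e2 : ‖∫ y in (0 : ℝ)..R, L (R + y * Complex.I) * rectMultiplier c R (R + y * Complex.I)‖ ≤
          3 * K * Real.exp (-δ * R) * |R - 0| := by
        refine intervalIntegral.norm_integral_le_of_norm_le_const fun y hy => ?_
        rw [uIoc_of_le hR0.le] at hy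
        exact norm_mul_rectMultiplier_vertical_le hK hC hL hc hR (by simpa using hy.1)
          (by simpa using hy.2) (by simp)
      have e3 : ‖∫ y in (0 : ℝ)..R, L ((-R : ℝ) + y * Complex.I) *
          rectMultiplier c R ((-R : ℝ) + y * Complex.I)‖ ≤
          3 * K * Real.exp (-δ * R) * |R - 0| := by
        refine intervalIntegral.norm_integral_le_of_norm_le_const fun y hy => ?_
        rw [uIoc_of_le hR0.le] at hy
        exact norm_mul_rectMultiplier_vertical_le hK hC hL hc hR (by simpa using hy.1)
          (by simpa using hy.2) (by simp)
      rw [show R - -R = 2 * R by ring, abs_of_pos (by linarith)] at e1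
      rw [sub_zero, abs_of_pos hR0] at e2 e3
      set T1 := ∫ x in (-R)..R, L (x + R * Complex.I) * rectMultiplier c R (x + R * Complex.I)
      set T2 := ∫ y in (0 : ℝ)..R, L (R + y * Complex.I) * rectMultiplier c R (R + y * Complex.I)
      set T3 := ∫ y in (0 : ℝ)..R, L ((-R : ℝ) + y * Complex.I) *
          rectMultiplier c R ((-R : ℝ) + y * Complex.I)
      have h4 : (∫ x in (-R)..R, L x * rectMultiplier c R x) =
          T1 - Complex.I * T2 + Complex.I * T3 := by linear_combination hrect
      rw [h4]
      calc _ ≤ ‖T1‖ + ‖T2‖ + ‖T3‖ := by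
            refine (norm_add_le _ _).trans (add_le_add ((norm_sub_le _ _).trans_eq ?_) ?_)
            · simp
            · simp
        _ ≤ _ := by nlinarith
    · refine ContinuousOn.mul (hLa.continuousOn.mono ?_)
        ((continuousOn_rectMultiplier hc0 hR0).mono ?_) <;>
      · intro z hz
        have := (Complex.mem_reProdIm.1 hz).2
        simp [uIcc_of_le hR0.le] at this
        exact this.1
    · intro z hz
      obtain ⟨hz1, hz2⟩ := Complex.mem_reProdIm.1 hz
      simp at hz2
      have hz0 : 0 < z.im := by
        rcases hz2.1 with h | h <;> linarith
      refine (((hLa z hz0.le).fun_mul (analyticAt_rectMultiplier ?_ ?_ hR0.ne')).differentiableAt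
        ).differentiableWithinAt
      · rintro rfl; simp at hz0
      · rintro rfl; simp at hz0
  have hlim0 : Tendsto (fun R : ℝ => ∫ x in (-R)..R, L x * rectMultiplier c R x) atTop (𝓝 0) := by
    rw [tendsto_zero_iff_norm_tendsto_zero]
    have h1 : Tendsto (fun R : ℝ => 12 * K * (R * Real.exp (-δ * R))) atTop (𝓝 (12 * K * 0)) := by
      refine Tendsto.const_mul _ ?_
      have := Real.tendsto_pow_mul_exp_neg_atTop_nhds_zero 1
      have h2 := (this.comp (tendsto_id.const_mul_atTop hδ0)).const_mul δ⁻¹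
      rw [mul_zero] at h2
      refine h2.congr fun R => ?_
      simp only [Function.comp_apply, id, pow_one, neg_mul]
      field_simp
    rw [mul_zero] at h1
    refine tendsto_of_tendsto_of_tendsto_of_le_of_le' tendsto_const_nhds h1
      (Eventually.of_forall fun _ => norm_nonneg _) ?_
    filter_upwards [eventually_ge_atTop 1] with R hR using hbound R hR
  have hLc : Continuous fun t : ℝ => L t := by
    refine continuous_iff_continuousAt.2 fun t => ?_
    exact ContinuousAt.comp (f := fun t : ℝ => (t : ℂ)) (hLa t (by simp [closedUpperHalf])).continuousAt
      Complex.continuous_ofReal.continuousAt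
  have hlim : Tendsto (fun R : ℝ => ∫ x in (-R)..R, L x * rectMultiplier c R x) atTop
      (𝓝 (∫ t : ℝ, L t * Complex.exp (s * t * Complex.I))) := by
    have h1 : Tendsto (fun R : ℝ => ∫ x, (Ioc (-R) R).indicator
        (fun x : ℝ => L x * rectMultiplier c R x) x) atTop
        (𝓝 (∫ t : ℝ, L t * Complex.exp (s * t * Complex.I))) := by
      refine tendsto_integral_filter_of_dominated_convergence (fun t => ‖L t‖) ?_ ?_ hLi.norm ?_
      · filter_upwards [eventually_gt_atTop 0] with R hR
        refine (Continuous.aestronglyMeasurable ?_).indicator measurableSet_Ioc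
        refine hLc.mul ?_
        exact (continuousOn_rectMultiplier hc0 hR).comp_continuous Complex.continuous_ofReal
          (fun t => by simp [closedUpperHalf])
      · filter_upwards [eventually_gt_atTop 0] with R hR
        refine Eventually.of_forall fun t => ?_
        by_cases ht : t ∈ Ioc (-R) R
        · rw [indicator_of_mem ht, norm_mul]
          refine mul_le_of_le_one_right (norm_nonneg _)
            ((norm_rectMultiplier_le hc0 (by simp)).trans ?_)
          have h2 : (1 : ℂ) - (t : ℂ) ^ 2 / (R : ℂ) ^ 2 = ((1 - t ^ 2 / R ^ 2 : ℝ) : ℂ) := by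
            push_cast; ring
          have h3 : t ^ 2 / R ^ 2 ≤ 1 := by
            rw [div_le_one (by positivity)]
            exact sq_le_sq' ht.1.le ht.2
          have h4 : 0 ≤ t ^ 2 / R ^ 2 := by positivity
          rw [h2, Complex.norm_real, Real.norm_eq_abs, abs_le]
          constructor <;> linarith
        · rw [indicator_of_notMem ht, norm_zero]
          exact norm_nonneg _
      · refine Eventually.of_forall fun t => ?_
        have h2 := (tendsto_rectMultiplier c t).const_mul (L t)
        have h3 : (2 * (c : ℂ) * t * Complex.I) = s * t * Complex.I := by
          rw [hcs]; push_cast; ring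
        rw [h3] at h2
        refine h2.congr' ?_
        filter_upwards [eventually_gt_atTop |t|] with R hR
        have ha := abs_lt.1 hR
        rw [indicator_of_mem (show t ∈ Ioc (-R) R from ⟨ha.1, ha.2.le⟩)]
    refine h1.congr' ?_
    filter_upwards [eventually_gt_atTop 0] with R hR
    rw [intervalIntegral.integral_of_le (by linarith), integral_indicator measurableSet_Ioc]
  exact tendsto_nhds_unique hlim hlim0

/-- Cauchy's theorem in the upper half-plane for integrable functions of polynomial growth at the
boundary. -/
theorem integral_eq_zero_of_le {K : ℝ} {L : ℂ → ℂ}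
    (hLa : AnalyticOnNhd ℂ L closedUpperHalf) (hLi : Integrable (fun t : ℝ => L t))
    (hL : ∀ z : ℂ, 0 < z.im → ‖L z‖ ≤ K * (1 + 1 / z.im) ^ 2) :
    ∫ t : ℝ, L t = 0 := by
  have hK : 0 ≤ K := by
    have h1 := (norm_nonneg _).trans (hL Complex.I (by simp))
    exact nonneg_of_mul_nonneg_left h1 (by norm_num)
  -- Polynomial growth in 1/y is dominated by a multiple of exp(C/y) for every C > 0, so every
  -- frequency s > 0 is allowed (C = s/32 leaves room in 16C < s); then s → 0.
  have key : ∀ s : ℝ, 0 < s → ∫ t : ℝ, L t * Complex.exp (s * t * Complex.I) = 0 := by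
    intro s hs
    set C := s / 32 with hCs
    have hC : 0 < C := by positivity
    refine integral_mul_exp_eq_zero_of_growth (K := K * (1 + 2 / C) ^ 2) hC.le hLa hLi
      (fun z hz => (hL z hz).trans ?_) (by linarith)
    rw [mul_assoc]
    refine mul_le_mul_of_nonneg_left ?_ hK
    have h1 : 1 + 1 / z.im ≤ (1 + 2 / C) * Real.exp (C / 2 * (1 / z.im)) := by
      have h2 := Real.add_one_le_exp (C / 2 * (1 / z.im))
      have h3 : 0 < 1 / z.im := by positivity
      calc 1 + 1 / z.im ≤ (1 + 2 / C) * (C / 2 * (1 / z.im) + 1) := by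
            have : (1 + 2 / C) * (C / 2 * (1 / z.im) + 1) =
              1 + 1 / z.im + (C / 2 * (1 / z.im) + 2 / C) := by field_simp; ring
            rw [this]
            have : 0 < C / 2 * (1 / z.im) + 2 / C := by positivity
            linarith
        _ ≤ _ := by gcongr
    calc (1 + 1 / z.im) ^ 2 ≤ ((1 + 2 / C) * Real.exp (C / 2 * (1 / z.im))) ^ 2 := by
          gcongr
      _ = (1 + 2 / C) ^ 2 * Real.exp (C * (1 / z.im)) := by
          rw [mul_pow, ← Real.exp_nat_mul]; congr 2; push_cast; ring
      _ ≤ _ := by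
          refine mul_le_mul_of_nonneg_left (Real.exp_le_exp.2 ?_) (by positivity)
          rw [mul_one_div]
          refine div_le_div_of_nonneg_right ?_ hz.le
          nlinarith [mul_nonneg hC.le (sq_nonneg ‖z‖)]
  have hlim : Tendsto (fun s : ℝ => ∫ t : ℝ, L t * Complex.exp (s * t * Complex.I)) (𝓝[>] 0)
      (𝓝 (∫ t : ℝ, L t)) := by
    refine tendsto_integral_filter_of_dominated_convergence (fun t => ‖L t‖) ?_ ?_ hLi.norm ?_
    · refine Eventually.of_forall fun s => hLi.aestronglyMeasurable.mul ?_
      exact (by fun_prop : Continuous fun t : ℝ => Complex.exp (s * t * Complex.I)).aestronglyMeasurable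
    · refine Eventually.of_forall fun s => Eventually.of_forall fun t => ?_
      rw [norm_mul, ← Complex.ofReal_mul, Complex.norm_exp_ofReal_mul_I, mul_one]
    · refine Eventually.of_forall fun t => ?_
      have : Continuous fun s : ℝ => L t * Complex.exp (s * t * Complex.I) := by fun_prop
      have h := (this.tendsto 0).mono_left (nhdsWithin_le_nhds (s := Ioi 0))
      simpa using h
  refine tendsto_nhds_unique hlim (tendsto_const_nhds.congr' ?_)
  filter_upwards [self_mem_nhdsWithin] with s hs using (key s hs).symm

theorem ofReal_mem_closedUpperHalf (t : ℝ) : (t : ℂ) ∈ closedUpperHalf := by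
  simp [closedUpperHalf]

theorem isClosed_closedUpperHalf : IsClosed closedUpperHalf :=
  isClosed_le continuous_const Complex.continuous_im

theorem continuous_ofReal_of_analyticOnNhd {f : ℂ → ℂ} (hf : AnalyticOnNhd ℂ f closedUpperHalf) :
    Continuous fun t : ℝ => f t :=
  hf.continuousOn.comp_continuous Complex.continuous_ofReal ofReal_mem_closedUpperHalf

/-! ### Difference quotients and the Cauchy estimate in the half-plane. -/

theorem _root_.AnalyticAt.dslope_self {f : ℂ → ℂ} {a : ℂ} (hf : AnalyticAt ℂ f a) :
    AnalyticAt ℂ (dslope f a) a := by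
  obtain ⟨p, hp⟩ := hf
  exact ⟨_, hp.has_fpower_series_dslope_fslope⟩

theorem _root_.AnalyticAt.dslope_of_ne {f : ℂ → ℂ} {a z : ℂ} (hf : AnalyticAt ℂ f z)
    (h : z ≠ a) : AnalyticAt ℂ (dslope f a) z := by
  have h1 : AnalyticAt ℂ (fun w => (w - a)⁻¹ * (f w - f a)) z := by
    refine AnalyticAt.fun_mul (AnalyticAt.fun_inv (by fun_prop) (sub_ne_zero.2 h)) (by fun_prop)
  refine h1.congr ?_
  filter_upwards [isOpen_ne.mem_nhds h] with w hw
  rw [_root_.dslope_of_ne _ hw, slope_def_module, smul_eq_mul]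

theorem _root_.AnalyticOnNhd.dslope {f : ℂ → ℂ} {s : Set ℂ} {a : ℂ} (hf : AnalyticOnNhd ℂ f s) :
    AnalyticOnNhd ℂ (dslope f a) s := by
  intro z hz
  rcases eq_or_ne z a with rfl | h
  · exact (hf z hz).dslope_self
  · exact (hf z hz).dslope_of_ne h

theorem dslope_eq_div {f : ℂ → ℂ} {a z : ℂ} (h : z ≠ a) :
    dslope f a z = (f z - f a) / (z - a) := by
  rw [dslope_of_ne _ h, slope_def_module, smul_eq_mul, inv_mul_eq_div]

theorem exists_norm_dslope_le_ball {f : ℂ → ℂ} (hf : AnalyticOnNhd ℂ f closedUpperHalf) (w : ℂ) :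
    ∃ M : ℝ, 0 ≤ M ∧ ∀ z ∈ closedUpperHalf, ‖z - w‖ ≤ 1 → ‖dslope f w z‖ ≤ M := by
  obtain ⟨M, hM⟩ := ((isCompact_closedBall w 1).inter_right
    isClosed_closedUpperHalf).exists_bound_of_continuousOn
    ((hf.dslope (a := w)).continuousOn.mono inter_subset_right)
  exact ⟨max M 0, le_max_right _ _, fun z hz hzw =>
    (hM z ⟨by simpa [dist_eq_norm] using hzw, hz⟩).trans (le_max_left _ _)⟩

/-- Within distance 1 of w compactness bounds the quotient, and farther away the division only
helps. The weight W is left abstract so as to cover both exponential and polynomial growth in 1/y.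
-/
theorem exists_norm_dslope_le {f : ℂ → ℂ} {K : ℝ} {W : ℂ → ℝ}
    (hf : AnalyticOnNhd ℂ f closedUpperHalf) (w : ℂ) (hW : ∀ z : ℂ, 0 < z.im → 1 ≤ W z)
    (hfK : ∀ z : ℂ, 0 < z.im → ‖f z‖ ≤ K * W z) :
    ∃ K' : ℝ, ∀ z : ℂ, 0 < z.im → ‖dslope f w z‖ ≤ K' * W z := by
  obtain ⟨M, hM0, hM⟩ := exists_norm_dslope_le_ball hf w
  refine ⟨M + |K| + ‖f w‖, fun z hz => ?_⟩
  have hWz := hW z hz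
  have hK := abs_nonneg K
  have hfw := norm_nonneg (f w)
  rcases le_or_gt ‖z - w‖ 1 with h | h
  · have := hM z hz.le h
    nlinarith
  · have hne : z ≠ w := by
      rintro rfl
      simp at h
      linarith
    rw [dslope_eq_div hne, norm_div]
    have h1 : ‖f z - f w‖ ≤ |K| * W z + ‖f w‖ := by
      refine (norm_sub_le _ _).trans (add_le_add_left ((hfK z hz).trans ?_) _)
      exact mul_le_mul_of_nonneg_right (le_abs_self K) (by linarith)
    rw [div_le_iff₀ (by linarith)]
    have h2 : |K| * W z + ‖f w‖ ≤ (M + |K| + ‖f w‖) * W z := by nlinarith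
    have h3 : 0 ≤ (M + |K| + ‖f w‖) * W z := by positivity
    nlinarith

theorem normSq_ofReal_sub (t : ℝ) (p : ℂ) :
    ‖(t : ℂ) - p‖ ^ 2 = p.im ^ 2 * (1 + ((t - p.re) / p.im) ^ 2) ∨ p.im = 0 := by
  by_cases h : p.im = 0
  · exact Or.inr h
  · left
    rw [← Complex.normSq_eq_norm_sq, Complex.normSq_apply]
    simp
    field_simp
    ring

theorem integrable_inv_normSq_sub {p : ℂ} (hp : p.im ≠ 0) :
    Integrable (fun t : ℝ => ‖((t : ℂ) - p)⁻¹‖ ^ 2) ∧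
      ∫ t : ℝ, ‖((t : ℂ) - p)⁻¹‖ ^ 2 = Real.pi / |p.im| := by
  have h1 : (fun t : ℝ => ‖((t : ℂ) - p)⁻¹‖ ^ 2) =
      fun t : ℝ => (p.im ^ 2)⁻¹ * (1 + ((t - p.re) / p.im) ^ 2)⁻¹ := by
    ext t
    rw [norm_inv, inv_pow, (normSq_ofReal_sub t p).resolve_right hp, mul_inv]
  rw [h1]
  constructor
  · refine Integrable.const_mul ?_ _
    exact (integrable_inv_one_add_sq.comp_div hp).comp_sub_right p.re
  · rw [integral_const_mul, integral_sub_right_eq_self (fun t : ℝ => (1 + (t / p.im) ^ 2)⁻¹) p.re,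
      Measure.integral_comp_div (fun t : ℝ => (1 + t ^ 2)⁻¹) p.im, integral_univ_inv_one_add_sq,
      smul_eq_mul, ← sq_abs p.im]
    have : |p.im| ≠ 0 := abs_ne_zero.2 hp
    field_simp

theorem ofReal_sub_ne_zero {p : ℂ} (hp : p.im ≠ 0) (t : ℝ) : (t : ℂ) - p ≠ 0 := by
  intro h
  have := congrArg Complex.im h
  simp at this
  exact hp this

theorem memLp_inv_sub {p : ℂ} (hp : p.im ≠ 0) : MemLp (fun t : ℝ => ((t : ℂ) - p)⁻¹) 2 := by
  rw [memLp_two_iff_integrable_sq_norm]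
  · exact (integrable_inv_normSq_sub hp).1
  · refine Continuous.aestronglyMeasurable (Continuous.inv₀ (by fun_prop) (ofReal_sub_ne_zero hp))

theorem MemLp.integrable_mul_two {f g : ℝ → ℂ} (hf : MemLp f 2) (hg : MemLp g 2) :
    Integrable fun t => f t * g t :=
  hf.integrable_mul hg

/-- The quotient d is square integrable: bounded near w, dominated by |f| elsewhere. Since f = (t -
w) d, one has d = (f + (w - p) d) · (t - p)⁻¹, a product of two square integrable functions. The
point w may be real. -/
theorem integrable_dslope {f : ℂ → ℂ} (hf : AnalyticOnNhd ℂ f closedUpperHalf)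
    (hf2 : MemLp (fun t : ℝ => f t) 2) {w : ℂ} (hfw : f w = 0) :
    Integrable fun t : ℝ => dslope f w t := by
  obtain ⟨M, hM0, hM⟩ := exists_norm_dslope_le_ball hf w
  have hc := continuous_ofReal_of_analyticOnNhd (hf.dslope (a := w))
  have hmul : ∀ t : ℝ, ((t : ℂ) - w) * dslope f w t = f t := fun t => by
    have := sub_smul_dslope f w t
    rwa [hfw, sub_zero, smul_eq_mul] at this
  have h2 : MemLp (fun t : ℝ => dslope f w t) 2 := by
    have hg : MemLp (fun t : ℝ => ‖f t‖ + (Icc (w.re - 1) (w.re + 1)).indicator (fun _ => M) t) 2 :=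
      hf2.norm.add (memLp_indicator_const 2 measurableSet_Icc M (Or.inr (by simp)))
    refine hg.of_le hc.aestronglyMeasurable (Eventually.of_forall fun t => ?_)
    have hnn : 0 ≤ (Icc (w.re - 1) (w.re + 1)).indicator (fun _ => M) t :=
      indicator_nonneg (fun _ _ => hM0) _
    rw [Real.norm_eq_abs, abs_of_nonneg (by positivity)]
    rcases le_or_gt ‖(t : ℂ) - w‖ 1 with h | h
    · have h1 : |t - w.re| ≤ 1 := by
        have := (Complex.abs_re_le_norm ((t : ℂ) - w)).trans h
        simpa using this
      have h3 := abs_le.1 h1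
      rw [indicator_of_mem (show t ∈ Icc (w.re - 1) (w.re + 1) from ⟨by linarith, by linarith⟩)]
      have := hM t (ofReal_mem_closedUpperHalf t) h
      linarith [norm_nonneg (f t)]
    · have h1 := congrArg norm (hmul t)
      rw [norm_mul] at h1
      nlinarith [norm_nonneg (dslope f w t)]
  set p : ℂ := w.re - Complex.I with hp
  have hpim : p.im ≠ 0 := by simp [hp]
  have h3 : MemLp (fun t : ℝ => f t + (w - p) * dslope f w t) 2 := hf2.add (h2.const_mul _)
  refine (MemLp.integrable_mul_two h3 (memLp_inv_sub hpim)).congr (Eventually.of_forall fun t => ?_)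
  have := ofReal_sub_ne_zero hpim t
  simp only
  rw [← hmul t]
  field_simp
  ring

theorem sq_integral_mul_le {f g : ℝ → ℂ} (hf : MemLp f 2) (hg : MemLp g 2) :
    ‖∫ t, f t * g t‖ ^ 2 ≤ (∫ t, ‖f t‖ ^ 2) * ∫ t, ‖g t‖ ^ 2 := by
  have h1 : ‖∫ t, f t * g t‖ ≤ ∫ t, ‖f t‖ * ‖g t‖ := by
    refine (norm_integral_le_integral_norm _).trans_eq ?_
    simp only [norm_mul]
  have h2 := integral_mul_le_Lp_mul_Lq_of_nonneg (μ := (volume : Measure ℝ))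
    (f := fun t => ‖f t‖) (g := fun t => ‖g t‖) Real.HolderConjugate.two_two
    (Eventually.of_forall fun _ => norm_nonneg _) (Eventually.of_forall fun _ => norm_nonneg _)
    (by simpa using hf.norm) (by simpa using hg.norm)
  simp only [Real.rpow_two, ← Real.sqrt_eq_rpow] at h2
  have h3 := h1.trans h2
  have hA : 0 ≤ ∫ t, ‖f t‖ ^ 2 := integral_nonneg fun _ => by positivity
  have hB : 0 ≤ ∫ t, ‖g t‖ ^ 2 := integral_nonneg fun _ => by positivity
  calc _ ≤ (√(∫ t, ‖f t‖ ^ 2) * √(∫ t, ‖g t‖ ^ 2)) ^ 2 :=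
        pow_le_pow_left₀ (norm_nonneg _) h3 2
    _ = _ := by rw [mul_pow, Real.sq_sqrt hA, Real.sq_sqrt hB]

theorem analyticOnNhd_inv_sub {p : ℂ} (hp : p.im < 0) :
    AnalyticOnNhd ℂ (fun z => (z - p)⁻¹) closedUpperHalf := by
  intro z hz
  refine AnalyticAt.fun_inv (by fun_prop) fun h => ?_
  rw [sub_eq_zero.1 h] at hz
  have : 0 ≤ p.im := hz
  linarith

theorem norm_inv_sub_le {p z : ℂ} (hp : p.im < 0) (hz : 0 ≤ z.im) :
    ‖(z - p)⁻¹‖ ≤ (-p.im)⁻¹ := by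
  rw [norm_inv]
  refine inv_anti₀ (by linarith) ?_
  have h := (le_abs_self _).trans (Complex.abs_im_le_norm (z - p))
  simp only [Complex.sub_im] at h
  linarith

/-- The Poisson integral of `t ↦ exp (i s t)`. -/
theorem integral_exp_mul_poisson {s : ℝ} (hs : 0 ≤ s) {w : ℂ} (hw : 0 < w.im) :
    ∫ t : ℝ, Complex.exp (s * t * Complex.I) * (((t : ℂ) - w)⁻¹ * ((t : ℂ) - conj w)⁻¹) =
      Complex.exp (s * w * Complex.I) * (Real.pi / w.im : ℝ) := by
  have hwc : (conj w).im < 0 := by simpa using hw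
  -- Dividing by z - w leaves an analytic integrand with integral zero, which says that the
  -- exponential may be replaced by its value at w against the Poisson kernel.
  set F : ℂ → ℂ := fun z => (Complex.exp (s * z * Complex.I) - Complex.exp (s * w * Complex.I)) *
    (z - conj w)⁻¹ with hF
  have hFa : AnalyticOnNhd ℂ F closedUpperHalf := fun z hz =>
    AnalyticAt.fun_mul (by fun_prop) (analyticOnNhd_inv_sub hwc z hz)
  have hexp : ∀ z : ℂ, 0 ≤ z.im → ‖Complex.exp (s * z * Complex.I)‖ ≤ 1 := fun z hz => by
    rw [Complex.norm_exp]
    refine Real.exp_le_one_iff.2 ?_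
    simp
    positivity
  have hdiff : ∀ z : ℂ, 0 ≤ z.im →
      ‖Complex.exp (s * z * Complex.I) - Complex.exp (s * w * Complex.I)‖ ≤ 2 := fun z hz => by
    refine (norm_sub_le _ _).trans ?_
    linarith [hexp z hz, hexp w hw.le]
  have hF2 : MemLp (fun t : ℝ => F t) 2 := by
    refine (memLp_inv_sub hwc.ne).of_le_mul (c := 2)
      (continuous_ofReal_of_analyticOnNhd hFa).aestronglyMeasurable (Eventually.of_forall fun t => ?_)
    rw [hF, norm_mul]
    exact mul_le_mul_of_nonneg_right (hdiff t (by simp)) (norm_nonneg _)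
  have hFw : F w = 0 := by simp [hF]
  have hFb : ∀ z : ℂ, 0 < z.im → ‖F z‖ ≤ (2 * (w.im)⁻¹) * (1 + 1 / z.im) ^ 2 := fun z hz => by
    have h1 : ‖F z‖ ≤ 2 * (w.im)⁻¹ := by
      rw [hF, norm_mul]
      refine mul_le_mul (hdiff z hz.le) ?_ (norm_nonneg _) zero_le_two
      simpa using norm_inv_sub_le hwc hz.le
    refine h1.trans (le_mul_of_one_le_right (by positivity) ?_)
    have : 0 < 1 / z.im := by positivity
    nlinarith
  obtain ⟨K, hK⟩ := exists_norm_dslope_le hFa w (W := fun z => (1 + 1 / z.im) ^ 2)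
    (fun z hz => by have : 0 < 1 / z.im := by positivity
                    nlinarith) hFb
  have h0 := integral_eq_zero_of_le hFa.dslope (integrable_dslope hFa hF2 hFw) hK
  have hwne := ofReal_sub_ne_zero hw.ne'
  have hpt : ∀ t : ℝ, dslope F w t =
      Complex.exp (s * t * Complex.I) * (((t : ℂ) - w)⁻¹ * ((t : ℂ) - conj w)⁻¹) -
        Complex.exp (s * w * Complex.I) * (((t : ℂ) - w)⁻¹ * ((t : ℂ) - conj w)⁻¹) := fun t => by
    rw [dslope_eq_div (sub_ne_zero.1 (hwne t)), hFw, sub_zero, hF]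
    simp only
    ring
  have hprod : ∀ t : ℝ, ((t : ℂ) - w)⁻¹ * ((t : ℂ) - conj w)⁻¹ = (‖((t : ℂ) - w)⁻¹‖ ^ 2 : ℝ) := by
    intro t
    have : ((t : ℂ) - conj w)⁻¹ = conj ((t : ℂ) - w)⁻¹ := by simp
    rw [this, Complex.mul_conj, Complex.normSq_eq_norm_sq]
  have hi : Integrable fun t : ℝ => ((t : ℂ) - w)⁻¹ * ((t : ℂ) - conj w)⁻¹ :=
    MemLp.integrable_mul_two (memLp_inv_sub hw.ne') (memLp_inv_sub hwc.ne)
  have hi1 : Integrable fun t : ℝ => Complex.exp (s * t * Complex.I) *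
      (((t : ℂ) - w)⁻¹ * ((t : ℂ) - conj w)⁻¹) := by
    refine hi.bdd_mul (c := 1) (by fun_prop) (Eventually.of_forall fun t => hexp t (by simp))
  simp only [hpt] at h0
  rw [integral_sub hi1 (hi.const_mul _), sub_eq_zero, integral_const_mul] at h0
  rw [h0]
  congr 1
  simp only [hprod]
  rw [integral_complex_ofReal, (integrable_inv_normSq_sub hw.ne').2, abs_of_pos hw]

/-- The numerator of the difference quotient used to derive Cauchy's formula at `w`. -/
noncomputable def cauchyAux (g : ℂ → ℂ) (w p z : ℂ) : ℂ := g z - g w * ((w - p) * (z - p)⁻¹)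

theorem cauchyAux_self (g : ℂ → ℂ) {w p : ℂ} (h : w ≠ p) : cauchyAux g w p w = 0 := by
  rw [cauchyAux, mul_inv_cancel₀ (sub_ne_zero.2 h), mul_one, sub_self]

theorem analyticOnNhd_cauchyAux {g : ℂ → ℂ} (hg : AnalyticOnNhd ℂ g closedUpperHalf) (w : ℂ)
    {p : ℂ} (hp : p.im < 0) : AnalyticOnNhd ℂ (cauchyAux g w p) closedUpperHalf := fun z hz =>
  (hg z hz).fun_sub (analyticAt_const.fun_mul
    (analyticAt_const.fun_mul (analyticOnNhd_inv_sub hp z hz)))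

theorem memLp_cauchyAux {g : ℂ → ℂ} (hg : MemLp (fun t : ℝ => g t) 2) (w : ℂ) {p : ℂ}
    (hp : p.im < 0) : MemLp (fun t : ℝ => cauchyAux g w p t) 2 :=
  hg.sub (((memLp_inv_sub hp.ne).const_mul _).const_mul _)

theorem exists_norm_cauchyAux_le {g : ℂ → ℂ} {K : ℝ} {W : ℂ → ℝ} (w : ℂ) {p : ℂ} (hp : p.im < 0)
    (hW : ∀ z : ℂ, 0 < z.im → 1 ≤ W z) (hgK : ∀ z : ℂ, 0 < z.im → ‖g z‖ ≤ K * W z) :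
    ∃ K' : ℝ, ∀ z : ℂ, 0 < z.im → ‖cauchyAux g w p z‖ ≤ K' * W z := by
  refine ⟨K + ‖g w‖ * (‖w - p‖ * (-p.im)⁻¹), fun z hz => ?_⟩
  rw [add_mul]
  refine (norm_sub_le _ _).trans (add_le_add (hgK z hz) ?_)
  rw [norm_mul, norm_mul]
  have h1 := norm_inv_sub_le hp hz.le
  have h2 : 0 ≤ ‖g w‖ * (‖w - p‖ * (-p.im)⁻¹) := by
    have : 0 < (-p.im)⁻¹ := inv_pos.2 (by linarith)
    positivity
  calc _ ≤ ‖g w‖ * (‖w - p‖ * (-p.im)⁻¹) := by gcongr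
    _ ≤ _ := le_mul_of_one_le_right h2 (hW z hz)

/-- The Cauchy estimate in the upper half-plane, from the vanishing of an integral. -/
theorem sq_norm_le_of_integral_dslope_eq_zero {g : ℂ → ℂ} (hg : MemLp (fun t : ℝ => g t) 2)
    {s : ℝ} (hs : 0 ≤ s) {w : ℂ} (hw : 0 < w.im)
    (h0 : ∫ t : ℝ, dslope (cauchyAux g w (conj w)) w t * Complex.exp (s * t * Complex.I) = 0) :
    ‖g w‖ ^ 2 ≤ Real.exp (2 * s * w.im) * (∫ t : ℝ, ‖g t‖ ^ 2) / (4 * Real.pi * w.im) := by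
  have hwc : (conj w).im < 0 := by simpa using hw
  have hwne := ofReal_sub_ne_zero hw.ne'
  have hne : w ≠ conj w := fun h => by
    have := congrArg Complex.im h
    simp at this
    linarith
  -- With p = conj w the vanishing integral equates the Cauchy integral of g with g(w) times a
  -- Poisson integral. The latter is computed exactly, and Cauchy–Schwarz bounds the former.
  have hpt : ∀ t : ℝ, dslope (cauchyAux g w (conj w)) w t * Complex.exp (s * t * Complex.I) =
      g t * (Complex.exp (s * t * Complex.I) * ((t : ℂ) - w)⁻¹) -
      (g w * (w - conj w)) * (Complex.exp (s * t * Complex.I) *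
        (((t : ℂ) - w)⁻¹ * ((t : ℂ) - conj w)⁻¹)) := fun t => by
    rw [dslope_eq_div (sub_ne_zero.1 (hwne t)), cauchyAux_self g hne, sub_zero, cauchyAux]
    ring
  have hen : ∀ t : ℝ, ‖Complex.exp (s * t * Complex.I)‖ = 1 := fun t => by
    rw [← Complex.ofReal_mul, Complex.norm_exp_ofReal_mul_I]
  have hm : MemLp (fun t : ℝ => Complex.exp (s * t * Complex.I) * ((t : ℂ) - w)⁻¹) 2 := by
    refine (memLp_inv_sub hw.ne').of_le ?_ (Eventually.of_forall fun t => ?_)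
    · exact (Continuous.mul (by fun_prop)
        (Continuous.inv₀ (by fun_prop) hwne)).aestronglyMeasurable
    · rw [norm_mul, hen, one_mul]
  have hi : Integrable fun t : ℝ => Complex.exp (s * t * Complex.I) *
      (((t : ℂ) - w)⁻¹ * ((t : ℂ) - conj w)⁻¹) := by
    refine (MemLp.integrable_mul_two hm (memLp_inv_sub hwc.ne)).congr
      (Eventually.of_forall fun t => ?_)
    simp only
    ring
  simp only [hpt] at h0
  rw [integral_sub (MemLp.integrable_mul_two hg hm) (hi.const_mul _), integral_const_mul,
    integral_exp_mul_poisson hs hw, sub_eq_zero] at h0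
  have hCS := sq_integral_mul_le hg hm
  rw [h0] at hCS
  have hm2 : ∫ t : ℝ, ‖Complex.exp (s * t * Complex.I) * ((t : ℂ) - w)⁻¹‖ ^ 2 = Real.pi / w.im := by
    simp only [norm_mul, hen, one_mul]
    rw [(integrable_inv_normSq_sub hw.ne').2, abs_of_pos hw]
  have hexp : ‖Complex.exp (s * w * Complex.I)‖ = Real.exp (-(s * w.im)) := by
    rw [Complex.norm_exp]; simp
  have hsub : ‖w - conj w‖ = 2 * w.im := by
    rw [Complex.sub_conj, norm_mul, Complex.norm_I, mul_one, Complex.norm_real, Real.norm_eq_abs,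
      abs_of_pos (by linarith)]
  rw [hm2, norm_mul, norm_mul, norm_mul, hexp, hsub, Complex.norm_real, Real.norm_eq_abs,
    abs_of_pos (div_pos Real.pi_pos hw)] at hCS
  have hpi := Real.pi_pos
  have he : Real.exp (2 * s * w.im) * Real.exp (-(s * w.im)) ^ 2 = 1 := by
    rw [← Real.exp_nat_mul, ← Real.exp_add]
    norm_num
    ring
  have h4 : ‖g w‖ ^ 2 * (4 * Real.pi ^ 2) * Real.exp (-(s * w.im)) ^ 2 ≤
      (∫ t : ℝ, ‖g t‖ ^ 2) * (Real.pi / w.im) := by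
    calc _ = (‖g w‖ * (2 * w.im) * (Real.exp (-(s * w.im)) * (Real.pi / w.im))) ^ 2 := by
          field_simp
          ring
      _ ≤ _ := hCS
  rw [le_div_iff₀ (by positivity)]
  have h5 := mul_le_mul_of_nonneg_left h4 (Real.exp_pos (2 * s * w.im)).le
  have h6 : Real.exp (2 * s * w.im) * (‖g w‖ ^ 2 * (4 * Real.pi ^ 2) * Real.exp (-(s * w.im)) ^ 2) =
      ‖g w‖ ^ 2 * (4 * Real.pi ^ 2) := by
    linear_combination (‖g w‖ ^ 2 * (4 * Real.pi ^ 2)) * he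
  rw [h6] at h5
  have h7 : ‖g w‖ ^ 2 * (4 * Real.pi * w.im) = ‖g w‖ ^ 2 * (4 * Real.pi ^ 2) * (w.im / Real.pi) := by
    field_simp
  rw [h7]
  calc _ ≤ Real.exp (2 * s * w.im) * ((∫ t : ℝ, ‖g t‖ ^ 2) * (Real.pi / w.im)) * (w.im / Real.pi) :=
        mul_le_mul_of_nonneg_right h5 (by positivity)
    _ = _ := by field_simp

/-! ### The Hardy class and the Phragmén–Lindelöf principle. -/

/-- Functions analytic on the closed upper half-plane, square integrable on the real axis and
bounded by a multiple of `1 + 1 / Im z`. -/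
structure IsHardy (g : ℂ → ℂ) : Prop where
  analytic : AnalyticOnNhd ℂ g closedUpperHalf
  memLp : MemLp (fun t : ℝ => g t) 2
  bound : ∃ K : ℝ, ∀ z : ℂ, 0 < z.im → ‖g z‖ ≤ K * (1 + 1 / z.im)

theorem one_le_one_add_one_div {z : ℂ} (hz : 0 < z.im) : 1 ≤ 1 + 1 / z.im := by
  have : 0 < 1 / z.im := by positivity
  linarith

/-- Cauchy's formula in disguise. Two choices are used: p = conj w for the pointwise estimate, and p
= x - i at a real point w = x for the reproducing formula. -/
theorem IsHardy.integral_dslope_cauchyAux {g : ℂ → ℂ} (hg : IsHardy g) (w : ℂ) {p : ℂ}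
    (hp : p.im < 0) (hwp : w ≠ p) :
    Integrable (fun t : ℝ => dslope (cauchyAux g w p) w t) ∧
      ∫ t : ℝ, dslope (cauchyAux g w p) w t = 0 := by
  obtain ⟨K, hK⟩ := hg.bound
  obtain ⟨K₁, hK₁⟩ := exists_norm_cauchyAux_le w hp (fun z hz => one_le_one_add_one_div hz) hK
  obtain ⟨K₂, hK₂⟩ := exists_norm_dslope_le (analyticOnNhd_cauchyAux hg.analytic w hp) w
    (fun z hz => one_le_one_add_one_div hz) hK₁
  have hint := integrable_dslope (analyticOnNhd_cauchyAux hg.analytic w hp)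
    (memLp_cauchyAux hg.memLp w hp) (cauchyAux_self g hwp)
  refine ⟨hint, integral_eq_zero_of_le (K := |K₂|)
    (analyticOnNhd_cauchyAux hg.analytic w hp).dslope hint
    fun z hz => (hK₂ z hz).trans ?_⟩
  have h1 := one_le_one_add_one_div hz
  calc _ ≤ |K₂| * (1 + 1 / z.im) := mul_le_mul_of_nonneg_right (le_abs_self _) (by linarith)
    _ ≤ _ := mul_le_mul_of_nonneg_left (by nlinarith) (abs_nonneg _)

theorem IsHardy.sq_norm_le {g : ℂ → ℂ} (hg : IsHardy g) {w : ℂ} (hw : 0 < w.im) :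
    ‖g w‖ ^ 2 ≤ (∫ t : ℝ, ‖g t‖ ^ 2) / (4 * Real.pi * w.im) := by
  have hwc : (conj w).im < 0 := by simpa using hw
  have hne : w ≠ conj w := fun h => by
    have := congrArg Complex.im h
    simp at this
    linarith
  have h := sq_norm_le_of_integral_dslope_eq_zero hg.memLp le_rfl hw (by
    simpa using (hg.integral_dslope_cauchyAux w hwc hne).2)
  simpa using h

theorem one_le_exp_growth {C : ℝ} (hC : 0 ≤ C) {z : ℂ} (hz : 0 < z.im) :
    1 ≤ Real.exp (C * (‖z‖ ^ 2 + 1) / z.im) := by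
  rw [Real.one_le_exp_iff]; positivity

/-- A function of bounded type that is square integrable on the real axis is of exponential type in
the upper half-plane. -/
theorem sq_norm_le_of_growth {g : ℂ → ℂ} {C : ℝ} (hC : 0 ≤ C)
    (hga : AnalyticOnNhd ℂ g closedUpperHalf) (hg2 : MemLp (fun t : ℝ => g t) 2)
    (hgr : ∀ z : ℂ, 0 < z.im → ‖g z‖ ≤ Real.exp (C * (‖z‖ ^ 2 + 1) / z.im)) {w : ℂ}
    (hw : 0 < w.im) :
    ‖g w‖ ^ 2 ≤ Real.exp (2 * (16 * C + 1) * w.im) * (∫ t : ℝ, ‖g t‖ ^ 2) /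
      (4 * Real.pi * w.im) := by
  have hwc : (conj w).im < 0 := by simpa using hw
  have hne : w ≠ conj w := fun h => by
    have := congrArg Complex.im h
    simp at this
    linarith
  obtain ⟨K₁, hK₁⟩ := exists_norm_cauchyAux_le (K := 1) w hwc
    (fun z hz => one_le_exp_growth hC hz) (fun z hz => by simpa using hgr z hz)
  obtain ⟨K₂, hK₂⟩ := exists_norm_dslope_le (analyticOnNhd_cauchyAux hga w hwc) w
    (fun z hz => one_le_exp_growth hC hz) hK₁
  refine sq_norm_le_of_integral_dslope_eq_zero hg2 (by positivity) hw ?_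
  exact integral_mul_exp_eq_zero_of_growth hC (analyticOnNhd_cauchyAux hga w hwc).dslope
    (integrable_dslope (analyticOnNhd_cauchyAux hga w hwc) (memLp_cauchyAux hg2 w hwc)
      (cauchyAux_self g hne)) hK₂ (by linarith)

theorem eventually_norm_le_exp_of_meanType_le {f : ℂ → ℂ} (hf : meanType f ≤ 0) {δ : ℝ}
    (hδ : 0 < δ) : ∀ᶠ y : ℝ in atTop, ‖f (y * Complex.I)‖ ≤ Real.exp (δ * y) := by
  have h1 : meanType f < (δ : EReal) := hf.trans_lt (by exact_mod_cast hδ)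
  have h2 := eventually_lt_of_limsup_lt h1
  filter_upwards [h2, eventually_gt_atTop 0] with y hy hy0
  rw [EReal.div_lt_iff (by exact_mod_cast hy0) (EReal.coe_ne_top y)] at hy
  have h3 : ENNReal.log ‖f (y * Complex.I)‖ₑ < ENNReal.log (ENNReal.ofReal (Real.exp (δ * y))) := by
    rw [ENNReal.log_ofReal_of_pos (Real.exp_pos _), Real.log_exp]
    exact_mod_cast hy
  rw [ENNReal.log_lt_log_iff, ← ofReal_norm] at h3
  exact ((ENNReal.ofReal_lt_ofReal_iff (Real.exp_pos _)).1 h3).le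

theorem meanType_le_zero_of_bounded {f : ℂ → ℂ} {M : ℝ}
    (hf : ∀ᶠ y : ℝ in atTop, ‖f (y * Complex.I)‖ ≤ M) : meanType f ≤ 0 := by
  refine le_of_forall_gt fun b hb => ?_
  obtain ⟨δ, hδ0, hδb⟩ := EReal.lt_iff_exists_real_btwn.1 hb
  have hδ : 0 < δ := by exact_mod_cast hδ0
  refine lt_of_le_of_lt ?_ hδb
  refine limsup_le_of_le (by isBoundedDefault) ?_
  have hlim : Tendsto (fun y : ℝ => Real.exp (y * δ)) atTop atTop :=
    Real.tendsto_exp_atTop.comp (tendsto_id.atTop_mul_const hδ)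
  filter_upwards [hf, eventually_gt_atTop 0, hlim.eventually_ge_atTop M] with y hy hy0 hyM
  rw [EReal.div_le_iff_le_mul (by exact_mod_cast hy0) (EReal.coe_ne_top y)]
  have h3 : ENNReal.log ‖f (y * Complex.I)‖ₑ ≤ ENNReal.log (ENNReal.ofReal (Real.exp (y * δ))) := by
    refine ENNReal.log_le_log ?_
    rw [← ofReal_norm]
    exact ENNReal.ofReal_le_ofReal (hy.trans hyM)
  rw [ENNReal.log_ofReal_of_pos (Real.exp_pos _), Real.log_exp] at h3
  exact_mod_cast h3

/-- Phragmén–Lindelöf: exponential type and nonpositive mean type give boundedness. -/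
theorem norm_le_of_exponential_of_meanType {g : ℂ → ℂ} {B s : ℝ}
    (hga : AnalyticOnNhd ℂ g closedUpperHalf)
    (hexp : ∀ z : ℂ, 1 ≤ z.im → ‖g z‖ ≤ B * Real.exp (s * z.im)) (hs : 0 ≤ s)
    (hmt : meanType g ≤ 0) {z : ℂ} (hz : 1 ≤ z.im) : ‖g z‖ ≤ B * Real.exp s := by
  have hB : 0 ≤ B := nonneg_of_mul_nonneg_left ((norm_nonneg _).trans (hexp Complex.I (by simp)))
    (Real.exp_pos _)
  -- The half-plane Im z ≥ 1 is rotated to Re ζ ≥ 0. The factor exp(-δζ) turns the mean type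
  -- condition into boundedness on the positive ray; afterwards δ → 0.
  have key : ∀ δ : ℝ, 0 < δ → ‖g z‖ ≤ B * Real.exp s * Real.exp (δ * (z.im - 1)) := by
    intro δ hδ
    set φ : ℂ → ℂ := fun ζ => Complex.I * ζ + Complex.I with hφ
    have hφim : ∀ ζ, (φ ζ).im = ζ.re + 1 := fun ζ => by simp [hφ]
    set f : ℂ → ℂ := fun ζ => g (φ ζ) * Complex.exp (-δ * ζ) with hf
    have hfn : ∀ ζ, ‖f ζ‖ = ‖g (φ ζ)‖ * Real.exp (-δ * ζ.re) := fun ζ => by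
      rw [hf, norm_mul, Complex.norm_exp]
      simp
    have hcl : closure {z : ℂ | 0 < z.re} = {z : ℂ | 0 ≤ z.re} := Complex.closure_setOfPred_lt_re 0
    have hd : DiffContOnCl ℂ f {z | 0 < z.re} := by
      refine DifferentiableOn.diffContOnCl ?_
      rw [hcl]
      intro ζ hζ
      have h1 : φ ζ ∈ closedUpperHalf := by
        have : 0 ≤ ζ.re := hζ
        simp only [closedUpperHalf, Set.mem_ofPred_eq, hφim]
        linarith
      have h2 : DifferentiableAt ℂ (fun ζ => g (φ ζ)) ζ :=
        (hga _ h1).differentiableAt.comp ζ (by fun_prop)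
      exact (h2.mul (by fun_prop)).differentiableWithinAt
    have hPL := PhragmenLindelof.right_half_plane_of_bounded_on_real (C := B * Real.exp s)
      (z := (z - Complex.I) / Complex.I) hd ?_ ?_ ?_ ?_
    · have h1 : φ ((z - Complex.I) / Complex.I) = z := by
        simp only [hφ]
        field_simp
        ring
      have h2 : ((z - Complex.I) / Complex.I).re = z.im - 1 := by
        simp
      rw [hfn, h1, h2, neg_mul, Real.exp_neg, ← div_eq_mul_inv, div_le_iff₀ (Real.exp_pos _)] at hPL
      exact hPL
    · refine ⟨1, by norm_num, s, ?_⟩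
      refine Asymptotics.IsBigO.of_bound (B * Real.exp s) ?_
      refine Eventually.filter_mono inf_le_right ?_
      rw [eventually_principal]
      intro ζ hζ
      have hζ0 : 0 < ζ.re := hζ
      rw [hfn, Real.norm_of_nonneg (Real.exp_pos _).le, Real.rpow_one]
      have h1 := hexp (φ ζ) (by rw [hφim]; linarith)
      rw [hφim] at h1
      have h2 : Real.exp (-δ * ζ.re) ≤ 1 := Real.exp_le_one_iff.2 (by nlinarith)
      calc _ ≤ ‖g (φ ζ)‖ * 1 := mul_le_mul_of_nonneg_left h2 (norm_nonneg _)
        _ ≤ B * Real.exp (s * (ζ.re + 1)) := by rw [mul_one]; exact h1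
        _ = B * Real.exp s * Real.exp (s * ζ.re) := by
          rw [mul_assoc, ← Real.exp_add]; congr 2; ring
        _ ≤ _ := by
          have := Complex.re_le_norm ζ
          gcongr
    · refine ⟨Real.exp δ, ?_⟩
      rw [eventually_map]
      have h1 := (tendsto_atTop_add_const_right atTop (1 : ℝ) tendsto_id).eventually
        (eventually_norm_le_exp_of_meanType_le hmt hδ)
      filter_upwards [h1] with x hx
      rw [hfn]
      have h2 : φ x = ((id x + 1 : ℝ) : ℂ) * Complex.I := by
        simp only [hφ, id]
        push_cast
        ring
      rw [h2]
      calc _ ≤ Real.exp (δ * (id x + 1)) * Real.exp (-δ * x) := by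
            rw [Complex.ofReal_re]
            gcongr
        _ = Real.exp δ := by
          rw [← Real.exp_add]; congr 1; simp only [id]; ring
    · intro x
      rw [hfn]
      have h1 := hexp (φ (x * Complex.I)) (by rw [hφim]; simp)
      rw [hφim] at h1
      simpa using h1
    · have h2 : ((z - Complex.I) / Complex.I).re = z.im - 1 := by
        simp
      rw [h2]
      linarith
  have hlim : Tendsto (fun δ : ℝ => B * Real.exp s * Real.exp (δ * (z.im - 1))) (𝓝[>] 0)
      (𝓝 (B * Real.exp s)) := by
    have : Continuous fun δ : ℝ => B * Real.exp s * Real.exp (δ * (z.im - 1)) := by fun_prop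
    have h := (this.tendsto 0).mono_left (nhdsWithin_le_nhds (s := Ioi 0))
    simpa using h
  refine ge_of_tendsto hlim ?_
  filter_upwards [self_mem_nhdsWithin] with δ hδ using key δ hδ

/-- A function of bounded type and nonpositive mean type in the upper half-plane that is analytic
across the real axis and square integrable there is in the Hardy class. -/
theorem isHardy_of_boundedType {g : ℂ → ℂ} (hga : AnalyticOnNhd ℂ g closedUpperHalf)
    (hg2 : MemLp (fun t : ℝ => g t) 2) (hbt : BoundedType g) (hmt : meanType g ≤ 0) :
    IsHardy g := by
  obtain ⟨C, hC, hgr⟩ := hbt.growth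
  have hsq := fun (w : ℂ) (hw : 0 < w.im) => sq_norm_le_of_growth hC hga hg2 hgr hw
  set I := ∫ t : ℝ, ‖g t‖ ^ 2 with hI
  have hI0 : 0 ≤ I := integral_nonneg fun _ => by positivity
  set s := 16 * C + 1 with hs
  have hs0 : 0 ≤ s := by positivity
  have hpi := Real.pi_gt_three
  -- Below height 1 the exponential is harmless; above it, the mean type condition removes it by
  -- Phragmén–Lindelöf.
  have hb : ∀ w : ℂ, 0 < w.im → ‖g w‖ ≤ (I + 1) * Real.exp (s * w.im) * (1 + 1 / w.im) := by
    intro w hw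
    refine abs_le_of_sq_le_sq' (b := (I + 1) * Real.exp (s * w.im) * (1 + 1 / w.im)) ?_
      (by positivity) |>.2
    refine (hsq w hw).trans ?_
    have h1 : Real.exp (2 * s * w.im) = Real.exp (s * w.im) ^ 2 := by
      rw [← Real.exp_nat_mul]; congr 1; push_cast; ring
    rw [h1, mul_pow, mul_pow]
    have h2 : Real.exp (s * w.im) ^ 2 * I / (4 * Real.pi * w.im) =
        I / (4 * Real.pi) * Real.exp (s * w.im) ^ 2 * (1 / w.im) := by field_simp
    rw [h2]
    have h3 : I / (4 * Real.pi) ≤ (I + 1) ^ 2 := by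
      rw [div_le_iff₀ (by positivity)]
      nlinarith [mul_nonneg hI0 (by linarith : (0 : ℝ) ≤ Real.pi - 3), sq_nonneg I]
    have h4 : 0 < 1 / w.im := by positivity
    have h5 : 1 / w.im ≤ (1 + 1 / w.im) ^ 2 := by nlinarith
    gcongr
  have h1 : ∀ z : ℂ, 1 ≤ z.im → ‖g z‖ ≤ 2 * (I + 1) * Real.exp (s * z.im) := fun z hz => by
    refine (hb z (by linarith)).trans ?_
    have : 1 / z.im ≤ 1 := by rw [div_le_one (by linarith)]; exact hz
    calc _ ≤ (I + 1) * Real.exp (s * z.im) * 2 := by gcongr; linarith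
      _ = _ := by ring
  refine ⟨hga, hg2, 2 * (I + 1) * Real.exp s, fun z hz => ?_⟩
  have h4 : 0 < 1 / z.im := by positivity
  rcases le_total 1 z.im with h | h
  · refine (norm_le_of_exponential_of_meanType hga h1 hs0 hmt h).trans ?_
    exact le_mul_of_one_le_right (by positivity) (by linarith)
  · refine (hb z hz).trans ?_
    have : Real.exp (s * z.im) ≤ Real.exp s := Real.exp_le_exp.2 (by nlinarith)
    gcongr
    linarith

/-! ### Hermite-Biehler functions and the passage from bounded type to the Hardy class. -/

theorem sharp_ofReal (f : ℂ → ℂ) (t : ℝ) : sharp f t = conj (f t) := by simp [sharp]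

theorem norm_sharp_ofReal (f : ℂ → ℂ) (t : ℝ) : ‖sharp f t‖ = ‖f t‖ := by
  rw [sharp_ofReal, RCLike.norm_conj]

theorem sharp_conj (f : ℂ → ℂ) (z : ℂ) : sharp f (conj z) = conj (f z) := by simp [sharp]

theorem sharp_mul (f g : ℂ → ℂ) : sharp (fun z => f z * g z) = fun z => sharp f z * sharp g z := by
  ext z; simp [sharp]

theorem hasDerivAt_sharp {f : ℂ → ℂ} (hf : Differentiable ℂ f) (z : ℂ) :
    HasDerivAt (sharp f) (conj (deriv f (conj z))) z := by
  have := (hf (conj z)).hasDerivAt.conj_conj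
  rwa [Complex.conj_conj] at this

theorem differentiable_sharp {f : ℂ → ℂ} (hf : Differentiable ℂ f) : Differentiable ℂ (sharp f) :=
  fun z => (hasDerivAt_sharp hf z).differentiableAt

theorem eq_zero_of_ofReal_eq_zero {f : ℂ → ℂ} (hf : Differentiable ℂ f)
    (h : ∀ t : ℝ, f t = 0) : f = 0 := by
  refine AnalyticOnNhd.eq_of_frequently_eq (z₀ := ((0 : ℝ) : ℂ)) (fun z _ => hf.analyticAt z)
    (fun z _ => analyticAt_const) ?_
  have ht : Tendsto (fun t : ℝ => (t : ℂ)) (𝓝[≠] 0) (𝓝[≠] ((0 : ℝ) : ℂ)) := by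
    refine tendsto_nhdsWithin_iff.2 ⟨?_, ?_⟩
    · exact (Complex.continuous_ofReal.tendsto 0).mono_left nhdsWithin_le_nhds
    · filter_upwards [self_mem_nhdsWithin] with t ht
      simpa using ht
  exact ht.frequently (Frequently.of_forall fun t => h t)

/-- Zero-free on the closed upper half-plane. -/
theorem HermiteBiehler.ne_zero {E : ℂ → ℂ} (hE : HermiteBiehler E) (hEr : NoRealZeros E) :
    ∀ z ∈ closedUpperHalf, E z ≠ 0 := by
  intro z hz
  rcases (show 0 ≤ z.im from hz).eq_or_lt with h | h
  · have : z = (z.re : ℂ) := Complex.ext rfl (by simp [← h])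
    rw [this]
    exact hEr z.re
  · exact norm_pos_iff.1 ((norm_nonneg _).trans_lt (hE.2 z h))

theorem HermiteBiehler.norm_sharp_lt {E : ℂ → ℂ} (hE : HermiteBiehler E) {z : ℂ} (hz : 0 < z.im) :
    ‖sharp E z‖ < ‖E z‖ := by
  rw [sharp, RCLike.norm_conj]
  exact hE.2 z hz

theorem HermiteBiehler.norm_sharp_le {E : ℂ → ℂ} (hE : HermiteBiehler E) {z : ℂ}
    (hz : z ∈ closedUpperHalf) : ‖sharp E z‖ ≤ ‖E z‖ := by
  rcases (show 0 ≤ z.im from hz).eq_or_lt with h | h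
  · have : z = (z.re : ℂ) := Complex.ext rfl (by simp [← h])
    rw [this, norm_sharp_ofReal]
  · exact (hE.norm_sharp_lt h).le

theorem HermiteBiehler.mul {E F : ℂ → ℂ} (hE : HermiteBiehler E) (hF : HermiteBiehler F) :
    HermiteBiehler fun z => E z * F z := by
  refine ⟨hE.1.mul hF.1, fun z hz => ?_⟩
  rw [norm_mul, norm_mul]
  exact mul_lt_mul'' (hE.2 z hz) (hF.2 z hz) (norm_nonneg _) (norm_nonneg _)

theorem analyticOnNhd_div {E f : ℂ → ℂ} (hE : HermiteBiehler E) (hEr : NoRealZeros E)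
    (hf : Differentiable ℂ f) : AnalyticOnNhd ℂ (fun z => f z / E z) closedUpperHalf :=
  fun z hz => (hf.analyticAt z).fun_div (hE.1.analyticAt z) (hE.ne_zero hEr z hz)

/-- The entire functions `f` such that `f / E` and `f* / E` are in the Hardy class. -/
def hardySpace (E : ℂ → ℂ) : Set (ℂ → ℂ) :=
  {f | Differentiable ℂ f ∧ IsHardy (fun z => f z / E z) ∧ IsHardy (fun z => sharp f z / E z)}

/-- This inclusion alone suffices: the later arguments run in `hardySpace`, whose conditions are
easily seen to survive L² limits and multiplication by F. -/
theorem space_subset_hardySpace {E : ℂ → ℂ} (hE : HermiteBiehler E) (hEr : NoRealZeros E) :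
    space E ⊆ hardySpace E := by
  rintro f ⟨hf, hi, hb1, hm1, hb2, hm2⟩
  have ha1 := analyticOnNhd_div hE hEr hf
  have ha2 := analyticOnNhd_div hE hEr (differentiable_sharp hf)
  refine ⟨hf, isHardy_of_boundedType ha1 ?_ hb1 hm1, isHardy_of_boundedType ha2 ?_ hb2 hm2⟩
  · rw [memLp_two_iff_integrable_sq_norm
      (continuous_ofReal_of_analyticOnNhd ha1).aestronglyMeasurable]
    exact hi
  · rw [memLp_two_iff_integrable_sq_norm
      (continuous_ofReal_of_analyticOnNhd ha2).aestronglyMeasurable]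
    refine hi.congr (Eventually.of_forall fun t => ?_)
    simp only [norm_div, norm_sharp_ofReal]

/-! ### The reproducing kernel at real points. -/

theorem kernelNum_self_ofReal (E : ℂ → ℂ) (x : ℝ) : kernelNum E x x = 0 := by
  simp [kernelNum, sharp, mul_comm]

theorem differentiable_kernelNum {E : ℂ → ℂ} (hE : Differentiable ℂ E) (w : ℂ) :
    Differentiable ℂ (kernelNum E w) :=
  (hE.const_mul _).sub ((differentiable_sharp hE).const_mul _)

theorem kernel_ofReal_eq (E : ℂ → ℂ) (x : ℝ) :
    kernel E x = fun z => -dslope (kernelNum E x) x z / (2 * Real.pi * Complex.I) := by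
  ext z
  rw [kernel, Complex.conj_ofReal]
  split_ifs with h
  · rw [h, dslope_same]
  · rw [dslope_eq_div h, kernelNum_self_ofReal, sub_zero]
    have h1 : (x : ℂ) - z ≠ 0 := sub_ne_zero.2 (Ne.symm h)
    have h2 : z - (x : ℂ) ≠ 0 := sub_ne_zero.2 h
    have h3 : z - (x : ℂ) = -((x : ℂ) - z) := by ring
    rw [h3]
    field_simp

theorem kernel_ofReal_of_ne (E : ℂ → ℂ) {x : ℝ} {z : ℂ} (h : z ≠ x) :
    kernel E x z = kernelNum E x z / (2 * Real.pi * Complex.I * (x - z)) := by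
  rw [kernel, Complex.conj_ofReal, if_neg h]

theorem differentiable_kernel {E : ℂ → ℂ} (hE : Differentiable ℂ E) (x : ℝ) :
    Differentiable ℂ (kernel E x) := by
  rw [kernel_ofReal_eq]
  have h : AnalyticOnNhd ℂ (kernelNum E x) univ := fun z _ =>
    (differentiable_kernelNum hE x).analyticAt z
  exact fun z => ((h.dslope (a := (x : ℂ)) z (mem_univ z)).differentiableAt.neg).div_const _

/-- This halves the membership conditions for the kernel. Off the point x it is a computation;
continuity gives the rest. -/
theorem sharp_kernel {E : ℂ → ℂ} (hE : Differentiable ℂ E) (x : ℝ) :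
    sharp (kernel E x) = kernel E x := by
  refine Continuous.ext_on (s := {(x : ℂ)}ᶜ) (dense_compl_singleton _)
    (differentiable_sharp (differentiable_kernel hE x)).continuous
    (differentiable_kernel hE x).continuous fun z hz => ?_
  have hz' : z ≠ x := hz
  have hz2 : conj z ≠ (x : ℂ) := fun h => hz' (by
    rw [← Complex.conj_conj z, h, Complex.conj_ofReal])
  rw [sharp, kernel_ofReal_of_ne E hz2, kernel_ofReal_of_ne E hz', kernelNum, kernelNum]
  simp only [map_div₀, map_sub, map_mul, Complex.conj_conj, Complex.conj_I, Complex.conj_ofReal,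
    sharp, map_ofNat]
  rw [← neg_div_neg_eq]
  congr 1 <;> ring

/-- From |E*| ≤ |E| in the closed half-plane. This one estimate yields bounded type, nonpositive
mean type and square integrability of the kernel divided by E. -/
theorem norm_kernel_div_mul_le {E : ℂ → ℂ} (hE : HermiteBiehler E) (hEr : NoRealZeros E) (x : ℝ)
    {z : ℂ} (hz : z ∈ closedUpperHalf) : ‖kernel E x z / E z‖ * ‖z - x‖ ≤ ‖E x‖ := by
  have hpi := Real.pi_gt_three
  rcases eq_or_ne z x with rfl | h
  · simp
  have hEz := norm_pos_iff.2 (hE.ne_zero hEr z hz)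
  have hzx : 0 < ‖z - x‖ := norm_pos_iff.2 (sub_ne_zero.2 h)
  have h1 : ‖kernelNum E x z‖ ≤ 2 * ‖E x‖ * ‖E z‖ := by
    rw [kernelNum, Complex.conj_ofReal]
    refine (norm_sub_le _ _).trans ?_
    rw [norm_mul, norm_mul, RCLike.norm_conj]
    have := mul_le_mul_of_nonneg_left (hE.norm_sharp_le hz) (norm_nonneg (E x))
    linarith
  rw [kernel_ofReal_of_ne E h, norm_div, norm_div, norm_mul, norm_mul, norm_mul, norm_sub_rev (x : ℂ) z]
  simp only [Complex.norm_ofNat, Complex.norm_real, Complex.norm_I, Real.norm_eq_abs,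
    abs_of_pos Real.pi_pos, mul_one]
  calc _ = ‖kernelNum E x z‖ / (2 * Real.pi * ‖E z‖) := by field_simp
    _ ≤ 2 * ‖E x‖ * ‖E z‖ / (2 * Real.pi * ‖E z‖) := by gcongr
    _ = ‖E x‖ / Real.pi := by field_simp
    _ ≤ ‖E x‖ := div_le_self (norm_nonneg _) (by linarith)

theorem kernel_mem_space {E : ℂ → ℂ} (hE : HermiteBiehler E) (hEr : NoRealZeros E) (x : ℝ) :
    kernel E x ∈ space E := by
  have hd := differentiable_kernel hE.1 x
  have hb := fun {z : ℂ} (hz : z ∈ closedUpperHalf) => norm_kernel_div_mul_le hE hEr x hz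
  set k : ℂ → ℂ := fun z => kernel E x z / E z with hk
  have hka : AnalyticOnNhd ℂ k closedUpperHalf := analyticOnNhd_div hE hEr hd
  have hkd : DifferentiableOn ℂ k upperHalf := fun z hz =>
    (hka z (le_of_lt (show 0 < z.im from hz))).differentiableAt.differentiableWithinAt
  have hzI : ∀ z : ℂ, 0 ≤ z.im → 1 ≤ ‖z + Complex.I‖ := fun z hz => by
    have := (le_abs_self _).trans (Complex.abs_im_le_norm (z + Complex.I))
    simp at this
    linarith
  have hzI0 : ∀ z : ℂ, 0 ≤ z.im → z + Complex.I ≠ 0 := fun z hz =>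
    norm_pos_iff.1 (by linarith [hzI z hz])
  have hbt : BoundedType k := by
    refine ⟨hkd, fun z => k z * ((z - x) / (z + Complex.I)), fun z => (z - x) / (z + Complex.I),
      ⟨?_, ‖E x‖, ?_⟩, ⟨?_, 1 + ‖(x : ℂ) + Complex.I‖, ?_⟩, ⟨Complex.I, by simp [upperHalf], ?_⟩,
      fun z _ => rfl⟩
    · exact hkd.mul (DifferentiableOn.div (by fun_prop) (by fun_prop)
        fun z hz => hzI0 z (le_of_lt hz))
    · intro z hz
      have hz0 : 0 ≤ z.im := le_of_lt hz
      rw [norm_mul, norm_div (z - x), ← mul_div_assoc]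
      exact (div_le_self (by positivity) (hzI z hz0)).trans (hb hz0)
    · exact DifferentiableOn.div (by fun_prop) (by fun_prop) fun z hz => hzI0 z (le_of_lt hz)
    · intro z hz
      have h1 := hzI z (le_of_lt hz)
      rw [norm_div, div_le_iff₀ (by linarith)]
      have h2 : ‖z - x‖ ≤ ‖z + Complex.I‖ + ‖(x : ℂ) + Complex.I‖ := by
        have : z - x = (z + Complex.I) - (x + Complex.I) := by ring
        rw [this]
        exact norm_sub_le _ _
      nlinarith [norm_nonneg ((x : ℂ) + Complex.I)]
    · refine div_ne_zero (fun h => ?_) (hzI0 _ (by simp))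
      have := congrArg Complex.im h
      simp at this
  have hmt : meanType k ≤ 0 := by
    refine meanType_le_zero_of_bounded (M := ‖E x‖) ?_
    filter_upwards [eventually_ge_atTop 1] with y hy
    have h1 := hb (z := y * Complex.I) (by simp [closedUpperHalf]; linarith)
    have h2 : 1 ≤ ‖(y : ℂ) * Complex.I - x‖ := by
      have := (le_abs_self _).trans (Complex.abs_im_le_norm ((y : ℂ) * Complex.I - x))
      simp at this
      linarith
    exact (le_mul_of_one_le_right (norm_nonneg _) h2).trans h1
  refine ⟨hd, ?_, hbt, hmt, ?_, ?_⟩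
  · have hc := continuous_ofReal_of_analyticOnNhd hka
    obtain ⟨M, hM⟩ := (isCompact_closedBall x 1).exists_bound_of_continuousOn hc.continuousOn
    set p : ℂ := x - Complex.I with hp
    have hpim : p.im ≠ 0 := by simp [hp]
    have h2 : MemLp (fun t : ℝ => k t) 2 := by
      refine (memLp_inv_sub hpim).of_le_mul (c := |M| + 2 * ‖E x‖) hc.aestronglyMeasurable
        (Eventually.of_forall fun t => ?_)
      rw [norm_inv, ← div_eq_mul_inv, le_div_iff₀ (norm_pos_iff.2 (ofReal_sub_ne_zero hpim t))]
      have h3 : ‖(t : ℂ) - p‖ ≤ ‖(t : ℂ) - x‖ + 1 := by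
        have : (t : ℂ) - p = (t - x) + Complex.I := by rw [hp]; ring
        rw [this]
        exact (norm_add_le _ _).trans (by simp)
      have h4 := hb (ofReal_mem_closedUpperHalf t)
      have h5 : ‖k t‖ ≤ |M| + ‖E x‖ := by
        rcases le_or_gt ‖(t : ℂ) - x‖ 1 with h | h
        · have h6 : t ∈ closedBall x 1 := by
            rw [mem_closedBall, Real.dist_eq]
            rwa [← Complex.ofReal_sub, Complex.norm_real, Real.norm_eq_abs] at h
          linarith [hM t h6, le_abs_self M, norm_nonneg (E x)]
        · have : ‖k t‖ ≤ ‖k t‖ * ‖(t : ℂ) - x‖ := le_mul_of_one_le_right (norm_nonneg _) h.le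
          linarith [abs_nonneg M]
      calc ‖k t‖ * ‖(t : ℂ) - p‖ ≤ ‖k t‖ * (‖(t : ℂ) - x‖ + 1) := by gcongr
        _ ≤ _ := by linarith
    rw [memLp_two_iff_integrable_sq_norm hc.aestronglyMeasurable] at h2
    exact h2
  · rw [sharp_kernel hE.1 x]; exact hbt
  · rw [sharp_kernel hE.1 x]; exact hmt

theorem kernel_mem_hardySpace {E : ℂ → ℂ} (hE : HermiteBiehler E) (hEr : NoRealZeros E) (x : ℝ) :
    kernel E x ∈ hardySpace E :=
  space_subset_hardySpace hE hEr (kernel_mem_space hE hEr x)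

/-- The reproducing property at real points. -/
theorem integral_mul_conj_kernel {E f : ℂ → ℂ} (hEr : NoRealZeros E)
    (hf : f ∈ hardySpace E) (x : ℝ) :
    ∫ t : ℝ, f t / E t * conj (kernel E x t / E t) = f x := by
  obtain ⟨hfd, h1, h2⟩ := hf
  set p : ℂ := x - Complex.I with hp
  have hpim : p.im < 0 := by simp [hp]
  have hxp : (x : ℂ) ≠ p := fun h => by
    have := congrArg Complex.im h
    simp [hp] at this
  obtain ⟨i1, e1⟩ := h1.integral_dslope_cauchyAux x hpim hxp
  obtain ⟨i2, e2⟩ := h2.integral_dslope_cauchyAux x hpim hxp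
  set N₁ : ℝ → ℂ := fun t => dslope (cauchyAux (fun z => f z / E z) x p) x t with hN₁
  set N₂ : ℝ → ℂ := fun t => dslope (cauchyAux (fun z => sharp f z / E z) x p) x t with hN₂
  have i2' : Integrable fun t => conj (N₂ t) :=
    (LinearIsometryEquiv.integrable_comp_iff (RCLike.conjLIE (K := ℂ))).2 i2
  have e2' : ∫ t, conj (N₂ t) = 0 := by rw [integral_conj, e2, map_zero]
  have hpi : (Real.pi : ℂ) ≠ 0 := by exact_mod_cast Real.pi_ne_zero
  -- The two terms of the kernel pair with Cauchy's formulas for f/E and f*/E, whose integrals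
  -- vanish. What remains is f(x)/π times the integral of |t - p|⁻², which is π because Im p = -1.
  have hpt : ∀ t : ℝ, t ≠ x → f t / E t * conj (kernel E x t / E t) =
      E x / (2 * Real.pi * Complex.I) * N₁ t -
        conj (E x) / (2 * Real.pi * Complex.I) * conj (N₂ t) +
        f x / Real.pi * (‖((t : ℂ) - p)⁻¹‖ ^ 2 : ℝ) := by
    intro t ht
    have htc : (t : ℂ) ≠ x := by exact_mod_cast ht
    have htx : (t : ℂ) - x ≠ 0 := sub_ne_zero.2 htc
    have hxt : (x : ℂ) - t ≠ 0 := sub_ne_zero.2 htc.symm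
    have hEx := hEr x
    have hEt := hEr t
    have hcEx : conj (E x) ≠ 0 := by simpa using hEx
    have hcEt : conj (E t) ≠ 0 := by simpa using hEt
    have hq1 : (t : ℂ) - x + Complex.I ≠ 0 := by
      have := ofReal_sub_ne_zero hpim.ne t
      rwa [hp, ← sub_add] at this
    have hq2 : (t : ℂ) - x - Complex.I ≠ 0 := by
      intro h
      have := congrArg Complex.im h
      simp at this
    have hsq : ((‖((t : ℂ) - p)⁻¹‖ ^ 2 : ℝ) : ℂ) =
        (((t : ℂ) - x + Complex.I) * ((t : ℂ) - x - Complex.I))⁻¹ := by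
      rw [norm_inv, inv_pow, ← Complex.normSq_eq_norm_sq, Complex.ofReal_inv, ← Complex.mul_conj]
      congr 1
      rw [hp]
      simp only [map_sub, Complex.conj_ofReal, Complex.conj_I]
      ring
    rw [hsq, hN₁, hN₂]
    simp only
    rw [dslope_eq_div htc, dslope_eq_div htc, cauchyAux_self _ hxp, cauchyAux_self _ hxp,
      kernel_ofReal_of_ne E htc, kernelNum, cauchyAux, cauchyAux, hp]
    simp only [sharp_ofReal, map_div₀, map_sub, map_mul, Complex.conj_conj, Complex.conj_I,
      Complex.conj_ofReal, map_ofNat, sub_zero, map_inv₀]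
    have hq1' : (t : ℂ) - (x - Complex.I) = t - x + Complex.I := by ring
    have hq2' : (t : ℂ) - (x - -Complex.I) = t - x - Complex.I := by ring
    rw [hq1', hq2']
    have hxt' : (x : ℂ) - t = -(t - x) := by ring
    rw [hxt']
    field_simp
    ring_nf
  have hae : ∀ᵐ t : ℝ, t ≠ x := by
    simp [ae_iff]
  rw [integral_congr_ae (hae.mono hpt)]
  obtain ⟨i3, e3⟩ := integrable_inv_normSq_sub hpim.ne
  have i3' : Integrable fun t : ℝ => ((‖((t : ℂ) - p)⁻¹‖ ^ 2 : ℝ) : ℂ) := i3.ofReal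
  have i12 : Integrable fun t => E x / (2 * Real.pi * Complex.I) * N₁ t -
      conj (E x) / (2 * Real.pi * Complex.I) * conj (N₂ t) :=
    (i1.const_mul _).sub (i2'.const_mul _)
  rw [integral_add i12 (i3'.const_mul _),
    integral_sub (i1.const_mul _) (i2'.const_mul _), integral_const_mul, integral_const_mul,
    integral_const_mul, e1, e2', integral_complex_ofReal, e3]
  have : p.im = -1 := by simp [hp]
  rw [this]
  simp [hpi]

theorem kernel_self_eq_normSq {E : ℂ → ℂ} (hE : HermiteBiehler E) (hEr : NoRealZeros E) (x : ℝ) :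
    kernel E x x = (normSq E (kernel E x) : ℂ) := by
  rw [← integral_mul_conj_kernel hEr (kernel_mem_hardySpace hE hEr x) x, normSq,
    ← integral_complex_ofReal]
  refine integral_congr_ae (Eventually.of_forall fun t => ?_)
  simp only [Complex.mul_conj, Complex.normSq_eq_norm_sq]

/-- If the norm of the kernel were zero, the reproducing formula would make the kernel vanish on the
line, hence everywhere; but its numerator at x + i is nonzero because |E*| < |E| there. -/
theorem kernel_self_re_pos {E : ℂ → ℂ} (hE : HermiteBiehler E) (hEr : NoRealZeros E) (x : ℝ) :
    0 < (kernel E x x).re := by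
  rw [kernel_self_eq_normSq hE hEr, Complex.ofReal_re]
  have hnn : 0 ≤ normSq E (kernel E x) := integral_nonneg fun _ => by positivity
  refine lt_of_le_of_ne hnn fun h => ?_
  have hk := kernel_mem_space hE hEr x
  have h1 : (fun t : ℝ => ‖kernel E x t / E t‖ ^ 2) =ᵐ[volume] 0 :=
    (integral_eq_zero_iff_of_nonneg (fun _ => by positivity) hk.2.1).1 h.symm
  have h2 : kernel E x = 0 := by
    refine eq_zero_of_ofReal_eq_zero (differentiable_kernel hE.1 x) fun y => ?_
    rw [← integral_mul_conj_kernel hEr (kernel_mem_hardySpace hE hEr x) y]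
    refine integral_eq_zero_of_ae (h1.mono fun t ht => ?_)
    have : kernel E x t / E t = 0 := by
      simpa using ht
    simp [this]
  have hne : (x : ℂ) + Complex.I ≠ x := by simp
  have h3 := congrFun h2 ((x : ℂ) + Complex.I)
  rw [kernel_ofReal_of_ne E hne, Pi.zero_apply, div_eq_zero_iff] at h3
  rcases h3 with h3 | h3
  · rw [kernelNum, Complex.conj_ofReal, sub_eq_zero] at h3
    have h4 := congrArg norm h3
    rw [norm_mul, norm_mul, RCLike.norm_conj] at h4
    have h5 := mul_left_cancel₀ (norm_ne_zero_iff.2 (hEr x)) h4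
    exact (hE.norm_sharp_lt (z := (x : ℂ) + Complex.I) (by simp)).ne' h5
  · simp [Real.pi_ne_zero] at h3

/-! ### The diagonal of the kernel and the phase. -/

theorem deriv_kernelNum {E : ℂ → ℂ} (hE : Differentiable ℂ E) (x : ℝ) :
    deriv (kernelNum E x) x = 2 * (conj (E x) * deriv E x).im * Complex.I := by
  have h1 : HasDerivAt (kernelNum E x) (conj (E x) * deriv E x - E x * conj (deriv E x)) x := by
    have h := hasDerivAt_sharp hE (x : ℂ)
    rw [Complex.conj_ofReal] at h
    have h2 := ((hE x).hasDerivAt.const_mul (conj (E x))).sub (h.const_mul (E x))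
    refine h2.congr_of_eventuallyEq (Eventually.of_forall fun z => ?_)
    simp [kernelNum]
  rw [h1.deriv]
  have := Complex.sub_conj (conj (E x) * deriv E x)
  rw [map_mul, Complex.conj_conj] at this
  rw [this]
  push_cast
  ring

theorem kernel_self_re_eq_im {E : ℂ → ℂ} (hE : Differentiable ℂ E) (x : ℝ) :
    (kernel E x x).re = -(conj (E x) * deriv E x).im / Real.pi := by
  have : kernel E x x = ((-(conj (E x) * deriv E x).im / Real.pi : ℝ) : ℂ) := by
    rw [kernel, Complex.conj_ofReal, if_pos rfl, deriv_kernelNum hE]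
    have hpi : (Real.pi : ℂ) ≠ 0 := by exact_mod_cast Real.pi_ne_zero
    push_cast
    field_simp
  rw [this, Complex.ofReal_re]

/-- The diagonal of the reproducing kernel in terms of the derivative of the phase. -/
theorem kernel_self_re_eq_deriv_phase {E : ℂ → ℂ} (hE : Differentiable ℂ E) (hEr : NoRealZeros E)
    {φ : ℝ → ℝ} (hφ : IsPhase E φ) (x : ℝ) :
    (kernel E x x).re = deriv φ x * ‖E x‖ ^ 2 / Real.pi := by
  obtain ⟨hc, -, hE1⟩ := hφ
  set a : ℝ → ℂ := fun t => conj (E x) * E t with ha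
  have had : HasDerivAt a (conj (E x) * deriv E x) x :=
    (HasDerivAt.comp_ofReal (hE x).hasDerivAt).const_mul _
  have hax : a x = ((‖E x‖ ^ 2 : ℝ) : ℂ) := by
    rw [ha]
    simp only
    rw [mul_comm, Complex.mul_conj, Complex.normSq_eq_norm_sq]
  have hEx : 0 < ‖E x‖ := norm_pos_iff.2 (hEr x)
  have hslit : a x ∈ Complex.slitPlane := by
    rw [hax, Complex.ofReal_mem_slitPlane]
    positivity
  have hlog := had.clog_real hslit
  have him : HasDerivAt (fun t => (Complex.log (a t)).im)
      ((conj (E x) * deriv E x) / a x).im x :=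
    Complex.imCLM.hasFDerivAt.comp_hasDerivAt x hlog
  -- Where |φ(t) - φ(x)| < π the principal argument of conj E(x) · E(t) is φ(x) - φ(t). This
  -- recovers φ near x from an explicit function, so its differentiability is derived rather than
  -- assumed.
  have hev : φ =ᶠ[𝓝 x] fun t => φ x - (Complex.log (a t)).im := by
    have hnear : ∀ᶠ t in 𝓝 x, |φ t - φ x| < Real.pi := by
      have := (hc.tendsto x).eventually (Metric.ball_mem_nhds (φ x) Real.pi_pos)
      filter_upwards [this] with t ht
      rwa [Real.dist_eq] at ht
    filter_upwards [hnear] with t ht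
    have hat : a t = ((‖E x‖ * ‖E t‖ : ℝ) : ℂ) * (Complex.cos (φ x - φ t : ℝ) +
        Complex.sin (φ x - φ t : ℝ) * Complex.I) := by
      rw [← Complex.exp_mul_I, ha]
      simp only
      conv_lhs => rw [hE1 t, hE1 x]
      have : conj (Complex.exp (-Complex.I * φ x)) = Complex.exp (Complex.I * φ x) := by
        rw [← Complex.exp_conj]
        simp
      rw [map_mul, this, Complex.conj_ofReal]
      have h2 : Complex.exp ((φ x - φ t : ℝ) * Complex.I) =
          Complex.exp (Complex.I * φ x) * Complex.exp (-Complex.I * φ t) := by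
        rw [← Complex.exp_add]; congr 1; push_cast; ring
      rw [h2]
      push_cast
      ring
    have hb := abs_lt.1 ht
    rw [Complex.log_im, hat, Complex.arg_mul_cos_add_sin_mul_I
      (mul_pos hEx (norm_pos_iff.2 (hEr t))) ⟨by linarith [hb.2], by linarith [hb.1]⟩]
    ring
  have hder : deriv φ x = -((conj (E x) * deriv E x) / a x).im := by
    rw [hev.deriv_eq]
    exact (him.const_sub (φ x)).deriv
  rw [hder, kernel_self_re_eq_im hE, hax, Complex.div_ofReal_im]
  field_simp

/-- Additivity of the logarithmic derivative, that is, of phases: the diagonal is -|E|² Im(E'/E)/π.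
-/
theorem kernel_mul_self_re {E F : ℂ → ℂ} (hE : Differentiable ℂ E) (hF : Differentiable ℂ F)
    (x : ℝ) : (kernel (fun z => E z * F z) x x).re =
      ‖F x‖ ^ 2 * (kernel E x x).re + ‖E x‖ ^ 2 * (kernel F x x).re := by
  have hEF : Differentiable ℂ fun z => E z * F z := hE.mul hF
  rw [kernel_self_re_eq_im hEF, kernel_self_re_eq_im hE, kernel_self_re_eq_im hF]
  have h1 : deriv (fun z => E z * F z) x = deriv E x * F x + E x * deriv F x :=
    ((hE x).hasDerivAt.mul (hF x).hasDerivAt).deriv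
  have h2 : conj (E x * F x) * deriv (fun z => E z * F z) x =
      ((‖F x‖ ^ 2 : ℝ) : ℂ) * (conj (E x) * deriv E x) +
        ((‖E x‖ ^ 2 : ℝ) : ℂ) * (conj (F x) * deriv F x) := by
    rw [h1, ← Complex.normSq_eq_norm_sq, ← Complex.normSq_eq_norm_sq, ← Complex.mul_conj,
      ← Complex.mul_conj, map_mul]
    ring
  rw [h2, Complex.add_im, Complex.im_ofReal_mul, Complex.im_ofReal_mul]
  ring

/-! ### Orthonormal families with one-dimensional defect. -/

/-- Expansion of a vector along an orthonormal family, with Parseval's identity for the sum. -/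
theorem _root_.Orthonormal.exists_expansion {H ι : Type*} [NormedAddCommGroup H]
    [InnerProductSpace ℂ H] [CompleteSpace H] {e : ι → H} (he : Orthonormal ℂ e) (u : H) :
    ∃ S : H, HasSum (fun i => ⟪e i, u⟫_ℂ • e i) S ∧ (∀ i, ⟪e i, u - S⟫_ℂ = 0) ∧
      (∀ x, (∀ i, ⟪e i, x⟫_ℂ = 0) → ⟪x, S⟫_ℂ = 0) ∧
      ∑' i, ‖⟪e i, u⟫_ℂ‖ ^ 2 = ‖u‖ ^ 2 - ‖u - S‖ ^ 2 := by
  classical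
  have hs : Summable fun i => ⟪e i, u⟫_ℂ • e i :=
    (he.orthogonalFamily.summable_iff_norm_sq_summable fun i => ⟪e i, u⟫_ℂ).2
      (he.inner_products_summable u)
  obtain ⟨S, hS⟩ := hs
  have hinner : ∀ x : H, HasSum (fun i => ⟪e i, u⟫_ℂ * ⟪x, e i⟫_ℂ) ⟪x, S⟫_ℂ := fun x => by
    have := (innerSL ℂ x).hasSum hS
    simpa [inner_smul_right] using this
  have hz : ∀ i, ⟪e i, S⟫_ℂ = ⟪e i, u⟫_ℂ := fun j => by
    refine (hinner (e j)).unique ?_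
    have h1 : (fun i => ⟪e i, u⟫_ℂ * ⟪e j, e i⟫_ℂ) = fun i => if i = j then ⟪e j, u⟫_ℂ else 0 := by
      ext i
      rw [orthonormal_iff_ite.1 he j i]
      by_cases h : i = j
      · simp [h]
      · simp [h, Ne.symm h]
    rw [h1]
    exact hasSum_ite_eq j _
  have hort : ∀ x, (∀ i, ⟪e i, x⟫_ℂ = 0) → ⟪x, S⟫_ℂ = 0 := fun x hx => by
    refine (hinner x).unique ?_
    have : (fun i => ⟪e i, u⟫_ℂ * ⟪x, e i⟫_ℂ) = fun _ => 0 := by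
      ext i
      rw [← inner_conj_symm x, hx i, map_zero, mul_zero]
    rw [this]
    exact hasSum_zero
  have hu0 : ∀ i, ⟪e i, u - S⟫_ℂ = 0 := fun i => by rw [inner_sub_right, hz, sub_self]
  refine ⟨S, hS, hu0, hort, ?_⟩
  have h2 : HasSum (fun i => ‖⟪e i, u⟫_ℂ‖ ^ 2) (‖S‖ ^ 2) := by
    have h3 := hinner S
    have h4 : (fun i => ⟪e i, u⟫_ℂ * ⟪S, e i⟫_ℂ) = fun i => ((‖⟪e i, u⟫_ℂ‖ ^ 2 : ℝ) : ℂ) := by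
      ext i
      rw [← inner_conj_symm S, hz, Complex.mul_conj, Complex.normSq_eq_norm_sq]
    rw [h4, inner_self_eq_norm_sq_to_K] at h3
    have h5 : ((‖S‖ : ℂ)) ^ 2 = ((‖S‖ ^ 2 : ℝ) : ℂ) := by push_cast; rfl
    exact Complex.hasSum_ofReal.1 (by rw [← h5]; exact h3)
  rw [h2.tsum_eq]
  have h6 : ‖u‖ * ‖u‖ = ‖u - S‖ * ‖u - S‖ + ‖S‖ * ‖S‖ := by
    have := norm_add_sq_eq_norm_sq_add_norm_sq_of_inner_eq_zero (𝕜 := ℂ) (u - S) S (hort _ hu0)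
    rwa [sub_add_cancel] at this
  nlinarith

/-- If the defect of an orthonormal family in a closed subspace `N` is at most one-dimensional and
does not meet the closed subspace `M` of `N`, then the family is sampling for `M`. -/
theorem _root_.Orthonormal.exists_lower_bound {H ι : Type*} [NormedAddCommGroup H]
    [InnerProductSpace ℂ H] [CompleteSpace H] {e : ι → H} (he : Orthonormal ℂ e)
    {M N : Submodule ℂ H} (hM : IsClosed (M : Set H)) (hN : IsClosed (N : Set H)) (hMN : M ≤ N)
    (heN : ∀ i, e i ∈ N)
    (hdim : ∀ r ∈ N, ∀ r' ∈ N, (∀ i, ⟪e i, r⟫_ℂ = 0) → (∀ i, ⟪e i, r'⟫_ℂ = 0) → r ≠ 0 →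
      ∃ c : ℂ, r' = c • r)
    (hinj : ∀ u ∈ M, (∀ i, ⟪e i, u⟫_ℂ = 0) → u = 0) :
    ∃ δ : ℝ, 0 < δ ∧ ∀ u ∈ M, δ * ‖u‖ ^ 2 ≤ ∑' i, ‖⟪e i, u⟫_ℂ‖ ^ 2 := by
  -- The residual r of u after expansion lies in the defect, and the sum of squares falls short of
  -- ‖u‖² by exactly ‖r‖².
  have hres : ∀ u ∈ M, ∃ r ∈ N, (∀ i, ⟪e i, r⟫_ℂ = 0) ∧
      (∀ x, (∀ i, ⟪e i, x⟫_ℂ = 0) → ⟪x, r⟫_ℂ = ⟪x, u⟫_ℂ) ∧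
      ∑' i, ‖⟪e i, u⟫_ℂ‖ ^ 2 = ‖u‖ ^ 2 - ‖r‖ ^ 2 := by
    intro u hu
    obtain ⟨S, hS, h1, h2, h3⟩ := he.exists_expansion u
    have hSN : S ∈ N := hN.mem_of_tendsto hS (Eventually.of_forall fun s =>
      N.sum_mem fun i _ => N.smul_mem _ (heN i))
    refine ⟨u - S, N.sub_mem (hMN hu) hSN, h1, fun x hx => ?_, h3⟩
    rw [inner_sub_right, h2 x hx, sub_zero]
  by_cases hex : ∃ a ∈ N, (∀ i, ⟪e i, a⟫_ℂ = 0) ∧ a ≠ 0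
  · obtain ⟨a, haN, hae, ha0⟩ := hex
    have : CompleteSpace M := hM.completeSpace_coe
    have haM : a ∉ M := fun h => ha0 (hinj a h hae)
    -- For u in M the residual is c a with c ‖a‖² = ⟪a, u⟫ = ⟪b, u⟫, so its norm is at most ‖b‖/‖a‖
    -- · ‖u‖. As a is not in M, ‖b‖ < ‖a‖: the ratio is the cosine of the angle between a and M.
    set b : H := M.starProjection a with hb
    have hbM : b ∈ M := M.starProjection_apply_mem a
    have hbu : ∀ u ∈ M, ⟪a, u⟫_ℂ = ⟪b, u⟫_ℂ := fun u hu => by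
      have := M.starProjection_inner_eq_zero a u hu
      rw [inner_sub_left, sub_eq_zero] at this
      exact this
    have hab : ‖b‖ ^ 2 < ‖a‖ ^ 2 := by
      have h1 : ⟪a - b, b⟫_ℂ = 0 := by rw [inner_sub_left, hbu b hbM, sub_self]
      have h2 := norm_add_sq_eq_norm_sq_add_norm_sq_of_inner_eq_zero (𝕜 := ℂ) (a - b) b h1
      rw [sub_add_cancel] at h2
      have h3 : 0 < ‖a - b‖ := norm_pos_iff.2 fun h => haM (by rw [sub_eq_zero.1 h]; exact hbM)
      nlinarith
    have ha : 0 < ‖a‖ ^ 2 := by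
      have := norm_pos_iff.2 ha0
      positivity
    refine ⟨1 - ‖b‖ ^ 2 / ‖a‖ ^ 2, by rw [sub_pos, div_lt_one ha]; exact hab, fun u hu => ?_⟩
    obtain ⟨r, hrN, hre, hru, hsum⟩ := hres u hu
    obtain ⟨c, rfl⟩ := hdim a haN r hrN hae hre ha0
    have h1 := hru a hae
    rw [inner_smul_right, hbu u hu, inner_self_eq_norm_sq_to_K] at h1
    have h2 := congrArg norm h1
    have h3 : ‖((‖a‖ : ℂ)) ^ 2‖ = ‖a‖ ^ 2 := by rw [norm_pow, Complex.norm_real, norm_norm]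
    rw [norm_mul] at h2
    have h4 : ‖c‖ * ‖a‖ ^ 2 ≤ ‖b‖ * ‖u‖ := by
      rw [← h3]
      exact h2.trans_le (norm_inner_le_norm b u)
    rw [hsum, norm_smul]
    have h5 : (‖c‖ * ‖a‖) ^ 2 ≤ ‖b‖ ^ 2 / ‖a‖ ^ 2 * ‖u‖ ^ 2 := by
      rw [div_mul_eq_mul_div, le_div_iff₀ ha]
      calc _ = (‖c‖ * ‖a‖ ^ 2) ^ 2 := by ring
        _ ≤ (‖b‖ * ‖u‖) ^ 2 := pow_le_pow_left₀ (by positivity) h4 2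
        _ = _ := by ring
    linarith
  · push Not at hex
    refine ⟨1, one_pos, fun u hu => ?_⟩
    obtain ⟨r, hrN, hre, -, hsum⟩ := hres u hu
    rw [hsum, hex r hrN hre, norm_zero]
    linarith

/-! ### Local bounds and closedness in L². -/

/-- An entire function that is small off the real axis on a circle is small in a concentric disc. -/
theorem norm_le_of_norm_mul_im_pow_le {f : ℂ → ℂ} (hf : Differentiable ℂ f) {R M : ℝ} (hR : 0 < R)
    (k : ℕ) (h : ∀ z : ℂ, ‖z‖ = R → ‖f z‖ * |z.im| ^ k ≤ M) {z : ℂ} (hz : ‖z‖ ≤ R / 2) :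
    ‖f z‖ ≤ M * (3 / R) ^ k := by
  -- On |y| = R one has y² - R² = y (y - conj y), of modulus 2R |Im y|, so this factor supplies the
  -- powers of |Im y|; for |z| ≤ R/2 its base is at least 3R²/4 in modulus.
  set g : ℂ → ℂ := fun z => f z * (z ^ 2 - R ^ 2) ^ k with hg
  have hgd : Differentiable ℂ g := by fun_prop
  have hmax : ‖g z‖ ≤ M * (2 * R) ^ k := by
    refine Complex.norm_le_of_forall_mem_frontier_norm_le (U := ball (0 : ℂ) R) isBounded_ball
      hgd.diffContOnCl (fun y hy => ?_) ?_
    · rw [frontier_ball (0 : ℂ) hR.ne'] at hy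
      have hyR : ‖y‖ = R := by simpa using hy
      have h1 : y ^ 2 - (R : ℂ) ^ 2 = y * (y - conj y) := by
        have : (R : ℂ) ^ 2 = y * conj y := by
          rw [Complex.mul_conj, Complex.normSq_eq_norm_sq, hyR]; push_cast; rfl
        rw [this]; ring
      have h2 : ‖y ^ 2 - (R : ℂ) ^ 2‖ = 2 * R * |y.im| := by
        rw [h1, norm_mul, Complex.sub_conj, norm_mul, Complex.norm_I, mul_one, Complex.norm_real,
          Real.norm_eq_abs, abs_mul, abs_of_pos (by norm_num : (0 : ℝ) < 2), hyR]
        ring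
      rw [hg, norm_mul, norm_pow, h2, mul_pow]
      have := mul_le_mul_of_nonneg_right (h y hyR) (by positivity : 0 ≤ (2 * R) ^ k)
      linarith
    · rw [closure_ball (0 : ℂ) hR.ne']
      simp only [mem_closedBall, dist_zero_right]
      linarith
  have hlow : 3 * R ^ 2 / 4 ≤ ‖z ^ 2 - (R : ℂ) ^ 2‖ := by
    have h1 := norm_sub_norm_le ((R : ℂ) ^ 2) (z ^ 2)
    rw [norm_sub_rev, norm_pow, norm_pow, Complex.norm_real, Real.norm_eq_abs, sq_abs] at h1
    nlinarith [norm_nonneg z]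
  have hM0 : 0 ≤ M := (by positivity : 0 ≤ ‖f (R : ℂ)‖ * |(R : ℂ).im| ^ k).trans
    (h R (by simp [abs_of_pos hR]))
  rw [hg, norm_mul, norm_pow] at hmax
  have h3 : ‖f z‖ * (3 * R ^ 2 / 4) ^ k ≤ M * (2 * R) ^ k :=
    (mul_le_mul_of_nonneg_left (pow_le_pow_left₀ (by positivity) hlow k) (norm_nonneg _)).trans hmax
  have h4 : (2 * R) ^ k ≤ (3 / R) ^ k * (3 * R ^ 2 / 4) ^ k := by
    rw [← mul_pow]
    refine pow_le_pow_left₀ (by positivity) ?_ k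
    have : 3 / R * (3 * R ^ 2 / 4) = 9 / 4 * R := by field_simp; ring
    rw [this]
    linarith
  have h5 : ‖f z‖ * (3 * R ^ 2 / 4) ^ k ≤ M * (3 / R) ^ k * (3 * R ^ 2 / 4) ^ k := by
    refine h3.trans ?_
    rw [mul_assoc]
    exact mul_le_mul_of_nonneg_left h4 hM0
  exact le_of_mul_le_mul_right h5 (by positivity)

theorem normSq_sharp (E f : ℂ → ℂ) : ∫ t : ℝ, ‖sharp f t / E t‖ ^ 2 = normSq E f := by
  simp only [normSq, norm_div, norm_sharp_ofReal]

/-- Functions in `hardySpace E` are locally bounded by their norm. -/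
theorem exists_sq_norm_le {E : ℂ → ℂ} (hE : HermiteBiehler E) (hEr : NoRealZeros E) {R : ℝ}
    (hR : 0 < R) : ∃ C : ℝ, ∀ f ∈ hardySpace E, ∀ z : ℂ, ‖z‖ ≤ R → ‖f z‖ ^ 2 ≤ C * normSq E f := by
  obtain ⟨M, hM⟩ := (isCompact_closedBall (0 : ℂ) (2 * R)).exists_bound_of_continuousOn
    hE.1.continuous.continuousOn
  have hM0 : 0 ≤ M := (norm_nonneg _).trans (hM 0 (by simp [hR.le]))
  refine ⟨M ^ 2 * (2 * R) * (3 / (2 * R)) ^ 2, fun f hf z hz => ?_⟩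
  obtain ⟨hfd, h1, h2⟩ := hf
  set N := normSq E f with hN
  have hN0 : 0 ≤ N := integral_nonneg fun _ => by positivity
  have hpi := Real.pi_gt_three
  -- Stated for general g because it is applied to f on the upper half of the circle and to f* for
  -- the lower half.
  have key : ∀ g : ℂ → ℂ, IsHardy (fun z => g z / E z) → ∫ t : ℝ, ‖g t / E t‖ ^ 2 = N →
      ∀ y : ℂ, ‖y‖ = 2 * R → 0 < y.im → (‖g y‖ * y.im) ^ 2 ≤ M ^ 2 * (2 * R) * N := by
    intro g hg hgN y hyR hy
    have h3 := hg.sq_norm_le hy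
    rw [hgN, norm_div, div_pow, div_le_iff₀ (by
      have := norm_pos_iff.2 (hE.ne_zero hEr y hy.le); positivity)] at h3
    have h4 : ‖E y‖ ≤ M := hM y (by simp [hyR])
    have h5 : N / (4 * Real.pi * y.im) * y.im ≤ N := by
      have : N / (4 * Real.pi * y.im) * y.im = N / (4 * Real.pi) := by field_simp
      rw [this]
      exact div_le_self hN0 (by linarith)
    have h6 : y.im ≤ 2 * R := by
      rw [← hyR]; exact (le_abs_self _).trans (Complex.abs_im_le_norm y)
    calc (‖g y‖ * y.im) ^ 2 = ‖g y‖ ^ 2 * y.im ^ 2 := by ring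
      _ ≤ N / (4 * Real.pi * y.im) * ‖E y‖ ^ 2 * y.im ^ 2 := by gcongr
      _ = (N / (4 * Real.pi * y.im) * y.im) * ‖E y‖ ^ 2 * y.im := by ring
      _ ≤ N * M ^ 2 * (2 * R) := by gcongr
      _ = _ := by ring
  have hcirc : ∀ y : ℂ, ‖y‖ = 2 * R → ‖f y‖ * |y.im| ^ 1 ≤ √(M ^ 2 * (2 * R) * N) := by
    intro y hy
    rw [pow_one]
    refine Real.le_sqrt_of_sq_le ?_
    rcases lt_trichotomy y.im 0 with h | h | h
    · have h3 := key (sharp f) h2 (by rw [normSq_sharp]) (conj y) (by simpa using hy)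
        (by simpa using h)
      rw [sharp_conj, RCLike.norm_conj, Complex.conj_im] at h3
      rwa [abs_of_neg h]
    · rw [h]
      simp
      positivity
    · rw [abs_of_pos h]
      exact key f h1 rfl y hy h
  have h7 := norm_le_of_norm_mul_im_pow_le hfd (by positivity) 1 hcirc (z := z) (by linarith)
  calc ‖f z‖ ^ 2 ≤ (√(M ^ 2 * (2 * R) * N) * (3 / (2 * R)) ^ 1) ^ 2 :=
        pow_le_pow_left₀ (norm_nonneg _) h7 2
    _ = _ := by rw [mul_pow, Real.sq_sqrt (by positivity)]; ring

theorem IsHardy.add {f g : ℂ → ℂ} (hf : IsHardy f) (hg : IsHardy g) :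
    IsHardy fun z => f z + g z := by
  obtain ⟨K, hK⟩ := hf.bound
  obtain ⟨K', hK'⟩ := hg.bound
  refine ⟨fun z hz => (hf.analytic z hz).fun_add (hg.analytic z hz), hf.memLp.add hg.memLp,
    K + K', fun z hz => ?_⟩
  rw [add_mul]
  exact (norm_add_le _ _).trans (add_le_add (hK z hz) (hK' z hz))

theorem IsHardy.const_mul {f : ℂ → ℂ} (hf : IsHardy f) (c : ℂ) : IsHardy fun z => c * f z := by
  obtain ⟨K, hK⟩ := hf.bound
  refine ⟨fun z hz => analyticAt_const.fun_mul (hf.analytic z hz), hf.memLp.const_mul c,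
    ‖c‖ * K, fun z hz => ?_⟩
  rw [norm_mul, mul_assoc]
  exact mul_le_mul_of_nonneg_left (hK z hz) (norm_nonneg _)

theorem sharp_add (f g : ℂ → ℂ) : sharp (fun z => f z + g z) = fun z => sharp f z + sharp g z := by
  ext z; simp [sharp]

theorem sharp_const_mul (c : ℂ) (f : ℂ → ℂ) :
    sharp (fun z => c * f z) = fun z => conj c * sharp f z := by
  ext z; simp [sharp]

theorem add_mem_hardySpace {E f g : ℂ → ℂ} (hf : f ∈ hardySpace E) (hg : g ∈ hardySpace E) :
    (fun z => f z + g z) ∈ hardySpace E := by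
  refine ⟨hf.1.add hg.1, ?_, ?_⟩
  · simpa only [add_div] using hf.2.1.add hg.2.1
  · rw [sharp_add]
    simpa only [add_div] using hf.2.2.add hg.2.2

theorem const_mul_mem_hardySpace {E f : ℂ → ℂ} (hf : f ∈ hardySpace E) (c : ℂ) :
    (fun z => c * f z) ∈ hardySpace E := by
  refine ⟨hf.1.const_mul c, ?_, ?_⟩
  · simpa only [mul_div_assoc] using hf.2.1.const_mul c
  · rw [sharp_const_mul]
    simpa only [mul_div_assoc] using hf.2.2.const_mul (conj c)

theorem isHardy_zero : IsHardy fun _ => 0 :=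
  ⟨fun _ _ => analyticAt_const, MemLp.zero', 0, fun z _ => by simp⟩

theorem zero_mem_hardySpace (E : ℂ → ℂ) : (fun _ => 0) ∈ hardySpace E := by
  refine ⟨differentiable_const _, ?_, ?_⟩
  · simpa using isHardy_zero
  · simpa [sharp] using isHardy_zero

/-- The functions `f / E`, `f ∈ hardySpace E`, as a subspace of `L²(ℝ)`. -/
noncomputable def hardySubmodule (E : ℂ → ℂ) : Submodule ℂ (Lp ℂ 2 (volume : Measure ℝ)) where
  carrier := {u | ∃ f ∈ hardySpace E, u =ᵐ[volume] fun t : ℝ => f t / E t}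
  add_mem' := by
    rintro u v ⟨f, hf, hu⟩ ⟨g, hg, hv⟩
    refine ⟨_, add_mem_hardySpace hf hg, ?_⟩
    filter_upwards [hu, hv, Lp.coeFn_add u v] with t h1 h2 h3
    rw [h3, Pi.add_apply, h1, h2, add_div]
  zero_mem' := by
    refine ⟨_, zero_mem_hardySpace E, ?_⟩
    filter_upwards [Lp.coeFn_zero ℂ 2 (volume : Measure ℝ)] with t h1
    rw [h1, Pi.zero_apply, zero_div]
  smul_mem' := by
    rintro c u ⟨f, hf, hu⟩
    refine ⟨_, const_mul_mem_hardySpace hf c, ?_⟩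
    filter_upwards [hu, Lp.coeFn_smul c u] with t h1 h2
    rw [h2, Pi.smul_apply, h1, smul_eq_mul, mul_div_assoc]

theorem sq_norm_eq_integral (u : Lp ℂ 2 (volume : Measure ℝ)) : ‖u‖ ^ 2 = ∫ t, ‖u t‖ ^ 2 := by
  have h : ⟪u, u⟫_ℂ = ∫ t, ((‖u t‖ ^ 2 : ℝ) : ℂ) := by
    rw [L2.inner_def]
    refine integral_congr_ae (Eventually.of_forall fun t => ?_)
    simp only [inner_self_eq_norm_sq_to_K]
    push_cast
    rfl
  rw [integral_complex_ofReal, inner_self_eq_norm_sq_to_K] at h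
  have h2 : ((‖u‖ ^ 2 : ℝ) : ℂ) = ((∫ t, ‖u t‖ ^ 2 : ℝ) : ℂ) := by
    rw [← h]; push_cast; rfl
  exact_mod_cast h2

theorem sq_norm_eq_normSq {E f : ℂ → ℂ} {u : Lp ℂ 2 (volume : Measure ℝ)}
    (hu : u =ᵐ[volume] fun t : ℝ => f t / E t) : ‖u‖ ^ 2 = normSq E f := by
  rw [sq_norm_eq_integral, normSq]
  refine integral_congr_ae (hu.mono fun t ht => ?_)
  simp only [ht]

theorem exists_bound_of_sq_norm_le {g : ℂ → ℂ} {N : ℝ} (hN : 0 ≤ N)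
    (h : ∀ z : ℂ, 0 < z.im → ‖g z‖ ^ 2 ≤ N / (4 * Real.pi * z.im)) :
    ∃ K : ℝ, ∀ z : ℂ, 0 < z.im → ‖g z‖ ≤ K * (1 + 1 / z.im) := by
  have hpi := Real.pi_gt_three
  refine ⟨N + 1, fun z hz => ?_⟩
  have h4 : 0 < 1 / z.im := by positivity
  refine (abs_le_of_sq_le_sq' (b := (N + 1) * (1 + 1 / z.im)) ?_ (by positivity)).2
  refine (h z hz).trans ?_
  have h2 : N / (4 * Real.pi * z.im) = N / (4 * Real.pi) * (1 / z.im) := by field_simp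
  rw [h2, mul_pow]
  have h3 : N / (4 * Real.pi) ≤ (N + 1) ^ 2 := by
    refine (div_le_self hN (by linarith)).trans ?_
    nlinarith
  have h5 : 1 / z.im ≤ (1 + 1 / z.im) ^ 2 := by nlinarith
  gcongr

/-- By the local bound, L² convergence forces locally uniform convergence, so the limit comes from
an entire function, identified with the L² limit along an almost everywhere convergent subsequence.
The Hardy estimate has a constant depending only on the norm and passes to the limit. -/
theorem isClosed_hardySubmodule {E : ℂ → ℂ} (hE : HermiteBiehler E) (hEr : NoRealZeros E) :
    IsClosed (hardySubmodule E : Set (Lp ℂ 2 (volume : Measure ℝ))) := by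
  refine IsSeqClosed.isClosed fun v u hv hvu => ?_
  choose f hf hfv using hv
  have hdiff : ∀ n m, (fun z => f n z - f m z) ∈ hardySpace E ∧
      normSq E (fun z => f n z - f m z) = ‖v n - v m‖ ^ 2 := fun n m => by
    have h1 := add_mem_hardySpace (hf n) (const_mul_mem_hardySpace (hf m) (-1))
    have h2 : (fun z => f n z + -1 * f m z) = fun z => f n z - f m z := by
      ext z; ring
    rw [h2] at h1
    refine ⟨h1, (sq_norm_eq_normSq ?_).symm⟩
    filter_upwards [hfv n, hfv m, Lp.coeFn_sub (v n) (v m)] with t a1 a2 a3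
    rw [a3, Pi.sub_apply, a1, a2, sub_div]
  have hvc : CauchySeq v := hvu.cauchySeq
  have hunif : ∀ R : ℝ, 0 < R → UniformCauchySeqOn f atTop (closedBall 0 R) := by
    intro R hR
    obtain ⟨C, hC⟩ := exists_sq_norm_le hE hEr hR
    rw [Metric.uniformCauchySeqOn_iff]
    intro ε hε
    obtain ⟨n₀, hn₀⟩ := Metric.cauchySeq_iff.1 hvc (ε / (|C| + 1)) (by positivity)
    refine ⟨n₀, fun m hm n hn z hz => ?_⟩
    have h1 := hC _ (hdiff m n).1 z (by simpa using hz)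
    rw [(hdiff m n).2] at h1
    have h2 := hn₀ m hm n hn
    rw [dist_eq_norm] at h2 ⊢
    refine lt_of_pow_lt_pow_left₀ 2 hε.le ?_
    have hC1 : 1 ≤ |C| + 1 := by linarith [abs_nonneg C]
    calc _ ≤ C * ‖v m - v n‖ ^ 2 := h1
      _ ≤ (|C| + 1) * ‖v m - v n‖ ^ 2 :=
        mul_le_mul_of_nonneg_right (by linarith [le_abs_self C]) (by positivity)
      _ < (|C| + 1) * (ε / (|C| + 1)) ^ 2 := by gcongr
      _ = ε ^ 2 / (|C| + 1) := by field_simp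
      _ ≤ ε ^ 2 := div_le_self (by positivity) hC1
  have hlimex : ∀ z, ∃ y, Tendsto (fun n => f n z) atTop (𝓝 y) := fun z => by
    refine cauchySeq_tendsto_of_complete ?_
    exact (hunif (‖z‖ + 1) (by positivity)).cauchySeq (by simp)
  choose g hg using hlimex
  have hloc : TendstoLocallyUniformlyOn f g atTop univ := by
    rw [tendstoLocallyUniformlyOn_iff_forall_isCompact isOpen_univ]
    intro K _ hK
    obtain ⟨R, hR⟩ := hK.isBounded.subset_closedBall (0 : ℂ)
    have h1 := (hunif (max R 1) (by positivity)).tendstoUniformlyOn_of_tendsto (f := g)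
      fun z _ => hg z
    exact h1.mono (hR.trans (closedBall_subset_closedBall (le_max_left _ _)))
  have hgd : Differentiable ℂ g := by
    rw [← differentiableOn_univ]
    exact hloc.differentiableOn (Eventually.of_forall fun n => (hf n).1.differentiableOn) isOpen_univ
  have hae : u =ᵐ[volume] fun t : ℝ => g t / E t := by
    obtain ⟨φ, hφm, hφ⟩ := (tendstoInMeasure_of_tendsto_Lp hvu).exists_seq_tendsto_ae
    have hall : ∀ᵐ t : ℝ, ∀ n, v n t = f n t / E t := ae_all_iff.2 hfv
    filter_upwards [hφ, hall] with t h1 h2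
    refine tendsto_nhds_unique h1 ?_
    simp only [h2]
    exact ((hg t).comp hφm.tendsto_atTop).div_const _
  have hnorm : ∀ n, ‖v n‖ ^ 2 = normSq E (f n) := fun n => sq_norm_eq_normSq (hfv n)
  have hbd : ∀ (q : ℕ → ℂ → ℂ) (r : ℂ → ℂ), (∀ n, IsHardy fun z => q n z / E z) →
      (∀ n, ∫ t : ℝ, ‖q n t / E t‖ ^ 2 = ‖v n‖ ^ 2) → (∀ z, Tendsto (fun n => q n z) atTop (𝓝 (r z))) →
      ∀ z : ℂ, 0 < z.im → ‖r z / E z‖ ^ 2 ≤ ‖u‖ ^ 2 / (4 * Real.pi * z.im) := by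
    intro q r hq hqv hqr z hz
    refine le_of_tendsto_of_tendsto' ((((hqr z).div_const (E z)).norm).pow 2)
      (((hvu.norm).pow 2).div_const _) fun n => ?_
    rw [← hqv n]
    exact (hq n).sq_norm_le hz
  have hm : MemLp (fun t : ℝ => g t / E t) 2 := (Lp.memLp u).ae_eq hae
  refine ⟨g, ⟨hgd, ⟨analyticOnNhd_div hE hEr hgd, hm, ?_⟩,
    ⟨analyticOnNhd_div hE hEr (differentiable_sharp hgd), ?_, ?_⟩⟩, hae⟩
  · exact exists_bound_of_sq_norm_le (by positivity)
      (hbd f g (fun n => (hf n).2.1) (fun n => (hnorm n).symm) hg)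
  · refine hm.of_le (continuous_ofReal_of_analyticOnNhd
      (analyticOnNhd_div hE hEr (differentiable_sharp hgd))).aestronglyMeasurable
      (Eventually.of_forall fun t => ?_)
    rw [norm_div, norm_div, norm_sharp_ofReal]
  · refine exists_bound_of_sq_norm_le (by positivity)
      (hbd (fun n => sharp (f n)) (sharp g) (fun n => (hf n).2.2)
        (fun n => by rw [normSq_sharp, hnorm]) fun z => ?_)
    exact (Complex.continuous_conj.tendsto _).comp (hg (conj z))

/-! ### The zeros of B + B* and the functions vanishing there. -/

theorem HermiteBiehler.add_sharp_ne_zero {B : ℂ → ℂ} (hB : HermiteBiehler B) {z : ℂ}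
    (hz : z.im ≠ 0) : B z + sharp B z ≠ 0 := by
  intro h
  have h1 : ‖B z‖ = ‖sharp B z‖ := by rw [eq_neg_of_add_eq_zero_left h, norm_neg]
  rcases lt_or_gt_of_ne hz with h0 | h0
  · have h2 := hB.2 (conj z) (by simpa using h0)
    rw [Complex.conj_conj] at h2
    rw [sharp, RCLike.norm_conj] at h1
    exact h2.ne h1
  · exact (hB.norm_sharp_lt h0).ne' h1

/-- At such a zero conj B(x) = -B(x), so the kernel is a multiple of (B + B*)/(z - x). Kernels at
distinct zeros are therefore orthogonal, and positivity of the diagonal makes the zeros simple. -/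
theorem kernelNum_of_add_sharp_eq_zero {B : ℂ → ℂ} {x : ℝ} (hx : B x + sharp B x = 0) :
    kernelNum B x = fun z => conj (B x) * (B z + sharp B z) := by
  ext z
  rw [sharp_ofReal] at hx
  rw [kernelNum, Complex.conj_ofReal]
  linear_combination (-sharp B z) * hx

theorem kernel_of_add_sharp_eq_zero {B : ℂ → ℂ} {x y : ℝ} (hx : B x + sharp B x = 0)
    (hy : B y + sharp B y = 0) (hxy : y ≠ x) : kernel B x y = 0 := by
  rw [kernel_ofReal_of_ne B (by exact_mod_cast hxy), kernelNum_of_add_sharp_eq_zero hx]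
  simp only [hy, mul_zero, zero_div]

theorem deriv_add_sharp_ne_zero {B : ℂ → ℂ} (hB : HermiteBiehler B) (hBr : NoRealZeros B) {x : ℝ}
    (hx : B x + sharp B x = 0) : deriv (fun z => B z + sharp B z) x ≠ 0 := by
  intro h
  have h1 : deriv (kernelNum B x) x = 0 := by
    rw [kernelNum_of_add_sharp_eq_zero hx, deriv_const_mul_field, h, mul_zero]
  have h2 := kernel_self_re_pos hB hBr x
  rw [kernel, Complex.conj_ofReal, if_pos rfl, h1] at h2
  simp at h2

/-- An entire function vanishing at the zeros, all of them simple, of an entire function `A` is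
divisible by `A`. -/
theorem exists_entire_quotient {f A : ℂ → ℂ} (hf : Differentiable ℂ f) (hA : Differentiable ℂ A)
    (h : ∀ z, A z = 0 → deriv A z ≠ 0 ∧ f z = 0) :
    ∃ D : ℂ → ℂ, Differentiable ℂ D ∧ ∀ z, f z = D z * A z := by
  classical
  refine ⟨fun z => if A z = 0 then deriv f z / deriv A z else f z / A z, fun a => ?_, fun z => ?_⟩
  · by_cases ha : A a = 0
    · have h1 : AnalyticAt ℂ (fun z => dslope f a z / dslope A a z) a :=
        (hf.analyticAt a).dslope_self.fun_div (hA.analyticAt a).dslope_self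
          (by rw [dslope_same]; exact (h a ha).1)
      refine h1.differentiableAt.congr_of_eventuallyEq ?_
      have h2 : ∀ᶠ z in 𝓝 a, dslope A a z ≠ 0 :=
        (hA.analyticAt a).dslope_self.continuousAt.eventually_ne
          (by rw [dslope_same]; exact (h a ha).1)
      filter_upwards [h2] with z hz
      rcases eq_or_ne z a with rfl | hza
      · simp only [if_pos ha, dslope_same]
      · rw [dslope_eq_div hza, ha, sub_zero] at hz
        have hzA : A z ≠ 0 := fun h0 => hz (by rw [h0, zero_div])
        rw [dslope_eq_div hza, dslope_eq_div hza, (h a ha).2, ha, sub_zero, sub_zero, if_neg hzA]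
        have : z - a ≠ 0 := sub_ne_zero.2 hza
        field_simp
    · have h1 : AnalyticAt ℂ (fun z => f z / A z) a :=
        (hf.analyticAt a).fun_div (hA.analyticAt a) ha
      refine h1.differentiableAt.congr_of_eventuallyEq ?_
      filter_upwards [(hA a).continuousAt.eventually_ne ha] with z hz
      rw [if_neg hz]
  · by_cases hz : A z = 0
    · rw [hz, mul_zero, (h z hz).2]
    · simp only [if_neg hz]
      field_simp

theorem exists_affine_of_linear_growth {f : ℂ → ℂ} (hf : Differentiable ℂ f) {M : ℝ}
    (h : ∀ z, ‖f z‖ ≤ M * (1 + ‖z‖)) : ∃ a b : ℂ, ∀ z, f z = a + b * z := by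
  have han : AnalyticOnNhd ℂ f univ := fun z _ => hf.analyticAt z
  have hd : Differentiable ℂ (dslope f 0) := fun z => (han.dslope z (mem_univ z)).differentiableAt
  have hM : 0 ≤ M := by have := (norm_nonneg _).trans (h 0); simpa using this
  obtain ⟨K, hK⟩ := (isCompact_closedBall (0 : ℂ) 1).exists_bound_of_continuousOn
    hd.continuous.continuousOn
  have hb : Bornology.IsBounded (range (dslope f 0)) := by
    refine isBounded_iff_forall_norm_le.2 ⟨|K| + (2 * M + ‖f 0‖), ?_⟩
    rintro _ ⟨z, rfl⟩
    rcases le_total ‖z‖ 1 with h1 | h1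
    · have := hK z (by simpa using h1)
      linarith [le_abs_self K, norm_nonneg (f 0)]
    · have hz : z ≠ 0 := norm_pos_iff.1 (by linarith)
      have h2 : ‖dslope f 0 z‖ ≤ 2 * M + ‖f 0‖ := by
        rw [dslope_eq_div hz, sub_zero, norm_div, div_le_iff₀ (by linarith)]
        have h3 := norm_sub_le (f z) (f 0)
        have h4 := h z
        nlinarith [norm_nonneg (f 0)]
      linarith [abs_nonneg K]
  refine ⟨f 0, dslope f 0 0, fun z => ?_⟩
  rw [hd.apply_eq_apply_of_bounded hb 0 z]
  rcases eq_or_ne z 0 with rfl | hz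
  · simp
  · rw [dslope_eq_div hz, sub_zero, div_mul_cancel₀ _ hz]
    ring

theorem exists_const_of_sqrt_growth {f : ℂ → ℂ} (hf : Differentiable ℂ f) {M : ℝ}
    (h : ∀ z, ‖f z‖ ^ 2 ≤ M * (1 + ‖z‖)) : ∃ a : ℂ, ∀ z, f z = a := by
  have hM : 0 ≤ M := by have := (sq_nonneg _).trans (h 0); simpa using this
  obtain ⟨a, b, hab⟩ := exists_affine_of_linear_growth hf (M := M + 1) fun z => by
    refine (abs_le_of_sq_le_sq' (b := (M + 1) * (1 + ‖z‖)) ((h z).trans ?_) (by positivity)).2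
    rw [mul_pow]
    have h1 : M ≤ (M + 1) ^ 2 := by nlinarith
    have h2 : 1 + ‖z‖ ≤ (1 + ‖z‖) ^ 2 := by nlinarith [norm_nonneg z]
    gcongr
  suffices hb : b = 0 from ⟨a, fun z => by rw [hab, hb, zero_mul, add_zero]⟩
  by_contra hb
  set β := ‖b‖ ^ 2 with hβ
  have hβ0 : 0 < β := by have := norm_pos_iff.2 hb; positivity
  set c := 2 * M + 2 * ‖a‖ ^ 2 with hc
  have hc0 : 0 ≤ c := by positivity
  have key : ∀ t : ℝ, 0 ≤ t → β * t ^ 2 ≤ c * (1 + t) := fun t ht => by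
    have h1 : b * t = f t - a := by rw [hab]; ring
    have h2 : ‖b‖ * t ≤ ‖f t‖ + ‖a‖ := by
      have := norm_sub_le (f t) a
      rwa [← h1, norm_mul, Complex.norm_real, Real.norm_of_nonneg ht] at this
    have h3 := h t
    rw [Complex.norm_real, Real.norm_of_nonneg ht] at h3
    have h4 : (‖b‖ * t) ^ 2 ≤ 2 * ‖f t‖ ^ 2 + 2 * ‖a‖ ^ 2 :=
      (pow_le_pow_left₀ (by positivity) h2 2).trans (by nlinarith [sq_nonneg (‖f t‖ - ‖a‖)])
    rw [mul_pow] at h4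
    nlinarith [mul_nonneg (sq_nonneg ‖a‖) ht]
  -- At this t the two sides of the inequality differ by exactly β, in the wrong direction.
  have h1 := key (c / β + 1) (by positivity)
  have h2 : β * (c / β + 1) = c + β := by field_simp
  have h3 : β * (c / β + 1) ^ 2 = (c + β) * (c / β + 1) := by rw [← h2]; ring
  rw [h3] at h1
  nlinarith

/-- Division by B + B* costs no more than division by B up to a factor (|z|² + 1)/y, since |B + B*|
≥ |B| (1 - |B*/B|) and the Harnack bound applies to B*/B. -/
theorem exists_norm_add_sharp_div_ge {B : ℂ → ℂ} (hB : HermiteBiehler B) (hBr : NoRealZeros B) :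
    ∃ c > 0, ∀ z : ℂ, 0 < z.im →
      c * z.im / (‖z‖ ^ 2 + 1) * ‖B z‖ ≤ ‖B z + sharp B z‖ := by
  obtain ⟨c, hc, h⟩ := exists_le_one_sub_norm (θ := fun z => sharp B z / B z)
    (fun z hz => (analyticOnNhd_div hB hBr (differentiable_sharp hB.1) z
      (le_of_lt (show 0 < z.im from hz))).differentiableAt.differentiableWithinAt)
    (fun z hz => by
      have := hB.norm_sharp_lt hz
      rw [norm_div, div_lt_one ((norm_nonneg _).trans_lt this)]
      exact this)
  refine ⟨c, hc, fun z hz => ?_⟩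
  have hz0 : 0 < ‖B z‖ := (norm_nonneg _).trans_lt (hB.norm_sharp_lt hz)
  have h1 := mul_le_mul_of_nonneg_right (h z hz) hz0.le
  rw [norm_div, sub_mul, one_mul, div_mul_cancel₀ _ hz0.ne'] at h1
  have h2 := norm_sub_norm_le (B z) (-sharp B z)
  rw [norm_neg, sub_neg_eq_add] at h2
  linarith

/-- The Hardy estimate bounds f/B by a multiple of y^(-1/2), and B/(B + B*) by one of (|z|² + 1)/y.
Hence |D| y² = O(R^(5/2)) on |z| = R, the lower half being handled through f* and D*. Absorbing y²
leaves |D| = O(R^(1/2)) inside, so D is constant by Liouville's theorem. -/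
theorem exists_eq_const_mul_of_quotient {B f D : ℂ → ℂ} (hB : HermiteBiehler B)
    (hBr : NoRealZeros B) (hf : f ∈ hardySpace B) (hD : Differentiable ℂ D)
    (hfD : ∀ z, f z = D z * (B z + sharp B z)) : ∃ a : ℂ, ∀ z, D z = a := by
  obtain ⟨c, hc, hlow⟩ := exists_norm_add_sharp_div_ge hB hBr
  set N := normSq B f with hN
  have hN0 : 0 ≤ N := integral_nonneg fun _ => by positivity
  have key : ∀ g G : ℂ → ℂ, IsHardy (fun z => g z / B z) → ∫ t : ℝ, ‖g t / B t‖ ^ 2 = N →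
      (∀ z, g z = G z * (B z + sharp B z)) → ∀ z : ℂ, 0 < z.im →
      (‖G z‖ * z.im ^ 2) ^ 2 ≤ N / c ^ 2 * (‖z‖ * (‖z‖ ^ 2 + 1) ^ 2) := by
    intro g G hg hgN hgG z hz
    have h1 := hg.sq_norm_le hz
    rw [hgN, norm_div, div_pow] at h1
    have hz0 : 0 < ‖B z‖ := (norm_nonneg _).trans_lt (hB.norm_sharp_lt hz)
    have h2 := mul_le_mul_of_nonneg_left (hlow z hz) (norm_nonneg (G z))
    rw [← norm_mul, ← hgG z] at h2
    have h3 : (‖G z‖ * (c * z.im / (‖z‖ ^ 2 + 1))) ^ 2 ≤ N / (4 * Real.pi * z.im) := by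
      refine le_trans ?_ h1
      rw [le_div_iff₀ (by positivity), ← mul_pow, mul_assoc]
      exact pow_le_pow_left₀ (by positivity) h2 2
    have h4 : z.im ≤ ‖z‖ := (le_abs_self _).trans (Complex.abs_im_le_norm z)
    have hpi := Real.pi_gt_three
    calc (‖G z‖ * z.im ^ 2) ^ 2
        = (‖G z‖ * (c * z.im / (‖z‖ ^ 2 + 1))) ^ 2 * (z.im ^ 2 * (‖z‖ ^ 2 + 1) ^ 2 / c ^ 2) := by
          field_simp
      _ ≤ N / (4 * Real.pi * z.im) * (z.im ^ 2 * (‖z‖ ^ 2 + 1) ^ 2 / c ^ 2) := by gcongr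
      _ = N / c ^ 2 * (z.im * (‖z‖ ^ 2 + 1) ^ 2) / (4 * Real.pi) := by field_simp
      _ ≤ N / c ^ 2 * (z.im * (‖z‖ ^ 2 + 1) ^ 2) := div_le_self (by positivity) (by linarith)
      _ ≤ _ := by gcongr
  have hsharp : ∀ z, sharp f z = sharp D z * (B z + sharp B z) := fun z => by
    rw [sharp, hfD, map_mul, map_add, ← sharp, sharp_conj, Complex.conj_conj, add_comm]
    rfl
  have hcirc : ∀ R : ℝ, 1 ≤ R → ∀ y : ℂ, ‖y‖ = R →
      ‖D y‖ * |y.im| ^ 2 ≤ √(N / c ^ 2 * (R * (R ^ 2 + 1) ^ 2)) := by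
    intro R hR y hy
    refine Real.le_sqrt_of_sq_le ?_
    rcases lt_trichotomy y.im 0 with h | h | h
    · have h3 := key (sharp f) (sharp D) hf.2.2 (by rw [normSq_sharp]) hsharp (conj y)
        (by simpa using h)
      rw [sharp_conj, RCLike.norm_conj, RCLike.norm_conj, Complex.conj_im, hy] at h3
      rwa [abs_of_neg h]
    · rw [h]
      simp
      positivity
    · rw [abs_of_pos h, ← hy]
      exact key f D hf.2.1 rfl hfD y h
  refine exists_const_of_sqrt_growth hD (M := N / c ^ 2 * 648) fun z => ?_
  set R := 2 * (1 + ‖z‖) with hR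
  have hz := norm_nonneg z
  have hR1 : 1 ≤ R := by linarith
  have h1 := norm_le_of_norm_mul_im_pow_le hD (by linarith) 2 (hcirc R hR1) (z := z) (by linarith)
  have h2 : R ^ 2 + 1 ≤ 2 * R ^ 2 := by nlinarith
  have hR0 : 0 < R := by linarith
  calc ‖D z‖ ^ 2 ≤ (√(N / c ^ 2 * (R * (R ^ 2 + 1) ^ 2)) * (3 / R) ^ 2) ^ 2 :=
        pow_le_pow_left₀ (norm_nonneg _) h1 2
    _ = N / c ^ 2 * (R * (R ^ 2 + 1) ^ 2) * (3 / R) ^ 4 := by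
        rw [mul_pow, Real.sq_sqrt (by positivity)]; ring
    _ ≤ N / c ^ 2 * (R * (2 * R ^ 2) ^ 2) * (3 / R) ^ 4 := by gcongr
    _ = N / c ^ 2 * 324 * R := by field_simp; ring
    _ = _ := by rw [hR]; ring

/-- A function in `hardySpace B` that vanishes at the zeros of `B + B*` is a multiple of
`B + B*`. -/
theorem exists_eq_const_mul_add_sharp {B f : ℂ → ℂ} (hB : HermiteBiehler B) (hBr : NoRealZeros B)
    (hf : f ∈ hardySpace B) (h : ∀ x : ℝ, B x + sharp B x = 0 → f x = 0) :
    ∃ a : ℂ, ∀ z, f z = a * (B z + sharp B z) := by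
  obtain ⟨D, hD, hfD⟩ := exists_entire_quotient hf.1 (hB.1.add (differentiable_sharp hB.1))
    fun z hz => by
      have hz0 : z.im = 0 := by
        by_contra h0
        exact hB.add_sharp_ne_zero h0 hz
      have hzr : z = (z.re : ℂ) := Complex.ext rfl (by simp [hz0])
      have hz' : B z + sharp B z = 0 := hz
      rw [hzr] at hz' ⊢
      exact ⟨deriv_add_sharp_ne_zero hB hBr hz', h _ hz'⟩
  obtain ⟨a, ha⟩ := exists_eq_const_mul_of_quotient hB hBr hf hD hfD
  exact ⟨a, fun z => by rw [hfD, ha]; rfl⟩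

theorem exists_exp_eq {f : ℂ → ℂ} (hf : Differentiable ℂ f) (h0 : ∀ z, f z ≠ 0) :
    ∃ h : ℂ → ℂ, Differentiable ℂ h ∧ ∀ z, f z = Complex.exp (h z) := by
  have hq : Differentiable ℂ fun z => deriv f z / f z := hf.deriv.div hf h0
  obtain ⟨g, hg⟩ := hq.isExactOn_univ
  have hg' : ∀ z, HasDerivAt g (deriv f z / f z) z := fun z => by
    simpa using hg z (mem_univ z)
  set k : ℂ → ℂ := fun z => f z * Complex.exp (-g z) with hk
  have hkd : ∀ z, HasDerivAt k 0 z := fun z => by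
    have h1 := (hf z).hasDerivAt.mul ((hg' z).neg.cexp)
    refine h1.congr_deriv ?_
    have h2 : f z * (deriv f z / f z) = deriv f z := mul_div_cancel₀ _ (h0 z)
    simp only [Pi.neg_apply]
    linear_combination (-Complex.exp (-g z)) * h2
  have hconst : ∀ z, k z = k 0 := fun z =>
    is_const_of_deriv_eq_zero (fun z => (hkd z).differentiableAt) (fun z => (hkd z).deriv) z 0
  have hk0 : k 0 ≠ 0 := mul_ne_zero (h0 0) (Complex.exp_ne_zero _)
  refine ⟨fun z => Complex.log (k 0) + g z, fun z => ((hg' z).const_add _).differentiableAt,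
    fun z => ?_⟩
  rw [Complex.exp_add, Complex.exp_log hk0, ← hconst z, hk, mul_assoc, ← Complex.exp_add]
  simp

/-- For a zero-free Hermite-Biehler function `F`, the quotient `F* / F` is an exponential. -/
theorem tendsto_sharp_div_of_zeroFree {F : ℂ → ℂ} (hF : HermiteBiehler F) (h0 : ∀ z, F z ≠ 0) :
    Tendsto (fun y : ℝ => sharp F (y * Complex.I) / F (y * Complex.I)) atTop (𝓝 0) := by
  have hs0 : ∀ z, sharp F z ≠ 0 := fun z => by simpa [sharp] using h0 (conj z)
  obtain ⟨h, hd, hh⟩ := exists_exp_eq (f := fun z => F z / sharp F z)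
    (hF.1.div (differentiable_sharp hF.1) hs0) fun z => div_ne_zero (h0 z) (hs0 z)
  have hnorm : ∀ z, ‖F z‖ / ‖sharp F z‖ = Real.exp (h z).re := fun z => by
    rw [← norm_div, ← Complex.norm_exp, ← hh]
  -- Writing F/F* = exp h, the real part of h is positive above the axis, zero on it and odd under
  -- conjugation. Borel–Carathéodory bounds in both half-planes give linear growth, so h is affine,
  -- with Re h(iy) a positive multiple of y.
  have hpos : ∀ z : ℂ, 0 < z.im → 0 < (h z).re := fun z hz => by
    rw [← Real.one_lt_exp_iff, ← hnorm, one_lt_div (norm_pos_iff.2 (hs0 z))]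
    exact hF.norm_sharp_lt hz
  have hreal : ∀ t : ℝ, (h t).re = 0 := fun t => by
    rw [← Real.exp_eq_one_iff, ← hnorm, norm_sharp_ofReal,
      div_self (norm_ne_zero_iff.2 (h0 t))]
  have hneg : ∀ z : ℂ, (h (conj z)).re = -(h z).re := fun z => by
    rw [← Real.exp_eq_exp, Real.exp_neg, ← hnorm, ← hnorm, sharp_conj, sharp, RCLike.norm_conj,
      RCLike.norm_conj, inv_div]
  obtain ⟨C₁, hC₁, h1⟩ := exists_norm_le_of_re_nonneg hd.differentiableOn
    fun z hz => (hpos z hz).le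
  obtain ⟨C₂, hC₂, h2⟩ := exists_norm_le_of_re_nonneg (h := fun z => -sharp h z)
    (differentiable_sharp hd).neg.differentiableOn fun z hz => by
      have := hneg z
      rw [sharp, Complex.neg_re, Complex.conj_re, this, neg_neg]
      exact (hpos z hz).le
  have hcirc : ∀ R : ℝ, ∀ y : ℂ, ‖y‖ = R → ‖h y‖ * |y.im| ^ 1 ≤ (C₁ + C₂) * (R ^ 2 + 1) := by
    intro R y hy
    rw [pow_one, ← hy]
    have hq : 0 < ‖y‖ ^ 2 + 1 := by positivity
    rcases lt_trichotomy y.im 0 with h | h | h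
    · have h3 := h2 (conj y) (by simpa using h)
      rw [norm_neg, sharp_conj, RCLike.norm_conj, RCLike.norm_conj,
        le_div_iff₀ (by simpa using h), Complex.conj_im] at h3
      rw [abs_of_neg h]
      nlinarith
    · rw [h, abs_zero, mul_zero]
      positivity
    · have h3 := h1 y h
      rw [le_div_iff₀ h] at h3
      rw [abs_of_pos h]
      nlinarith
  obtain ⟨a, b, hab⟩ := exists_affine_of_linear_growth hd (M := (C₁ + C₂) * 12) fun z => by
    set R := 2 * (1 + ‖z‖) with hR
    have hz := norm_nonneg z
    have hR0 : 0 < R := by linarith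
    have h3 := norm_le_of_norm_mul_im_pow_le hd hR0 1 (hcirc R) (z := z) (by linarith)
    have h4 : R ^ 2 + 1 ≤ 2 * R ^ 2 := by nlinarith
    calc ‖h z‖ ≤ (C₁ + C₂) * (R ^ 2 + 1) * (3 / R) ^ 1 := h3
      _ ≤ (C₁ + C₂) * (2 * R ^ 2) * (3 / R) ^ 1 := by gcongr
      _ = (C₁ + C₂) * 6 * R := by field_simp; ring
      _ = _ := by rw [hR]; ring
  have ha : a.re = 0 := by simpa [hab] using hreal 0
  have hre : ∀ y : ℝ, (h (y * Complex.I)).re = -b.im * y := fun y => by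
    rw [hab]; simp [ha]
  have hb : 0 < -b.im := by
    have := hpos (((1 : ℝ) : ℂ) * Complex.I) (by simp)
    rwa [hre, mul_one] at this
  rw [tendsto_zero_iff_norm_tendsto_zero]
  have h5 : (fun y : ℝ => ‖sharp F (y * Complex.I) / F (y * Complex.I)‖) =
      fun y : ℝ => Real.exp (-(-b.im * y)) := by
    ext y
    rw [Real.exp_neg, ← hre, ← hnorm, inv_div, norm_div]
  rw [h5]
  exact Real.tendsto_exp_neg_atTop_nhds_zero.comp (tendsto_id.const_mul_atTop hb)

/-- For c ≠ 0 a zero of F would be a zero of E F + E* F*, hence real, which is excluded. With F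
zero-free, f/E = c (1 + (E*/E)(F*/F)) tends to c along iy because F*/F decays there, while the Hardy
estimate gives limit 0. -/
theorem eq_zero_of_mul_eq_const_mul {E F f : ℂ → ℂ} (hE : HermiteBiehler E)
    (hF : HermiteBiehler F) (hFr : NoRealZeros F) (hf : f ∈ hardySpace E) {c : ℂ}
    (h : ∀ z, f z * F z = c * (E z * F z + sharp (fun z => E z * F z) z)) : c = 0 := by
  by_contra hc
  have hF0 : ∀ z, F z ≠ 0 := fun z hz => by
    have h1 := h z
    rw [hz, mul_zero, mul_zero] at h1
    have h2 : (fun z => E z * F z) z + sharp (fun z => E z * F z) z = 0 := by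
      simp only [hz, mul_zero]
      exact (mul_eq_zero.1 h1.symm).resolve_left hc
    by_cases hz0 : z.im = 0
    · have hzr : z = (z.re : ℂ) := Complex.ext rfl (by simp [hz0])
      exact hFr z.re (by rw [← hzr]; exact hz)
    · exact (hE.mul hF).add_sharp_ne_zero hz0 h2
  have hT := tendsto_sharp_div_of_zeroFree hF hF0
  have hI : ∀ {y : ℝ}, 0 < y → 0 < ((y : ℂ) * Complex.I).im := fun hy => by simpa using hy
  have h1 : Tendsto (fun y : ℝ => sharp E (y * Complex.I) / E (y * Complex.I) *
      (sharp F (y * Complex.I) / F (y * Complex.I))) atTop (𝓝 0) := by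
    refine squeeze_zero_norm' ?_ (tendsto_zero_iff_norm_tendsto_zero.1 hT)
    filter_upwards [eventually_gt_atTop 0] with y hy
    have h2 := hE.norm_sharp_lt (hI hy)
    rw [norm_mul]
    refine mul_le_of_le_one_left (norm_nonneg _) ?_
    rw [norm_div]
    exact div_le_one_of_le₀ h2.le (norm_nonneg _)
  have h2 : Tendsto (fun y : ℝ => f (y * Complex.I) / E (y * Complex.I)) atTop (𝓝 c) := by
    have h3 := (h1.const_add 1).const_mul c
    rw [add_zero, mul_one] at h3
    refine h3.congr' ?_
    filter_upwards [eventually_gt_atTop 0] with y hy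
    have hE0 : E (y * Complex.I) ≠ 0 :=
      norm_pos_iff.1 ((norm_nonneg _).trans_lt (hE.norm_sharp_lt (hI hy)))
    have h4 := h (y * Complex.I)
    have h5 := hF0 (y * Complex.I)
    rw [sharp_mul] at h4
    rw [eq_div_iff hE0]
    refine mul_right_cancel₀ h5 ?_
    rw [h4]
    field_simp
  have h3 : Tendsto (fun y : ℝ => ‖f (y * Complex.I) / E (y * Complex.I)‖ ^ 2) atTop (𝓝 0) := by
    have h6 : Tendsto (fun y : ℝ => normSq E f / (4 * Real.pi) * y⁻¹) atTop (𝓝 0) := by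
      simpa using tendsto_inv_atTop_zero.const_mul (normSq E f / (4 * Real.pi))
    refine squeeze_zero' (Eventually.of_forall fun y => by positivity) ?_ h6
    filter_upwards [eventually_gt_atTop 0] with y hy
    have h7 := hf.2.1.sq_norm_le (hI hy)
    refine h7.trans (le_of_eq ?_)
    simp only [Complex.mul_im, Complex.ofReal_re, Complex.I_im, mul_one, Complex.ofReal_im,
      Complex.I_re, mul_zero, add_zero, normSq]
    field_simp
  have h8 := tendsto_nhds_unique h3 (h2.norm.pow 2)
  exact hc (norm_eq_zero.1 (pow_eq_zero_iff (two_ne_zero)|>.1 h8.symm))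

/-! ### The embedding of H(E) in H(E F) and sampling with the weights of E F. -/

theorem IsHardy.of_norm_le {g k : ℂ → ℂ} (hg : IsHardy g) (hk : AnalyticOnNhd ℂ k closedUpperHalf)
    (h : ∀ z ∈ closedUpperHalf, ‖k z‖ ≤ ‖g z‖) : IsHardy k := by
  obtain ⟨K, hK⟩ := hg.bound
  exact ⟨hk, hg.memLp.of_le (continuous_ofReal_of_analyticOnNhd hk).aestronglyMeasurable
    (Eventually.of_forall fun t => h t (ofReal_mem_closedUpperHalf t)), K,
    fun z hz => (h z (le_of_lt hz)).trans (hK z hz)⟩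

theorem NoRealZeros.mul {E F : ℂ → ℂ} (hEr : NoRealZeros E) (hFr : NoRealZeros F) :
    NoRealZeros fun z => E z * F z :=
  fun x => mul_ne_zero (hEr x) (hFr x)

theorem mul_mem_hardySpace {E F f : ℂ → ℂ} (hE : HermiteBiehler E) (hF : HermiteBiehler F)
    (hEr : NoRealZeros E) (hFr : NoRealZeros F) (hf : f ∈ hardySpace E) :
    (fun z => f z * F z) ∈ hardySpace fun z => E z * F z := by
  have hd : Differentiable ℂ fun z => f z * F z := hf.1.mul hF.1
  refine ⟨hd, hf.2.1.of_norm_le (analyticOnNhd_div (hE.mul hF) (hEr.mul hFr) hd) fun z hz => ?_,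
    hf.2.2.of_norm_le (analyticOnNhd_div (hE.mul hF) (hEr.mul hFr) (differentiable_sharp hd))
      fun z hz => ?_⟩
  · rw [mul_div_mul_right _ _ (hF.ne_zero hFr z hz)]
  · rw [sharp_mul, mul_div_mul_comm, norm_mul, norm_div (sharp F z)]
    exact mul_le_of_le_one_right (norm_nonneg _)
      (div_le_one_of_le₀ (hF.norm_sharp_le hz) (norm_nonneg _))

/-- In L² the elements f/E and f F/(E F) are the same, so multiplication by F becomes an inclusion
of subspaces. -/
theorem hardySubmodule_le_mul {E F : ℂ → ℂ} (hE : HermiteBiehler E) (hF : HermiteBiehler F)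
    (hEr : NoRealZeros E) (hFr : NoRealZeros F) :
    hardySubmodule E ≤ hardySubmodule fun z => E z * F z := by
  rintro u ⟨f, hf, hu⟩
  refine ⟨_, mul_mem_hardySpace hE hF hEr hFr hf, hu.trans (Eventually.of_forall fun t => ?_)⟩
  simp only
  rw [mul_div_mul_right _ _ (hFr t)]

/-- The function `f / E`, `f ∈ hardySpace E`, as an element of `L²(ℝ)`. -/
noncomputable def toL2 {E f : ℂ → ℂ} (hf : f ∈ hardySpace E) : Lp ℂ 2 (volume : Measure ℝ) :=
  hf.2.1.memLp.toLp fun t : ℝ => f t / E t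

theorem coeFn_toL2 {E f : ℂ → ℂ} (hf : f ∈ hardySpace E) :
    toL2 hf =ᵐ[volume] fun t : ℝ => f t / E t :=
  hf.2.1.memLp.coeFn_toLp

theorem toL2_mem {E f : ℂ → ℂ} (hf : f ∈ hardySpace E) : toL2 hf ∈ hardySubmodule E :=
  ⟨f, hf, coeFn_toL2 hf⟩

theorem inner_toL2_kernel {E f : ℂ → ℂ} (hE : HermiteBiehler E) (hEr : NoRealZeros E)
    (hf : f ∈ hardySpace E) {u : Lp ℂ 2 (volume : Measure ℝ)}
    (hu : u =ᵐ[volume] fun t : ℝ => f t / E t) (x : ℝ) :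
    ⟪toL2 (kernel_mem_hardySpace hE hEr x), u⟫_ℂ = f x := by
  rw [L2.inner_def, ← integral_mul_conj_kernel hEr hf x]
  refine integral_congr_ae ?_
  filter_upwards [hu, coeFn_toL2 (kernel_mem_hardySpace hE hEr x)] with t h1 h2
  rw [h1, h2, RCLike.inner_apply]

theorem kernel_self_eq_re {E : ℂ → ℂ} (hE : HermiteBiehler E) (hEr : NoRealZeros E) (x : ℝ) :
    kernel E x x = ((kernel E x x).re : ℂ) := by
  rw [kernel_self_eq_normSq hE hEr, Complex.ofReal_re]

theorem sq_norm_apply_le {E f : ℂ → ℂ} (hE : HermiteBiehler E) (hEr : NoRealZeros E)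
    (hf : f ∈ hardySpace E) (x : ℝ) : ‖f x‖ ^ 2 ≤ (kernel E x x).re * normSq E f := by
  rw [kernel_self_eq_normSq hE hEr, Complex.ofReal_re,
    ← sq_norm_eq_normSq (coeFn_toL2 (kernel_mem_hardySpace hE hEr x)),
    ← sq_norm_eq_normSq (coeFn_toL2 hf), ← inner_toL2_kernel hE hEr hf (coeFn_toL2 hf) x, ← mul_pow]
  exact pow_le_pow_left₀ (norm_nonneg _) (norm_inner_le_norm _ _) 2

/-- Comparison of the norms gives comparison of the kernels on the diagonal. -/
theorem kernel_self_re_le {E₁ E₂ : ℂ → ℂ} (hE₁ : HermiteBiehler E₁) (hE₂ : HermiteBiehler E₂)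
    (h₁ : NoRealZeros E₁) (h₂ : NoRealZeros E₂) (hs : space E₁ ⊆ space E₂) {C : ℝ}
    (hC : ∀ f ∈ space E₁, normSq E₂ f ≤ C * normSq E₁ f) (x : ℝ) :
    (kernel E₁ x x).re ≤ C * (kernel E₂ x x).re := by
  -- The test function is the kernel of E₁ itself: K₁(x,x)² ≤ K₂(x,x) · C · K₁(x,x). It has to lie
  -- in `space`, where the comparison of norms is assumed.
  have hk := kernel_mem_space hE₁ h₁ x
  have hp := kernel_self_re_pos hE₁ h₁ x
  have hp₂ := kernel_self_re_pos hE₂ h₂ x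
  have h3 := sq_norm_apply_le hE₂ h₂ (space_subset_hardySpace hE₂ h₂ (hs hk)) x
  have h4 := hC _ hk
  have h5 : normSq E₁ (kernel E₁ x) = (kernel E₁ x x).re := by
    rw [kernel_self_eq_normSq hE₁ h₁ x, Complex.ofReal_re]
  rw [kernel_self_eq_re hE₁ h₁, Complex.norm_real, Real.norm_of_nonneg hp.le] at h3
  rw [h5] at h4
  have h6 := mul_le_mul_of_nonneg_left h4 hp₂.le
  have h7 : (kernel E₁ x x).re * (kernel E₁ x x).re ≤
      C * (kernel E₂ x x).re * (kernel E₁ x x).re := by linarith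
  exact le_of_mul_le_mul_right h7 hp

/-- The normalized kernels at the real zeros of `B + B*`. -/
noncomputable def normalizedKernel {B : ℂ → ℂ} (hB : HermiteBiehler B) (hBr : NoRealZeros B)
    (x : ℝ) : Lp ℂ 2 (volume : Measure ℝ) :=
  (((√(kernel B x x).re)⁻¹ : ℝ) : ℂ) • toL2 (kernel_mem_hardySpace hB hBr x)

theorem inner_normalizedKernel {B g : ℂ → ℂ} (hB : HermiteBiehler B) (hBr : NoRealZeros B)
    (hg : g ∈ hardySpace B) {u : Lp ℂ 2 (volume : Measure ℝ)}
    (hu : u =ᵐ[volume] fun t : ℝ => g t / B t) (x : ℝ) :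
    ⟪normalizedKernel hB hBr x, u⟫_ℂ = (((√(kernel B x x).re)⁻¹ : ℝ) : ℂ) * g x := by
  rw [normalizedKernel, inner_smul_left, Complex.conj_ofReal, inner_toL2_kernel hB hBr hg hu]

theorem sq_norm_inner_normalizedKernel {B g : ℂ → ℂ} (hB : HermiteBiehler B)
    (hBr : NoRealZeros B) (hg : g ∈ hardySpace B) {u : Lp ℂ 2 (volume : Measure ℝ)}
    (hu : u =ᵐ[volume] fun t : ℝ => g t / B t) (x : ℝ) :
    ‖⟪normalizedKernel hB hBr x, u⟫_ℂ‖ ^ 2 = ‖g x‖ ^ 2 / (kernel B x x).re := by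
  rw [inner_normalizedKernel hB hBr hg hu, norm_mul, mul_pow, Complex.norm_real, Real.norm_eq_abs,
    sq_abs, inv_pow, Real.sq_sqrt (kernel_self_re_pos hB hBr x).le]
  field_simp

theorem orthonormal_normalizedKernel {B : ℂ → ℂ} (hB : HermiteBiehler B) (hBr : NoRealZeros B)
    {ι : Type*} {lam : ι → ℝ} (hinj : Function.Injective lam)
    (h0 : ∀ i, B (lam i) + sharp B (lam i) = 0) :
    Orthonormal ℂ fun i => normalizedKernel hB hBr (lam i) := by
  classical
  rw [orthonormal_iff_ite]
  intro i j
  conv_lhs => rw [normalizedKernel.eq_def hB hBr (lam j), inner_smul_right]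
  rw [inner_normalizedKernel hB hBr (kernel_mem_hardySpace hB hBr (lam j)) (coeFn_toL2 _)]
  split_ifs with h
  · subst h
    have hp := kernel_self_re_pos hB hBr (lam i)
    rw [kernel_self_eq_re hB hBr (lam i), ← Complex.ofReal_mul, ← Complex.ofReal_mul,
      Complex.ofReal_re, ← mul_assoc, ← mul_inv, Real.mul_self_sqrt hp.le, inv_mul_cancel₀ hp.ne',
      Complex.ofReal_one]
  · rw [kernel_of_add_sharp_eq_zero (h0 j) (h0 i) fun h' => h (hinj h'), mul_zero, mul_zero]

/-- For `f` in the Hardy space of `E`, the values of `f F` at the zeros of `E F + E* F*` control the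
norm of `f`. -/
theorem exists_sampling_bounds {E F : ℂ → ℂ} (hE : HermiteBiehler E) (hF : HermiteBiehler F)
    (hEr : NoRealZeros E) (hFr : NoRealZeros F) {ι : Type*} {lam : ι → ℝ}
    (hinj : Function.Injective lam)
    (hlam : ∀ x : ℝ, (∃ i, lam i = x) ↔ E x * F x + sharp (fun z => E z * F z) x = 0) :
    ∃ δ : ℝ, 0 < δ ∧ ∀ f ∈ hardySpace E,
      Summable (fun i => ‖f (lam i) * F (lam i)‖ ^ 2 /
        (kernel (fun z => E z * F z) (lam i) (lam i)).re) ∧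
      δ * normSq E f ≤ ∑' i, ‖f (lam i) * F (lam i)‖ ^ 2 /
        (kernel (fun z => E z * F z) (lam i) (lam i)).re ∧
      ∑' i, ‖f (lam i) * F (lam i)‖ ^ 2 /
        (kernel (fun z => E z * F z) (lam i) (lam i)).re ≤ normSq E f := by
  set B : ℂ → ℂ := fun z => E z * F z with hBdef
  have hB : HermiteBiehler B := hE.mul hF
  have hBr : NoRealZeros B := hEr.mul hFr
  have h0 : ∀ i, B (lam i) + sharp B (lam i) = 0 := fun i => (hlam _).1 ⟨i, rfl⟩
  have he := orthonormal_normalizedKernel hB hBr hinj h0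
  have hvan : ∀ g ∈ hardySpace B, ∀ u : Lp ℂ 2 (volume : Measure ℝ),
      u =ᵐ[volume] (fun t : ℝ => g t / B t) →
      (∀ i, ⟪normalizedKernel hB hBr (lam i), u⟫_ℂ = 0) →
      ∃ a : ℂ, ∀ z, g z = a * (B z + sharp B z) := by
    intro g hg u hu h
    refine exists_eq_const_mul_add_sharp hB hBr hg fun x hx => ?_
    obtain ⟨i, rfl⟩ := (hlam x).2 hx
    have h1 := sq_norm_inner_normalizedKernel hB hBr hg hu (lam i)
    rw [h i, norm_zero, zero_pow two_ne_zero, eq_comm, div_eq_zero_iff] at h1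
    exact norm_eq_zero.1 (pow_eq_zero_iff two_ne_zero |>.1
      (h1.resolve_right (kernel_self_re_pos hB hBr (lam i)).ne'))
  obtain ⟨δ, hδ, hlow⟩ := he.exists_lower_bound (isClosed_hardySubmodule hE hEr)
    (isClosed_hardySubmodule hB hBr) (hardySubmodule_le_mul hE hF hEr hFr)
    (fun i => Submodule.smul_mem _ _ (toL2_mem _))
    -- Elements orthogonal to all the kernels are multiples of (B + B*)/B, so any nonzero one spans
    -- the defect.
    (by
      rintro r ⟨g, hg, hr⟩ r' ⟨g', hg', hr'⟩ h1 h2 hne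
      obtain ⟨a, ha⟩ := hvan g hg r hr h1
      obtain ⟨a', ha'⟩ := hvan g' hg' r' hr' h2
      have ha0 : a ≠ 0 := fun h => hne (by
        rw [Lp.eq_zero_iff_ae_eq_zero]
        filter_upwards [hr] with t ht
        rw [ht, ha, h, zero_mul, zero_div, Pi.zero_apply])
      refine ⟨a' / a, Lp.ext ?_⟩
      filter_upwards [hr, hr', Lp.coeFn_smul (a' / a) r] with t e1 e2 e3
      rw [e3, Pi.smul_apply, e1, e2, ha, ha', smul_eq_mul]
      field_simp)
    -- An element of the smaller space in the defect satisfies f F = a (B + B*), which forces a = 0.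
    (by
      rintro u ⟨f, hf, hu⟩ h1
      have hfF := mul_mem_hardySpace hE hF hEr hFr hf
      have hu' : u =ᵐ[volume] fun t : ℝ => (f t * F t) / B t :=
        hu.trans (Eventually.of_forall fun t => by
          simp only [hBdef]
          rw [mul_div_mul_right _ _ (hFr t)])
      obtain ⟨a, ha⟩ := hvan _ hfF u hu' h1
      have ha0 := eq_zero_of_mul_eq_const_mul hE hF hFr hf ha
      rw [Lp.eq_zero_iff_ae_eq_zero]
      filter_upwards [hu'] with t ht
      rw [ht, ha, ha0, zero_mul, zero_div, Pi.zero_apply])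
  refine ⟨δ, hδ, fun f hf => ?_⟩
  have hu := coeFn_toL2 hf
  have hfF := mul_mem_hardySpace hE hF hEr hFr hf
  have hu' : toL2 hf =ᵐ[volume] fun t : ℝ => (f t * F t) / B t :=
    hu.trans (Eventually.of_forall fun t => by
      simp only [hBdef]
      rw [mul_div_mul_right _ _ (hFr t)])
  have h2 : (fun i => ‖f (lam i) * F (lam i)‖ ^ 2 / (kernel B (lam i) (lam i)).re) =
      fun i => ‖⟪normalizedKernel hB hBr (lam i), toL2 hf⟫_ℂ‖ ^ 2 :=
    funext fun i => (sq_norm_inner_normalizedKernel hB hBr hfF hu' (lam i)).symm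
  rw [h2, ← sq_norm_eq_normSq hu]
  exact ⟨he.inner_products_summable _, hlow _ (toL2_mem hf), he.tsum_inner_products_le _⟩

/-- The kernel of a product on the diagonal, when the phase of `F` is dominated by that of `E`. -/
theorem kernel_mul_self_re_le {E F : ℂ → ℂ} (hE : Differentiable ℂ E) (hF : Differentiable ℂ F)
    (hEr : NoRealZeros E) (hFr : NoRealZeros F) {φE φF : ℝ → ℝ} (hφE : IsPhase E φE)
    (hφF : IsPhase F φF) {C : ℝ} {x : ℝ} (h : deriv φF x ≤ C * deriv φE x) :
    (kernel (fun z => E z * F z) x x).re ≤ (1 + C) * (‖F x‖ ^ 2 * (kernel E x x).re) := by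
  rw [kernel_mul_self_re hE hF, kernel_self_re_eq_deriv_phase hE hEr hφE,
    kernel_self_re_eq_deriv_phase hF hFr hφF, add_mul, one_mul]
  refine add_le_add le_rfl ?_
  have h1 : 0 ≤ ‖E x‖ ^ 2 * ‖F x‖ ^ 2 / Real.pi := by positivity
  calc _ = deriv φF x * (‖E x‖ ^ 2 * ‖F x‖ ^ 2 / Real.pi) := by ring
    _ ≤ C * deriv φE x * (‖E x‖ ^ 2 * ‖F x‖ ^ 2 / Real.pi) := by gcongr
    _ = _ := by ring

end DeBranges

/-! ### Comparison of weights and the sampling theorem. -/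

theorem mainTheorem9 (E₀ E F : ℂ → ℂ)
    (hE₀ : DeBranges.HermiteBiehler E₀) (hE : DeBranges.HermiteBiehler E)
    (hF : DeBranges.HermiteBiehler F)
    (hE₀r : DeBranges.NoRealZeros E₀) (hEr : DeBranges.NoRealZeros E)
    (hFr : DeBranges.NoRealZeros F)
    (hspace : DeBranges.SameSpace E₀ E)
    (φE φF : ℝ → ℝ) (hφE : DeBranges.IsPhase E φE) (hφF : DeBranges.IsPhase F φF)
    (hdom : ∃ C : ℝ, 0 < C ∧ ∀ x : ℝ, deriv φF x ≤ C * deriv φE x) :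
    DeBranges.NormalizedSamplingSet E₀
      (DeBranges.zeroSet
        (fun z => E z * F z + DeBranges.sharp E z * DeBranges.sharp F z)) := by
  open DeBranges in
  obtain ⟨hs, c, C, hc, hC, hcC⟩ := hspace
  obtain ⟨C', hC', hphase⟩ := hdom
  set Λ := zeroSet fun z => E z * F z + sharp E z * sharp F z with hΛ
  have hmem : ∀ z, z ∈ Λ ↔ E z * F z + sharp (fun z => E z * F z) z = 0 := fun z => by
    rw [sharp_mul]
    exact Iff.rfl
  have him : ∀ z ∈ Λ, z.im = 0 := fun z hz => by
    by_contra h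
    exact (hE.mul hF).add_sharp_ne_zero h ((hmem z).1 hz)
  have hre : ∀ z ∈ Λ, ((z.re : ℝ) : ℂ) = z := fun z hz => Complex.ext rfl (by simp [him z hz])
  refine ⟨him, ?_⟩
  obtain ⟨δ, hδ, hsamp⟩ := exists_sampling_bounds hE hF hEr hFr
    (lam := fun z : Λ => (z : ℂ).re)
    (fun z w h => Subtype.ext (by
      rw [← hre z z.2, ← hre w w.2]
      exact congrArg _ h))
    (fun x => by
      rw [← hmem]
      constructor
      · rintro ⟨z, rfl⟩
        rw [hre z z.2]
        exact z.2
      · exact fun hx => ⟨⟨x, hx⟩, Complex.ofReal_re x⟩)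
  have hK1 : ∀ x : ℝ, (kernel E₀ x x).re ≤ C * (kernel E x x).re :=
    kernel_self_re_le hE₀ hE hE₀r hEr hs.le fun f hf => (hcC f hf).2
  have hK2 : ∀ x : ℝ, (kernel E x x).re ≤ c⁻¹ * (kernel E₀ x x).re :=
    kernel_self_re_le hE hE₀ hEr hE₀r hs.ge fun f hf => by
      rw [le_inv_mul_iff₀ hc]
      exact (hcC f (hs.ge hf)).1
  -- This direction only drops the nonnegative term |E|² K_F; the comparison of phases is needed for
  -- the reverse one.
  have hw1 : ∀ (f : ℂ → ℂ) (x : ℝ), ‖f x * F x‖ ^ 2 / (kernel (fun z => E z * F z) x x).re ≤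
      C * (‖f x‖ ^ 2 / (kernel E₀ x x).re) := fun f x => by
    have p0 := kernel_self_re_pos hE₀ hE₀r x
    have p1 := kernel_self_re_pos hE hEr x
    have p2 := kernel_self_re_pos hF hFr x
    have pF : 0 < ‖F x‖ := norm_pos_iff.2 (hFr x)
    rw [kernel_mul_self_re hE.1 hF.1, norm_mul, mul_pow]
    calc _ ≤ ‖f x‖ ^ 2 * ‖F x‖ ^ 2 / (‖F x‖ ^ 2 * (kernel E x x).re) := by
          gcongr
          exact le_add_of_nonneg_right (by positivity)
      _ = C * (‖f x‖ ^ 2 / (C * (kernel E x x).re)) := by field_simp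
      _ ≤ C * (‖f x‖ ^ 2 / (kernel E₀ x x).re) := by
          gcongr
          exact hK1 x
  have hw2 : ∀ (f : ℂ → ℂ) (x : ℝ), ‖f x‖ ^ 2 / (kernel E₀ x x).re ≤
      c⁻¹ * (1 + C') * (‖f x * F x‖ ^ 2 / (kernel (fun z => E z * F z) x x).re) := fun f x => by
    have p0 := kernel_self_re_pos hE₀ hE₀r x
    have p1 := kernel_self_re_pos hE hEr x
    have p3 := kernel_self_re_pos (hE.mul hF) (hEr.mul hFr) x
    have pF : 0 < ‖F x‖ := norm_pos_iff.2 (hFr x)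
    have h1 := kernel_mul_self_re_le hE.1 hF.1 hEr hFr hφE hφF (hphase x)
    have h2 := hK2 x
    rw [norm_mul, mul_pow]
    calc _ = c⁻¹ * (‖f x‖ ^ 2 / (c⁻¹ * (kernel E₀ x x).re)) := by field_simp
      _ ≤ c⁻¹ * (‖f x‖ ^ 2 / (kernel E x x).re) := by gcongr
      _ = c⁻¹ * (1 + C') * (‖f x‖ ^ 2 * ‖F x‖ ^ 2 /
          ((1 + C') * (‖F x‖ ^ 2 * (kernel E x x).re))) := by field_simp
      _ ≤ _ := by gcongr
  -- Lower bound: δ c ‖f‖²_{E₀} ≤ δ ‖f‖²_E, which is at most the sum with the weights of E F, and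
  -- that is at most C times the wanted sum. Upper bound: the wanted sum is at most c⁻¹(1 + C')
  -- times the sum for E F, and the latter is at most ‖f‖²_E ≤ C ‖f‖²_{E₀}.
  refine ⟨δ * c / C, c⁻¹ * (1 + C') * C, by positivity, by positivity, fun f hf => ?_⟩
  have hfE : f ∈ hardySpace E := space_subset_hardySpace hE hEr (hs.le hf)
  obtain ⟨hsum, hlo, hup⟩ := hsamp f hfE
  have hsum' : Summable fun z : Λ => ‖f (z : ℂ).re‖ ^ 2 / (kernel E₀ (z : ℂ).re (z : ℂ).re).re :=
    Summable.of_nonneg_of_le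
      (fun z => div_nonneg (by positivity) (kernel_self_re_pos hE₀ hE₀r _).le)
      (fun z => hw2 f _) (hsum.mul_left _)
  obtain ⟨n1, n2⟩ := hcC f hf
  refine ⟨hsum', ?_, ?_⟩
  · have h1 := hsum.tsum_le_tsum (fun z => hw1 f _) (hsum'.mul_left C)
    rw [tsum_mul_left] at h1
    rw [div_mul_eq_mul_div, div_le_iff₀ hC, mul_assoc]
    have := mul_le_mul_of_nonneg_left n1 hδ.le
    linarith
  · have h1 := hsum'.tsum_le_tsum (fun z => hw2 f _) (hsum.mul_left _)
    rw [tsum_mul_left] at h1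
    refine h1.trans ?_
    rw [mul_assoc _ C]
    exact mul_le_mul_of_nonneg_left (hup.trans n2) (by positivity)
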